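/- Let $k$ be an algebraically closed field, let $N,N'$ be finitely generated free $\mathbf Z$-modules with duals $M,M'$, and let $\Sigma$ be a finite fan of strongly convex rational polyhedral cones in $N_{\mathbf R}=\mathbf R\otimes_{\mathbf Z}N$, with toric variety $\mathbf P=\mathbf P_\Sigma=\bigcup_{\sigma\in\Sigma}\mathbf A_\sigma$, $\mathbf A_\sigma=\operatorname{Spec}k[M\cap\sigma^\vee]$. Let $\sigma'$ be a strongly convex rational polyhedral cone in $N'_{\mathbf R}$, let $\mathbf A=\mathbf A_{\sigma'}$, and let $\pi:\mathbf P\to\mathbf A$ be the equivariant morphism given by a homomorphism $\pi_*:N\to N'$ with $\pi_{*\mathbf R}(\sigma)\subset\sigma'$ for all $\sigma\in\Sigma$. Assume that $\Sigma$ is simplicial and that $m(\Sigma)=\prod_{\sigma\in\Sigma}m(\sigma)$ is nonzero in $k$, where $m(\sigma)$ is the order of $(N\cap\sigma_{\mathbf R})/\sum_\rho\mathbf Z v_\rho$; here $\rho$ runs over the one-dimensional cones of $\Sigma$ contained in $\sigma$, $v_\rho$ is the generator of the monoid $\rho\cap N$, and $\sigma_{\mathbf R}$ is the linear span of $\sigma$.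 Notation. Let $M_{\pi,k}$ be the cokernel of $k\otimes M'\to k\otimes M$, and put $\omega^p_{\mathbf P/\mathbf A}(\log D)=\mathcal O_{\mathbf P}\otimes_k\bigwedge^pM_{\pi,k}$. For a nonsingular $\sigma\in\Sigma$, generated by a part $v_1,\dots,v_c$ of a $\mathbf Z$-basis $v_1,\dots,v_d$ of $N$ with dual basis $u_1,\dots,u_d$, let $\omega^1_{\mathbf A_\sigma}\subset k[M\cap\sigma^\vee]\otimes_{\mathbf Z}M$ be the submodule generated by $\chi^{u_j}\otimes u_j$ for $j\le c$ with $\pi_*(v_j)=0$ and by $1\otimes u_j$ for all other $j$. Let $\omega^1_{\mathbf A_\sigma/\mathbf A}\subset k[M\cap\sigma^\vee]\otimes_kM_{\pi,k}$ be its quotient by the image of $k[M\cap\sigma^\vee]\otimes M'$; these modules define a sheaf $\omega^1_{\mathbf P^{\rm reg}/\mathbf A}$ on $\mathbf P^{\rm reg}=\bigcup_{\sigma\ \text{nonsingular}}\mathbf A_\sigma$. With $j:\mathbf P^{\rm reg}\to\mathbf P$ the inclusion, let $\widetilde\omega^p_{\mathbf P/\mathbf A}=j_*\bigwedge^p\omega^1_{\mathbf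 P^{\rm reg}/\mathbf A}\subset\omega^p_{\mathbf P/\mathbf A}(\log D)$. For $0\le r\le p$ let $W_r\omega^p_{\mathbf P/\mathbf A}(\log D)$ be the image of $\omega^r_{\mathbf P/\mathbf A}(\log D)\otimes\widetilde\omega^{p-r}_{\mathbf P/\mathbf A}\to\omega^p_{\mathbf P/\mathbf A}(\log D)$, $\eta\otimes w\mapsto\eta\wedge w$, and let $W_{-1}\omega^p_{\mathbf P/\mathbf A}(\log D)=0$. Let $\Sigma_\pi(r)$ be the set of $r$-dimensional $\tau\in\Sigma$ with $\pi_{*\mathbf R}(\tau)=0$. For $\tau\in\Sigma_\pi(r)$ let $N_\tau=N/(N\cap\tau_{\mathbf R})$, let $\Sigma_\tau$ be the fan in $N_{\tau,\mathbf R}$ of the images $[\sigma]_\tau$ of the $\sigma\in\Sigma$ containing $\tau$, let $\mathbf P_\tau=\mathbf P_{\Sigma_\tau}$, and let $\iota_\tau:\mathbf P_\tau\to\mathbf P$ be the closed immersion with $\iota_\tau^*\chi^u=\chi^u$ for $u\in\tau^\perp$ and $\iota_\tau^*\chi^u=0$ for $u\notin\tau^\perp$. The morphism $\mathbf P_\tau\to\mathbf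 A$ is induced by $[v]\mapsto\pi_*(v)$. Fix an ordering $v_1,\dots,v_r$ of the $v_\rho$ with $\rho\subset\tau$ a one-dimensional cone of $\Sigma$, and let $\phi_\tau:\bigwedge^rM_{\pi,k}\to k$ be $\eta_1\wedge\dots\wedge\eta_r\mapsto\det(\langle\eta_i,1\otimes v_j\rangle)$. Theorem. For all $0\le r\le p$ and all choices of orderings, $W_{r-1}\omega^p_{\mathbf P/\mathbf A}(\log D)\subset W_r\omega^p_{\mathbf P/\mathbf A}(\log D)$, there is an $\mathcal O_{\mathbf P}$-linear map (the Poincaré residue) $$\mathrm{Res}:W_r\omega^p_{\mathbf P/\mathbf A}(\log D)\to\bigoplus_{\tau\in\Sigma_\pi(r)}\iota_{\tau*}\widetilde\omega^{p-r}_{\mathbf P_\tau/\mathbf A},\qquad \mathrm{Res}(\eta\wedge w)=(\phi_\tau(\eta)\,\iota_\tau^*w)_\tau$$ for $\eta\in\bigwedge^rM_{\pi,k}$ and local sections $w$ of $\widetilde\omega^{p-r}_{\mathbf P/\mathbf A}$, and the sequence of $\mathcal O_{\mathbf P}$-modules $$0\to W_{r-1}\omega^p_{\mathbf P/\mathbf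 A}(\log D)\to W_r\omega^p_{\mathbf P/\mathbf A}(\log D)\xrightarrow{\mathrm{Res}}\bigoplus_{\tau\in\Sigma_\pi(r)}\iota_{\tau*}\widetilde\omega^{p-r}_{\mathbf P_\tau/\mathbf A}\to0$$ is exact. -/

import Mathlib

open CategoryTheory Limits AlgebraicGeometry TopologicalSpace Module
open scoped TensorProduct

universe u

namespace Toric

/-! ### Cones and fans -/

section Cones

variable {N : Type u} [AddCommGroup N]

/-- The real extension of an element `u` of `M = Hom(N, ℤ)`: the functional `⟨u, ·⟩` on
`N_ℝ = ℝ ⊗ N`. -/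
noncomputable def pair (u : Dual ℤ N) : Dual ℝ (ℝ ⊗[ℤ] N) := Dual.baseChange ℝ u

/-- A lattice point of `N`, as an element of `N_ℝ`. -/
noncomputable def pt (v : N) : ℝ ⊗[ℤ] N := (1 : ℝ) ⊗ₜ[ℤ] v

@[simp] lemma pair_pt (u : Dual ℤ N) (v : N) : pair u (pt v) = (u v : ℝ) := by
  simp [pair, pt]

@[simp] lemma pair_add (u u' : Dual ℤ N) (x : ℝ ⊗[ℤ] N) :
    pair (u + u') x = pair u x + pair u' x := by
  simp [pair]

@[simp] lemma pair_zero (x : ℝ ⊗[ℤ] N) : pair (0 : Dual ℤ N) x = 0 := by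
  simp [pair]

variable (N) in
/-- Convex cones (with apex) in `N_ℝ`. -/
abbrev Cone := PointedCone ℝ (ℝ ⊗[ℤ] N)

/-- Rational polyhedral: generated by finitely many lattice points. -/
def IsRationalPolyhedral (σ : Cone N) : Prop :=
  ∃ S : Set N, S.Finite ∧ σ = PointedCone.hull ℝ (pt '' S)

/-- Strongly convex: the cone contains no line. -/
def IsStronglyConvex (σ : Cone N) : Prop := (σ : ConvexCone ℝ (ℝ ⊗[ℤ] N)).Salient

/-- `τ` is the face `σ ∩ u^⊥` of `σ` for some `u ∈ M ∩ σ^∨`. -/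
def IsFace (τ σ : Cone N) : Prop :=
  ∃ u : Dual ℤ N, (∀ x ∈ σ, 0 ≤ pair u x) ∧ ∀ x, x ∈ τ ↔ x ∈ σ ∧ pair u x = 0

lemma IsFace.le {τ σ : Cone N} (h : IsFace τ σ) : τ ≤ σ := by
  obtain ⟨u, -, hu⟩ := h
  exact fun x hx => ((hu x).1 hx).1

lemma IsFace.mem_of_add_mem {τ σ : Cone N} (h : IsFace τ σ) {x y : ℝ ⊗[ℤ] N} (hx : x ∈ σ)
    (hy : y ∈ σ) (hxy : x + y ∈ τ) : x ∈ τ := by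
  obtain ⟨u, hu0, hu⟩ := h
  have h1 := ((hu _).1 hxy).2
  rw [map_add] at h1
  have h2 := hu0 x hx
  have h3 := hu0 y hy
  exact (hu x).2 ⟨hx, by linarith⟩

variable (N) in
/-- A finite fan of strongly convex rational polyhedral cones in `N_ℝ`. -/
structure Fan where
  cones : Set (Cone N)
  finite : cones.Finite
  rational : ∀ σ ∈ cones, IsRationalPolyhedral σ
  stronglyConvex : ∀ σ ∈ cones, IsStronglyConvex σ
  face_mem : ∀ σ ∈ cones, ∀ τ, IsFace τ σ → τ ∈ cones
  inter : ∀ σ ∈ cones, ∀ σ' ∈ cones, IsFace (σ ⊓ σ') σ ∧ IsFace (σ ⊓ σ') σ'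

lemma Fan.inf_mem (F : Fan N) {σ σ' : Cone N} (h : σ ∈ F.cones) (h' : σ' ∈ F.cones) :
    σ ⊓ σ' ∈ F.cones :=
  F.face_mem σ h _ (F.inter σ h σ' h').1

lemma Fan.isFace (F : Fan N) {τ σ : Cone N} (h : τ ∈ F.cones) (h' : σ ∈ F.cones) (hle : τ ≤ σ) :
    IsFace τ σ := by
  have := (F.inter τ h σ h').2
  rwa [inf_eq_left.2 hle] at this

/-- The subspace `σ_ℝ` of `N_ℝ` generated by `σ`. -/
def linSpan (σ : Cone N) : Submodule ℝ (ℝ ⊗[ℤ] N) := Submodule.span ℝ (σ : Set (ℝ ⊗[ℤ] N))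

/-- The dimension of a cone. -/
noncomputable def coneDim (σ : Cone N) : ℕ := finrank ℝ (linSpan σ)

/-- The sublattice `N ∩ σ_ℝ` of `N`. -/
def lat (σ : Cone N) : Submodule ℤ N where
  carrier := {v | pt v ∈ linSpan σ}
  add_mem' := fun {a b} ha hb => by
    simpa [pt, TensorProduct.tmul_add] using (linSpan σ).add_mem ha hb
  zero_mem' := by simp [pt]
  smul_mem' := fun n v hv => by
    have : pt (n • v) = (n : ℝ) • pt v := by
      rw [pt, pt, TensorProduct.tmul_smul, TensorProduct.smul_tmul', TensorProduct.smul_tmul']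
      simp
    simpa [this] using (linSpan σ).smul_mem (n : ℝ) hv

lemma mem_lat {σ : Cone N} {v : N} : v ∈ lat σ ↔ pt v ∈ linSpan σ := Iff.rfl

/-- `v` is the generator of the monoid `ρ ∩ N`. -/
def IsPrimitiveGenerator (ρ : Cone N) (v : N) : Prop :=
  ∀ x : N, pt x ∈ ρ ↔ ∃ n : ℕ, x = n • v

/-- The set of all `v_ρ` for the one-dimensional cones `ρ ∈ Σ` contained in `σ`. -/
def Fan.rayGens (F : Fan N) (σ : Cone N) : Set N :=
  {v | ∃ ρ ∈ F.cones, coneDim ρ = 1 ∧ ρ ≤ σ ∧ IsPrimitiveGenerator ρ v}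

/-- A fan is simplicial if each of its cones is generated by linearly independent vectors. -/
def Fan.IsSimplicial (F : Fan N) : Prop := ∀ σ ∈ F.cones, PointedCone.IsSimplicial σ

/-- The order `m(σ)` of the quotient of `N ∩ σ_ℝ` by `∑ ℤ v_ρ`, where `ρ` ranges over the rays
of `σ`. -/
noncomputable def Fan.mult (F : Fan N) (σ : Cone N) : ℕ :=
  (Submodule.span ℤ (F.rayGens σ)).toAddSubgroup.relIndex (lat σ).toAddSubgroup

/-- `m(Σ) = ∏ m(σ)`. -/
noncomputable def Fan.totalMult (F : Fan N) : ℕ := ∏ σ ∈ F.finite.toFinset, F.mult σ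

/-- `b` is a `ℤ`-basis of `N` of which the members with index in `S` generate `σ`. -/
def IsAdapted (σ : Cone N) {d : ℕ} (b : Basis (Fin d) ℤ N) (S : Set (Fin d)) : Prop :=
  σ = PointedCone.hull ℝ (pt '' (b '' S))

/-- A nonsingular cone: generated by a part of a `ℤ`-basis of `N`. -/
def IsNonsingular (σ : Cone N) : Prop :=
  ∃ (d : ℕ) (b : Basis (Fin d) ℤ N) (S : Set (Fin d)), IsAdapted σ b S

end Cones

/-! ### The fan of an orbit closure -/

section Star

variable {N : Type u} [AddCommGroup N]

/-- The lattice `N_τ = N / (N ∩ τ_ℝ)`. -/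
abbrev QuotLattice (τ : Cone N) : Type u := N ⧸ lat τ

/-- The projection `N_ℝ → N_{τ,ℝ}`, `v ↦ [v]_τ`. -/
noncomputable def projR (τ : Cone N) : ℝ ⊗[ℤ] N →ₗ[ℝ] ℝ ⊗[ℤ] QuotLattice τ :=
  (lat τ).mkQ.baseChange ℝ

lemma projR_pt (τ : Cone N) (v : N) : projR τ (pt v) = pt ((lat τ).mkQ v) := by
  simp [projR, pt]

lemma mem_linSpan {τ : Cone N} {x : ℝ ⊗[ℤ] N} :
    x ∈ linSpan τ ↔ ∃ a ∈ τ, ∃ b ∈ τ, x + a = b := by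
  constructor
  · intro hx
    induction hx using Submodule.span_induction with
    | mem x h => exact ⟨0, τ.zero_mem, x, h, by simp⟩
    | zero => exact ⟨0, τ.zero_mem, 0, τ.zero_mem, by simp⟩
    | add x y _ _ hx hy =>
      obtain ⟨a, ha, b, hb, h⟩ := hx
      obtain ⟨a', ha', b', hb', h'⟩ := hy
      exact ⟨a + a', τ.add_mem ha ha', b + b', τ.add_mem hb hb', by rw [← h, ← h']; abel⟩
    | smul c x _ hx =>
      obtain ⟨a, ha, b, hb, h⟩ := hx
      rcases le_total 0 c with hc | hc
      · exact ⟨c • a, PointedCone.smul_mem τ hc ha, c • b, PointedCone.smul_mem τ hc hb,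
          by rw [← h, smul_add]⟩
      · refine ⟨(-c) • b, PointedCone.smul_mem τ (by linarith) hb, (-c) • a,
          PointedCone.smul_mem τ (by linarith) ha, ?_⟩
        rw [← h, smul_add, neg_smul, neg_smul]; abel
  · rintro ⟨a, ha, b, hb, h⟩
    have : x = b - a := by rw [← h]; abel
    rw [this]
    exact Submodule.sub_mem _ (Submodule.subset_span hb) (Submodule.subset_span ha)

lemma projR_eq_zero {τ : Cone N} (hτ : IsRationalPolyhedral τ) {x : ℝ ⊗[ℤ] N} :
    projR τ x = 0 ↔ x ∈ linSpan τ := by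
  have hex : Function.Exact (lat τ).subtype (lat τ).mkQ := LinearMap.exact_subtype_mkQ _
  constructor
  · intro h
    obtain ⟨y, rfl⟩ := (lTensor_exact ℝ hex (Submodule.mkQ_surjective _) x).1 h
    have key : ∀ y, (LinearMap.lTensor ℝ (lat τ).subtype) y ∈ linSpan τ := by
      intro y
      induction y using TensorProduct.induction_on with
      | zero => simp
      | tmul c v =>
        have h1 : (LinearMap.lTensor ℝ (lat τ).subtype) (c ⊗ₜ v) = c • pt (v : N) := by
          simp [pt, TensorProduct.smul_tmul']
        rw [h1]
        exact Submodule.smul_mem _ _ v.2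
      | add a b ha hb => rw [map_add]; exact Submodule.add_mem _ ha hb
    exact key y
  · intro h
    obtain ⟨S, -, hS⟩ := hτ
    have hτ0 : ∀ y ∈ τ, projR τ y = 0 := by
      intro y hy
      have hle : PointedCone.hull ℝ (pt '' S) ≤
          PointedCone.ofSubmodule (LinearMap.ker (projR τ)) := by
        refine Submodule.span_le.2 ?_
        rintro _ ⟨v, hv, rfl⟩
        have hv' : v ∈ lat τ := by
          refine mem_lat.2 (Submodule.subset_span ?_)
          have : pt v ∈ PointedCone.hull ℝ (pt '' S) :=
            Submodule.subset_span (Set.mem_image_of_mem _ hv)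
          rw [← hS] at this
          exact this
        change projR τ (pt v) = 0
        rw [projR_pt, Submodule.mkQ_apply, (Submodule.Quotient.mk_eq_zero _).2 hv']
        simp [pt]
      rw [hS] at hy
      exact hle hy
    obtain ⟨a, ha, b, hb, hab⟩ := mem_linSpan.1 h
    have := congrArg (projR τ) hab
    rwa [map_add, hτ0 a ha, hτ0 b hb, add_zero] at this

lemma pair_projR (τ : Cone N) (u : Dual ℤ (QuotLattice τ)) (x : ℝ ⊗[ℤ] N) :
    pair u (projR τ x) = pair (u ∘ₗ (lat τ).mkQ) x := by
  induction x using TensorProduct.induction_on with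
  | zero => simp
  | tmul c v => simp [pair, projR]
  | add a b ha hb => rw [map_add, map_add, map_add, ha, hb]

lemma pair_eq_zero_of_mem_linSpan {τ : Cone N} {u : Dual ℤ N} (hu : ∀ x ∈ τ, pair u x = 0)
    {x : ℝ ⊗[ℤ] N} (hx : x ∈ linSpan τ) : pair u x = 0 := by
  have : linSpan τ ≤ LinearMap.ker (pair u) := Submodule.span_le.2 hu
  exact this hx

lemma lat_le_ker {τ : Cone N} {u : Dual ℤ N} (hu : ∀ x ∈ τ, pair u x = 0) :
    lat τ ≤ LinearMap.ker u := by
  intro v hv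
  have := pair_eq_zero_of_mem_linSpan hu hv
  rw [pair_pt] at this
  exact_mod_cast this

/-- An element `u ∈ M ∩ τ^⊥`, as an element of `M_τ = Hom(N_τ, ℤ)`. -/
def descend {τ : Cone N} (u : Dual ℤ N) (hu : ∀ x ∈ τ, pair u x = 0) :
    Dual ℤ (QuotLattice τ) :=
  (lat τ).liftQ u (lat_le_ker hu)

lemma descend_comp {τ : Cone N} (u : Dual ℤ N) (hu : ∀ x ∈ τ, pair u x = 0) :
    descend u hu ∘ₗ (lat τ).mkQ = u := Submodule.liftQ_mkQ _ _ _

lemma pair_descend {τ : Cone N} (u : Dual ℤ N) (hu : ∀ x ∈ τ, pair u x = 0) (x : ℝ ⊗[ℤ] N) :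
    pair (descend u hu) (projR τ x) = pair u x := by
  rw [pair_projR, descend_comp]

/-- The image `[σ]_τ` of `σ` in `N_{τ,ℝ}`. -/
noncomputable def starCone (τ σ : Cone N) : Cone (QuotLattice τ) := PointedCone.map (projR τ) σ

lemma mem_starCone {τ σ : Cone N} {y : ℝ ⊗[ℤ] QuotLattice τ} :
    y ∈ starCone τ σ ↔ ∃ x ∈ σ, projR τ x = y := Iff.rfl

lemma starCone_mono (τ : Cone N) {σ σ' : Cone N} (h : σ ≤ σ') :
    starCone τ σ ≤ starCone τ σ' := by
  rintro _ ⟨x, hx, rfl⟩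
  exact ⟨x, h hx, rfl⟩

lemma Fan.mem_of_projR_eq (F : Fan N) {τ σ σ' : Cone N} (hτ : τ ∈ F.cones) (hσ : σ ∈ F.cones)
    (hσ' : σ' ∈ F.cones) (h : τ ≤ σ) (h' : τ ≤ σ') {x y : ℝ ⊗[ℤ] N} (hx : x ∈ σ) (hy : y ∈ σ')
    (hxy : projR τ x = projR τ y) : x ∈ σ' := by
  have h0 : projR τ (x - y) = 0 := by rw [map_sub, hxy, sub_self]
  obtain ⟨a, ha, b, hb, hab⟩ := mem_linSpan.1 ((projR_eq_zero (F.rational τ hτ)).1 h0)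
  have e : x + a = y + b := by rw [← hab]; abel
  have hmem : x + a ∈ σ ⊓ σ' :=
    ⟨σ.add_mem hx (h ha), by rw [e]; exact σ'.add_mem hy (h' hb)⟩
  exact ((F.inter σ hσ σ' hσ').1.mem_of_add_mem hx (h ha) hmem).2

lemma Fan.le_of_starCone_le (F : Fan N) {τ σ σ' : Cone N} (hτ : τ ∈ F.cones) (hσ : σ ∈ F.cones)
    (hσ' : σ' ∈ F.cones) (h : τ ≤ σ) (h' : τ ≤ σ') (hle : starCone τ σ ≤ starCone τ σ') :
    σ ≤ σ' := by
  intro x hx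
  obtain ⟨y, hy, hyx⟩ := hle (show projR τ x ∈ starCone τ σ from ⟨x, hx, rfl⟩)
  exact F.mem_of_projR_eq hτ hσ hσ' h h' hx hy hyx.symm

lemma Fan.starCone_inf (F : Fan N) {τ σ σ' : Cone N} (hτ : τ ∈ F.cones) (hσ : σ ∈ F.cones)
    (hσ' : σ' ∈ F.cones) (h : τ ≤ σ) (h' : τ ≤ σ') :
    starCone τ σ ⊓ starCone τ σ' = starCone τ (σ ⊓ σ') := by
  apply le_antisymm
  · rintro _ ⟨⟨x, hx, rfl⟩, ⟨y, hy, hyx⟩⟩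
    exact ⟨x, ⟨hx, F.mem_of_projR_eq hτ hσ hσ' h h' hx hy hyx.symm⟩, rfl⟩
  · exact le_inf (starCone_mono τ inf_le_left) (starCone_mono τ inf_le_right)

lemma pair_eq_zero_of_le {τ τ' σ : Cone N} {u : Dual ℤ N}
    (hu : ∀ x, x ∈ τ' ↔ x ∈ σ ∧ pair u x = 0) (h : τ ≤ τ') :
    ∀ x ∈ τ, pair u x = 0 := fun x hx => ((hu x).1 (h hx)).2

lemma IsFace.starCone {τ τ' σ : Cone N} (hf : IsFace τ' σ) (h : τ ≤ τ') :
    IsFace (starCone τ τ') (starCone τ σ) := by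
  obtain ⟨u, hu0, hu⟩ := hf
  refine ⟨descend u (pair_eq_zero_of_le hu h), ?_, ?_⟩
  · rintro _ ⟨x, hx, rfl⟩
    exact (hu0 x hx).trans_eq (pair_descend u _ x).symm
  · intro y
    constructor
    · rintro ⟨x, hx, rfl⟩
      exact ⟨⟨x, ((hu x).1 hx).1, rfl⟩, (pair_descend u _ x).trans ((hu x).1 hx).2⟩
    · rintro ⟨⟨x, hx, rfl⟩, hy⟩
      exact ⟨x, (hu x).2 ⟨hx, (pair_descend u _ x).symm.trans hy⟩, rfl⟩

/-- The fan `Σ_τ` in `N_{τ,ℝ}` of all `[σ]_τ` with `τ ⊂ σ ∈ Σ`. -/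
noncomputable def Fan.star (F : Fan N) (τ : Cone N) (hτ : τ ∈ F.cones) : Fan (QuotLattice τ) where
  cones := {σ' | ∃ σ ∈ F.cones, τ ≤ σ ∧ σ' = starCone τ σ}
  finite := by
    refine (F.finite.image (starCone τ)).subset ?_
    rintro _ ⟨σ, hσ, -, rfl⟩
    exact ⟨σ, hσ, rfl⟩
  rational := by
    rintro _ ⟨σ, hσ, -, rfl⟩
    obtain ⟨S, hS, rfl⟩ := F.rational σ hσ
    refine ⟨(lat τ).mkQ '' S, hS.image _, ?_⟩
    rw [starCone, PointedCone.map, PointedCone.hull, Submodule.map_span]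
    congr 1
    ext y
    simp only [Set.mem_image, exists_exists_and_eq_and]
    constructor
    · rintro ⟨v, hv, rfl⟩
      exact ⟨v, hv, (projR_pt τ v).symm⟩
    · rintro ⟨v, hv, rfl⟩
      exact ⟨v, hv, projR_pt τ v⟩
  stronglyConvex := by
    rintro _ ⟨σ, hσ, hle, rfl⟩ _ ⟨x, hx, rfl⟩ hne hneg
    apply hne
    obtain ⟨y, hy, hyx⟩ := hneg
    replace hyx : projR τ y = - projR τ x := hyx
    change projR τ x = 0
    have h0 : projR τ (x + y) = 0 := by rw [map_add, hyx, add_neg_cancel]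
    obtain ⟨a, ha, b, hb, hab⟩ := mem_linSpan.1 ((projR_eq_zero (F.rational τ hτ)).1 h0)
    have hf := F.isFace hτ hσ hle
    have : x ∈ τ := hf.mem_of_add_mem hx (σ.add_mem hy (hle ha))
      (by rw [← add_assoc, hab]; exact hb)
    exact (projR_eq_zero (F.rational τ hτ)).2 (Submodule.subset_span this)
  face_mem := by
    rintro _ ⟨σ, hσ, hle, rfl⟩ τ' ⟨u, hu0, hu⟩
    let σ₁ : Cone N :=
      σ ⊓ PointedCone.ofSubmodule (LinearMap.ker (pair (u ∘ₗ (lat τ).mkQ)))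
    have h1 : ∀ x, x ∈ σ₁ ↔ x ∈ σ ∧ pair (u ∘ₗ (lat τ).mkQ) x = 0 := fun x => Iff.rfl
    refine ⟨σ₁, F.face_mem σ hσ σ₁ ⟨u ∘ₗ (lat τ).mkQ, ?_, h1⟩, ?_, ?_⟩
    · intro x hx
      rw [← pair_projR]
      exact hu0 _ ⟨x, hx, rfl⟩
    · intro x hx
      refine (h1 x).2 ⟨hle hx, ?_⟩
      rw [← pair_projR, (projR_eq_zero (F.rational τ hτ)).2 (Submodule.subset_span hx), map_zero]
    · ext y
      rw [hu]
      constructor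
      · rintro ⟨⟨x, hx, rfl⟩, hy⟩
        exact ⟨x, (h1 x).2 ⟨hx, (pair_projR τ u x).symm.trans hy⟩, rfl⟩
      · rintro ⟨x, hx, rfl⟩
        exact ⟨⟨x, ((h1 x).1 hx).1, rfl⟩, (pair_projR τ u x).trans ((h1 x).1 hx).2⟩
  inter := by
    rintro _ ⟨σ, hσ, hle, rfl⟩ _ ⟨σ', hσ', hle', rfl⟩
    rw [F.starCone_inf hτ hσ hσ' hle hle']
    exact ⟨(F.inter σ hσ σ' hσ').1.starCone (le_inf hle hle'),
      (F.inter σ hσ σ' hσ').2.starCone (le_inf hle hle')⟩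

end Star

/-! ### The toric variety of a fan -/

section Variety

variable (k : Type u) [Field k] {N : Type u} [AddCommGroup N]

/-- The monoid `M ∩ σ^∨`. -/
def dualMonoid (σ : Cone N) : AddSubmonoid (Dual ℤ N) where
  carrier := {u | ∀ x ∈ σ, 0 ≤ pair u x}
  add_mem' := fun ha hb x hx => by rw [pair_add]; exact add_nonneg (ha x hx) (hb x hx)
  zero_mem' := fun x _ => (pair_zero x).ge

variable {k} in
lemma dualMonoid_anti {τ σ : Cone N} (h : τ ≤ σ) : dualMonoid σ ≤ dualMonoid τ :=
  fun _ hu x hx => hu x (h hx)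

/-- The coordinate ring `k[M ∩ σ^∨]` of the affine toric variety `A_σ`. -/
abbrev CoordRing (σ : Cone N) : Type u := AddMonoidAlgebra k (dualMonoid σ)

/-- The character `χ^u`, for `u ∈ M ∩ σ^∨`. -/
noncomputable def chi {σ : Cone N} (u : dualMonoid σ) : CoordRing k σ :=
  AddMonoidAlgebra.single u 1

/-- The inclusion `k[M ∩ σ^∨] ⊂ k[M ∩ τ^∨]` for `τ ⊂ σ`. -/
noncomputable def coordMap {τ σ : Cone N} (h : τ ≤ σ) : CoordRing k σ →ₐ[k] CoordRing k τ :=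
  AddMonoidAlgebra.mapDomainAlgHom k k (AddSubmonoid.inclusion (dualMonoid_anti h))

lemma coordMap_single {τ σ : Cone N} (h : τ ≤ σ) (u : dualMonoid σ) (c : k) :
    coordMap k h (AddMonoidAlgebra.single u c) =
      AddMonoidAlgebra.single (AddSubmonoid.inclusion (dualMonoid_anti h) u) c := by
  simp [coordMap]

lemma coordMap_chi {τ σ : Cone N} (h : τ ≤ σ) (u : dualMonoid σ) :
    coordMap k h (chi k u) = chi k (AddSubmonoid.inclusion (dualMonoid_anti h) u) :=
  coordMap_single k h u 1

/-- If `τ = σ ∩ m^⊥`, then `k[M ∩ τ^∨]` is the localization of `k[M ∩ σ^∨]` at `χ^m`. -/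
lemma isLocalization_coordMap {τ σ : Cone N} (hσ : IsRationalPolyhedral σ) (h : τ ≤ σ)
    (m : dualMonoid σ) (hm : ∀ x, x ∈ τ ↔ x ∈ σ ∧ pair m.1 x = 0) :
    letI := (coordMap k h).toRingHom.toAlgebra
    IsLocalization.Away (chi k m) (CoordRing k τ) := by
  let _ := (coordMap k h).toRingHom.toAlgebra
  have hmap : ∀ u c, algebraMap (CoordRing k σ) (CoordRing k τ) (AddMonoidAlgebra.single u c) =
      AddMonoidAlgebra.single (AddSubmonoid.inclusion (dualMonoid_anti h) u) c :=
    fun u c => coordMap_single k h u c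
  have hneg : -m.1 ∈ dualMonoid τ := by
    intro x hx
    have h1 : pair (-m.1) x + pair m.1 x = 0 := by rw [← pair_add]; simp
    have h2 := ((hm x).1 hx).2
    linarith
  have hpow : ∀ n : ℕ, algebraMap (CoordRing k σ) (CoordRing k τ) (chi k m ^ n) =
      AddMonoidAlgebra.single (AddSubmonoid.inclusion (dualMonoid_anti h) (n • m)) 1 := by
    intro n
    rw [chi, AddMonoidAlgebra.single_pow, one_pow, hmap]
  refine isLocalization_iff _ _ |>.2 ⟨?_, ?_, ?_⟩
  · rintro ⟨_, n, rfl⟩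
    rw [map_pow]
    apply IsUnit.pow
    refine IsUnit.of_mul_eq_one (AddMonoidAlgebra.single ⟨-m.1, hneg⟩ 1) ?_
    rw [chi, hmap, AddMonoidAlgebra.single_mul_single, AddMonoidAlgebra.one_def]
    congr 1
    · ext1; simp
    · simp
  · intro z
    suffices hs : ∃ (n : ℕ) (y : CoordRing k σ),
        z * algebraMap (CoordRing k σ) (CoordRing k τ) (chi k m ^ n) = algebraMap _ _ y by
      obtain ⟨n, y, hy⟩ := hs
      exact ⟨(y, ⟨_, n, rfl⟩), hy⟩
    induction z using AddMonoidAlgebra.induction_linear with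
    | zero => exact ⟨0, 0, by simp⟩
    | add x y hx hy =>
      obtain ⟨n, a, ha⟩ := hx
      obtain ⟨n', b, hb⟩ := hy
      refine ⟨n + n', a * chi k m ^ n' + b * chi k m ^ n, ?_⟩
      rw [map_add, map_mul, map_mul, ← ha, ← hb, pow_add, map_mul]
      ring
    | single u c =>
      obtain ⟨S, hS, rfl⟩ := hσ
      have hgen : ∀ v ∈ S, pt v ∈ PointedCone.hull ℝ (pt '' S) := fun v hv =>
        Submodule.subset_span (Set.mem_image_of_mem _ hv)
      let n : ℕ := ∑ v ∈ hS.toFinset, (u.1 v).natAbs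
      have hn : ∀ v ∈ S, 0 ≤ u.1 v + n * m.1 v := by
        intro v hv
        have h0 : (0 : ℝ) ≤ pair m.1 (pt v) := m.2 _ (hgen v hv)
        rw [pair_pt] at h0
        have h0' : 0 ≤ m.1 v := by exact_mod_cast h0
        rcases h0'.eq_or_lt with h1 | h1
        · have hmem : pt v ∈ τ := (hm _).2 ⟨hgen v hv, by rw [pair_pt, ← h1]; simp⟩
          have h2 : (0 : ℝ) ≤ pair u.1 (pt v) := u.2 _ hmem
          rw [pair_pt] at h2
          rw [← h1, mul_zero, add_zero]
          exact_mod_cast h2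
        · have h2 : (u.1 v).natAbs ≤ n :=
            Finset.single_le_sum (f := fun v => (u.1 v).natAbs) (fun _ _ => Nat.zero_le _)
              (hS.mem_toFinset.2 hv)
          have h3 : (n : ℤ) ≤ n * m.1 v := le_mul_of_one_le_right (by positivity) h1
          omega
      have hmem : u.1 + n • m.1 ∈ dualMonoid (PointedCone.hull ℝ (pt '' S)) := by
        intro x hx
        have hle : PointedCone.hull ℝ (pt '' S) ≤
            PointedCone.comap (pair (u.1 + n • m.1)) (PointedCone.positive ℝ ℝ) := by
          refine Submodule.span_le.2 ?_
          rintro _ ⟨v, hv, rfl⟩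
          change 0 ≤ pair (u.1 + n • m.1) (pt v)
          rw [pair_pt]
          have := hn v hv
          simp only [LinearMap.add_apply, LinearMap.smul_apply, nsmul_eq_mul]
          exact_mod_cast this
        exact hle hx
      refine ⟨n, AddMonoidAlgebra.single ⟨_, hmem⟩ c, ?_⟩
      rw [hpow, hmap, AddMonoidAlgebra.single_mul_single, mul_one]
      congr 1
  · intro x y hxy
    refine ⟨1, ?_⟩
    have hinj : Function.Injective (algebraMap (CoordRing k σ) (CoordRing k τ)) :=
      AddMonoidAlgebra.mapDomain_injective (AddSubmonoid.inclusion_injective _)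
    rw [hinj hxy]

lemma isOpenImmersion_coordMap {τ σ : Cone N} (hσ : IsRationalPolyhedral σ) (h : IsFace τ σ) :
    IsOpenImmersion (Spec.map (CommRingCat.ofHom (coordMap k h.le).toRingHom)) := by
  obtain ⟨m, hm0, hm⟩ := id h
  have := isLocalization_coordMap k hσ h.le ⟨m, hm0⟩ hm
  let _ := (coordMap k h.le).toRingHom.toAlgebra
  exact IsOpenImmersion.of_isLocalization (S := CoordRing k τ) (chi k (σ := σ) ⟨m, hm0⟩)

lemma range_coordMap {τ σ : Cone N} (hσ : IsRationalPolyhedral σ) (h : τ ≤ σ)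
    (m : dualMonoid σ) (hm : ∀ x, x ∈ τ ↔ x ∈ σ ∧ pair m.1 x = 0) :
    Set.range (PrimeSpectrum.comap (coordMap k h).toRingHom) =
      PrimeSpectrum.basicOpen (chi k m) := by
  have := isLocalization_coordMap k hσ h m hm
  let _ := (coordMap k h).toRingHom.toAlgebra
  exact PrimeSpectrum.localization_away_comap_range (CoordRing k τ) (chi k m)

/-- The diagram of the affine toric varieties `A_σ = Spec k[M ∩ σ^∨]`, for `σ ∈ Σ`, and of the
inclusions `A_τ ⊂ A_σ` for `τ ⊂ σ`. -/
noncomputable def Fan.charts (F : Fan N) : F.cones ⥤ Scheme.{u} where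
  obj σ := Spec (.of (CoordRing k σ.1))
  map f := Spec.map (CommRingCat.ofHom (coordMap k (leOfHom f)).toRingHom)
  map_id σ := by
    rw [← Spec.map_id]
    congr 1
    ext1
    refine RingHom.ext fun x => ?_
    induction x using AddMonoidAlgebra.induction_linear with
    | zero => simp
    | add x y hx hy => rw [map_add, hx, hy, map_add]
    | single u c => exact coordMap_single k le_rfl u c
  map_comp f g := by
    rw [← Spec.map_comp, ← CommRingCat.ofHom_comp]
    congr 2
    refine RingHom.ext fun x => ?_
    induction x using AddMonoidAlgebra.induction_linear with
    | zero => simp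
    | add x y hx hy => rw [map_add, hx, hy, map_add]
    | single u c =>
      refine (coordMap_single k (leOfHom (f ≫ g)) u c).trans ?_
      change _ = coordMap k (leOfHom f) (coordMap k (leOfHom g) _)
      rw [coordMap_single, coordMap_single]
      rfl

instance (F : Fan N) {τ σ : F.cones} (f : τ ⟶ σ) : IsOpenImmersion ((F.charts k).map f) :=
  isOpenImmersion_coordMap k (F.rational _ σ.2) (F.isFace τ.2 σ.2 (leOfHom f))

instance (F : Fan N) : (F.charts k ⋙ Scheme.forget).IsLocallyDirected where
  cond {τ₁ τ₂ σ} f₁ f₂ x₁ x₂ h := by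
    obtain ⟨m₁, hm₁, h₁⟩ := F.isFace τ₁.2 σ.2 (leOfHom f₁)
    obtain ⟨m₂, hm₂, h₂⟩ := F.isFace τ₂.2 σ.2 (leOfHom f₂)
    let M₁ : dualMonoid σ.1 := ⟨m₁, hm₁⟩
    let M₂ : dualMonoid σ.1 := ⟨m₂, hm₂⟩
    let τ : F.cones := ⟨τ₁.1 ⊓ τ₂.1, F.inf_mem τ₁.2 τ₂.2⟩
    have hτ₁ : τ ≤ τ₁ := inf_le_left (a := τ₁.1)
    have hτ₂ : τ ≤ τ₂ := inf_le_right (a := τ₁.1)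
    have hτ : ∀ x, x ∈ τ.1 ↔ x ∈ σ.1 ∧ pair (M₁ + M₂).1 x = 0 := by
      intro x
      change x ∈ τ₁.1 ∧ x ∈ τ₂.1 ↔ x ∈ σ.1 ∧ pair (m₁ + m₂) x = 0
      rw [h₁, h₂, pair_add]
      constructor
      · rintro ⟨⟨a, b⟩, -, c⟩
        exact ⟨a, by rw [b, c, add_zero]⟩
      · rintro ⟨a, b⟩
        have := hm₁ x a
        have := hm₂ x a
        exact ⟨⟨a, by linarith⟩, a, by linarith⟩
    let y : PrimeSpectrum (CoordRing k σ.1) := (F.charts k).map f₁ x₁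
    have hy₁ : y ∈ PrimeSpectrum.basicOpen (chi k M₁) := by
      have := range_coordMap k (F.rational _ σ.2) (leOfHom f₁) M₁ h₁
      exact this.le ⟨x₁, rfl⟩
    have hy₂ : y ∈ PrimeSpectrum.basicOpen (chi k M₂) := by
      have := range_coordMap k (F.rational _ σ.2) (leOfHom f₂) M₂ h₂
      exact this.le ⟨x₂, h.symm⟩
    have hy : y ∈ PrimeSpectrum.basicOpen (chi k (M₁ + M₂)) := by
      have : chi k (M₁ + M₂) = chi k M₁ * chi k M₂ := by
        rw [chi, chi, chi, AddMonoidAlgebra.single_mul_single, mul_one]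
      rw [this, PrimeSpectrum.basicOpen_mul]
      exact ⟨hy₁, hy₂⟩
    have hr := range_coordMap k (F.rational _ σ.2) (hτ₁.trans (leOfHom f₁)) (M₁ + M₂) hτ
    obtain ⟨x', hx⟩ := hr.ge hy
    let x : (F.charts k).obj τ := x'
    have hx₁ : (F.charts k).map f₁ ((F.charts k).map (homOfLE hτ₁) x) =
        (F.charts k).map f₁ x₁ := by
      have e : (F.charts k).map (homOfLE hτ₁ ≫ f₁) x = y := hx
      rwa [(F.charts k).map_comp, Scheme.Hom.comp_apply] at e
    have hx₂ : (F.charts k).map f₂ ((F.charts k).map (homOfLE hτ₂) x) =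
        (F.charts k).map f₂ x₂ := by
      have e : (F.charts k).map (homOfLE hτ₂ ≫ f₂) x = y := hx
      rw [(F.charts k).map_comp, Scheme.Hom.comp_apply] at e
      exact e.trans h
    exact ⟨τ, homOfLE hτ₁, homOfLE hτ₂, x,
      ((F.charts k).map f₁).isOpenEmbedding.injective hx₁,
      ((F.charts k).map f₂).isOpenEmbedding.injective hx₂⟩

/-- The toric variety `P_Σ`, glued from the affine toric varieties `A_σ`, `σ ∈ Σ`. -/
noncomputable def Fan.variety (F : Fan N) : Scheme.{u} := colimit (F.charts k)

/-- The open immersion `A_σ ⟶ P_Σ`. -/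
noncomputable def Fan.chartι (F : Fan N) (σ : F.cones) :
    Spec (.of (CoordRing k σ.1)) ⟶ F.variety k := colimit.ι (F.charts k) σ

instance (F : Fan N) (σ : F.cones) : IsOpenImmersion (F.chartι k σ) :=
  inferInstanceAs (IsOpenImmersion (colimit.ι (F.charts k) σ))

lemma Fan.charts_w (F : Fan N) {τ σ : F.cones} (h : τ ≤ σ) :
    Spec.map (CommRingCat.ofHom (coordMap k h).toRingHom) ≫ F.chartι k σ = F.chartι k τ :=
  colimit.w (F.charts k) (homOfLE h)

/-- The structure morphism `P_Σ ⟶ Spec k`. -/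
noncomputable def Fan.structureMap (F : Fan N) : F.variety k ⟶ Spec (.of k) :=
  colimit.desc (F.charts k)
    { pt := Spec (.of k)
      ι :=
        { app := fun σ => Spec.map (CommRingCat.ofHom (algebraMap k (CoordRing k σ.1)))
          naturality := fun τ σ f => by
            change Spec.map _ ≫ Spec.map _ = _ ≫ 𝟙 _
            rw [Category.comp_id, ← Spec.map_comp, ← CommRingCat.ofHom_comp]
            congr 2
            exact (coordMap k (leOfHom f)).comp_algebraMap } }

lemma Fan.chartι_structureMap (F : Fan N) (σ : F.cones) :
    F.chartι k σ ≫ F.structureMap k =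
      Spec.map (CommRingCat.ofHom (algebraMap k (CoordRing k σ.1))) :=
  colimit.ι_desc _ _

end Variety

/-! ### Subsheaves of `𝒪_X ⊗ B` -/

section Sheaves

variable {k : Type u} [Field k] {X : Scheme.{u}} [X.Over (Spec (.of k))]

lemma le_preimage_top {Z : Scheme.{u}} (f : X ⟶ Z) (U : X.Opens) : U ≤ f ⁻¹ᵁ ⊤ :=
  fun _ _ => trivial

/-- The sections of the structure sheaf of a `k`-scheme form `k`-algebras. -/
noncomputable instance sectionsAlgebra (U : X.Opens) : Algebra k Γ(X, U) :=
  ((Scheme.ΓSpecIso (.of k)).inv ≫ (X ↘ Spec (.of k)).appLE ⊤ U (le_preimage_top _ U)).hom.toAlgebra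

lemma algebraMap_sections (U : X.Opens) : algebraMap k Γ(X, U) =
    ((Scheme.ΓSpecIso (.of k)).inv ≫ (X ↘ Spec (.of k)).appLE ⊤ U (le_preimage_top _ U)).hom := rfl

variable (k) in
/-- Restriction of functions. -/
noncomputable def resHom {U V : X.Opens} (h : V ≤ U) : Γ(X, U) →ₐ[k] Γ(X, V) where
  toRingHom := (X.presheaf.map (homOfLE h).op).hom
  commutes' c := by
    simp only [algebraMap_sections]
    change ((_ ≫ _) ≫ _ : CommRingCat.of k ⟶ _).hom c = _
    rw [Category.assoc, Scheme.Hom.appLE_map]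

variable {Y : Scheme.{u}} [Y.Over (Spec (.of k))]

variable (k) in
/-- Pullback of functions along a morphism of `k`-schemes. -/
noncomputable def pullHom (f : Y ⟶ X) [f.IsOver (Spec (.of k))] (U : X.Opens) :
    Γ(X, U) →ₐ[k] Γ(Y, f ⁻¹ᵁ U) where
  toRingHom := (f.app U).hom
  commutes' c := by
    simp only [algebraMap_sections]
    change ((_ ≫ _) ≫ _ : CommRingCat.of k ⟶ _).hom c = _
    rw [Category.assoc, Scheme.Hom.app_eq_appLE, Scheme.Hom.appLE_comp_appLE]
    congr 3
    have hcongr : ∀ {g g' : Y ⟶ Spec (.of k)} (_ : g = g') (W : Y.Opens),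
        g.appLE ⊤ W (le_preimage_top g W) = g'.appLE ⊤ W (le_preimage_top g' W) := by
      rintro g _ rfl W
      rfl
    exact hcongr (comp_over f (Spec (.of k))) _

variable (B : Type u) [Ring B] [Algebra k B]

/-- Restriction of sections of `𝒪_X ⊗ B`. -/
noncomputable def tensorRes {U V : X.Opens} (h : V ≤ U) :
    Γ(X, U) ⊗[k] B →ₐ[k] Γ(X, V) ⊗[k] B :=
  Algebra.TensorProduct.map (resHom k h) (AlgHom.id k B)

variable {B}

@[simp] lemma tensorRes_tmul {U V : X.Opens} (h : V ≤ U) (a : Γ(X, U)) (b : B) :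
    tensorRes B h (a ⊗ₜ[k] b) = resHom k h a ⊗ₜ[k] b := by
  simp [tensorRes]

lemma resHom_resHom {U V W : X.Opens} (h : V ≤ U) (h' : W ≤ V) (a : Γ(X, U)) :
    resHom k h' (resHom k h a) = resHom k (h'.trans h) a := by
  change (X.presheaf.map (homOfLE h).op ≫ X.presheaf.map (homOfLE h').op).hom a = _
  rw [← Functor.map_comp]
  rfl

lemma resHom_self {U : X.Opens} (a : Γ(X, U)) : resHom k le_rfl a = a := by
  change (X.presheaf.map (𝟙 _)).hom a = a
  rw [X.presheaf.map_id]
  rfl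

lemma tensorRes_tensorRes {U V W : X.Opens} (h : V ≤ U) (h' : W ≤ V) (s : Γ(X, U) ⊗[k] B) :
    tensorRes B h' (tensorRes B h s) = tensorRes B (h'.trans h) s := by
  induction s using TensorProduct.induction_on with
  | zero => simp
  | tmul a b => simp [resHom_resHom]
  | add x y hx hy => rw [map_add, map_add, map_add, hx, hy]

lemma tensorRes_self {U : X.Opens} (s : Γ(X, U) ⊗[k] B) : tensorRes B le_rfl s = s := by
  induction s using TensorProduct.induction_on with
  | zero => simp
  | tmul a b => simp [resHom_self]
  | add x y hx hy => rw [map_add, hx, hy]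

lemma tensorRes_smul {U V : X.Opens} (h : V ≤ U) (a : Γ(X, U)) (s : Γ(X, U) ⊗[k] B) :
    tensorRes B h (a • s) = resHom k h a • tensorRes B h s := by
  induction s using TensorProduct.induction_on with
  | zero => simp
  | tmul a b => simp [TensorProduct.smul_tmul']
  | add x y hx hy => rw [smul_add, map_add, map_add, smul_add, hx, hy]

section Coord

/-- The coefficient functions of a section of `𝒪_X ⊗ B`. -/
noncomputable def coeff (l : Dual k B) (U : X.Opens) : Γ(X, U) ⊗[k] B →ₗ[k] Γ(X, U) :=
  (TensorProduct.rid k _).toLinearMap ∘ₗ l.lTensor Γ(X, U)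

@[simp] lemma coeff_tmul (l : Dual k B) (U : X.Opens) (a : Γ(X, U)) (b : B) :
    coeff l U (a ⊗ₜ b) = l b • a := by simp [coeff]

lemma coeff_tensorRes (l : Dual k B) {U V : X.Opens} (h : V ≤ U) (s : Γ(X, U) ⊗[k] B) :
    coeff l V (tensorRes B h s) = resHom k h (coeff l U s) := by
  induction s using TensorProduct.induction_on with
  | zero => simp
  | tmul a b => simp
  | add x y hx hy => rw [map_add, map_add, map_add, map_add, hx, hy]

lemma sum_coeff {ι : Type*} [Fintype ι] (b : Basis ι k B) {U : X.Opens} (s : Γ(X, U) ⊗[k] B) :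
    ∑ i, coeff (b.coord i) U s ⊗ₜ[k] b i = s := by
  induction s using TensorProduct.induction_on with
  | zero => simp
  | tmul a c =>
    simp only [coeff_tmul, TensorProduct.smul_tmul]
    rw [← TensorProduct.tmul_sum]
    congr 1
    exact b.sum_repr c
  | add x y hx hy =>
    simp only [map_add, TensorProduct.add_tmul, Finset.sum_add_distrib, hx, hy]

variable [Module.Finite k B]

lemma ext_of_coeff {U : X.Opens} {s t : Γ(X, U) ⊗[k] B}
    (h : ∀ l : Dual k B, coeff l U s = coeff l U t) : s = t := by
  rw [← sum_coeff (finBasis k B) s, ← sum_coeff (finBasis k B) t]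
  simp only [h]

lemma resHom_ext {U : X.Opens} {a b : Γ(X, U)}
    (h : ∀ x ∈ U, ∃ (V : X.Opens) (hV : V ≤ U), x ∈ V ∧ resHom k hV a = resHom k hV b) :
    a = b := by
  choose V hV hx hab using h
  refine X.sheaf.eq_of_locally_eq' (fun x : U => V x.1 x.2) U (fun x => homOfLE (hV x.1 x.2))
    (fun x hxU => ?_) a b (fun x => hab x.1 x.2)
  exact Opens.mem_iSup.2 ⟨⟨x, hxU⟩, hx x hxU⟩

lemma tensorRes_ext {U : X.Opens} {s t : Γ(X, U) ⊗[k] B}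
    (h : ∀ x ∈ U, ∃ (V : X.Opens) (hV : V ≤ U), x ∈ V ∧ tensorRes B hV s = tensorRes B hV t) :
    s = t := by
  refine ext_of_coeff fun l => resHom_ext (k := k) fun x hx => ?_
  obtain ⟨V, hV, hxV, hst⟩ := h x hx
  exact ⟨V, hV, hxV, by rw [← coeff_tensorRes, hst, coeff_tensorRes]⟩

lemma tensor_gluing {ι : Type u} (U : ι → X.Opens) (s : ∀ i, Γ(X, U i) ⊗[k] B)
    (hs : ∀ i j, tensorRes B (inf_le_left : U i ⊓ U j ≤ U i) (s i) =
      tensorRes B (inf_le_right : U i ⊓ U j ≤ U j) (s j)) :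
    ∃ t : Γ(X, iSup U) ⊗[k] B, ∀ i, tensorRes B (le_iSup U i) t = s i := by
  let b := finBasis k B
  have key : ∀ m, ∃ a : Γ(X, iSup U), ∀ i,
      resHom k (le_iSup U i) a = coeff (b.coord m) (U i) (s i) := by
    intro m
    obtain ⟨a, ha, -⟩ := X.sheaf.existsUnique_gluing U (fun i => coeff (b.coord m) (U i) (s i))
      (fun i j => by
        change resHom k (inf_le_left : U i ⊓ U j ≤ U i) _ =
          resHom k (inf_le_right : U i ⊓ U j ≤ U j) _
        rw [← coeff_tensorRes, hs, coeff_tensorRes])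
    exact ⟨a, ha⟩
  choose a ha using key
  refine ⟨∑ m, a m ⊗ₜ b m, fun i => ?_⟩
  rw [map_sum, ← sum_coeff b (s i)]
  simp only [tensorRes_tmul, ha]

end Coord

variable (k X B) in
/-- An `𝒪_X`-submodule of the sheaf `𝒪_X ⊗_k B`. -/
structure SubSheaf where
  sec : ∀ U : X.Opens, Submodule Γ(X, U) (Γ(X, U) ⊗[k] B)
  res_mem : ∀ {U V : X.Opens} (h : V ≤ U) {s : Γ(X, U) ⊗[k] B},
    s ∈ sec U → tensorRes B h s ∈ sec V
  local_mem : ∀ {U : X.Opens} {s : Γ(X, U) ⊗[k] B},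
    (∀ x ∈ U, ∃ (V : X.Opens) (h : V ≤ U), x ∈ V ∧ tensorRes B h s ∈ sec V) → s ∈ sec U

namespace SubSheaf

lemma span_res {S : ∀ U : X.Opens, Set (Γ(X, U) ⊗[k] B)}
    (hS : ∀ {U V : X.Opens} (h : V ≤ U), ∀ s ∈ S U, tensorRes B h s ∈ S V) {U V : X.Opens}
    (h : V ≤ U) {s : Γ(X, U) ⊗[k] B} (hs : s ∈ Submodule.span Γ(X, U) (S U)) :
    tensorRes B h s ∈ Submodule.span Γ(X, V) (S V) := by
  induction hs using Submodule.span_induction with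
  | mem s hs => exact Submodule.subset_span (hS h s hs)
  | zero => rw [map_zero]; exact Submodule.zero_mem _
  | add s t _ _ hs ht => rw [map_add]; exact Submodule.add_mem _ hs ht
  | smul a s _ hs => rw [tensorRes_smul]; exact Submodule.smul_mem _ _ hs

lemma baseChange_res (L : Submodule k B) {U V : X.Opens} (h : V ≤ U) {s : Γ(X, U) ⊗[k] B}
    (hs : s ∈ L.baseChange Γ(X, U)) : tensorRes B h s ∈ L.baseChange Γ(X, V) := by
  rw [Submodule.baseChange_eq_span] at hs
  induction hs using Submodule.span_induction with
  | mem s hs =>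
    obtain ⟨b, hb, rfl⟩ := hs
    simp only [TensorProduct.mk_apply, tensorRes_tmul]
    exact Submodule.tmul_mem_baseChange_of_mem _ hb
  | zero => rw [map_zero]; exact Submodule.zero_mem _
  | add s t _ _ hs ht => rw [map_add]; exact Submodule.add_mem _ hs ht
  | smul a s _ hs => rw [tensorRes_smul]; exact Submodule.smul_mem _ _ hs

lemma exists_proj (L : Submodule k B) :
    ∃ e : B →ₗ[k] B, (∀ b, e b ∈ L) ∧ ∀ b ∈ L, e b = b := by
  obtain ⟨g, hg⟩ := LinearMap.exists_leftInverse_of_injective L.subtype L.ker_subtype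
  exact ⟨L.subtype ∘ₗ g, fun b => (g b).2,
    fun b hb => congrArg Subtype.val (LinearMap.congr_fun hg ⟨b, hb⟩)⟩

lemma mem_baseChange_iff {L : Submodule k B} {e : B →ₗ[k] B} (he : ∀ b, e b ∈ L)
    (he' : ∀ b ∈ L, e b = b) {U : X.Opens} {s : Γ(X, U) ⊗[k] B} :
    s ∈ L.baseChange Γ(X, U) ↔ e.baseChange Γ(X, U) s = s := by
  constructor
  · intro hs
    rw [Submodule.baseChange_eq_span] at hs
    induction hs using Submodule.span_induction with
    | mem s hs =>
      obtain ⟨b, hb, rfl⟩ := hs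
      simp [he' b hb]
    | zero => rw [map_zero]
    | add s t _ _ hs ht => rw [map_add, hs, ht]
    | smul a s _ hs => rw [map_smul, hs]
  · intro hs
    rw [← hs]
    clear hs
    induction s using TensorProduct.induction_on with
    | zero => simp
    | tmul a b => exact Submodule.tmul_mem_baseChange_of_mem _ (he b)
    | add x y hx hy => rw [map_add]; exact Submodule.add_mem _ hx hy

lemma baseChange_tensorRes (e : B →ₗ[k] B) {U V : X.Opens} (h : V ≤ U)
    (s : Γ(X, U) ⊗[k] B) :
    e.baseChange Γ(X, V) (tensorRes B h s) = tensorRes B h (e.baseChange Γ(X, U) s) := by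
  induction s using TensorProduct.induction_on with
  | zero => simp
  | tmul a b => simp
  | add x y hx hy => rw [map_add, map_add, map_add, map_add, hx, hy]

/-- The sections of a subsheaf of `𝒪_X ⊗ B`, as a presheaf of abelian groups. -/
noncomputable def presheaf (F : SubSheaf k X B) : (X.Opens)ᵒᵖ ⥤ Ab.{u} where
  obj U := AddCommGrpCat.of (F.sec U.unop)
  map {U V} f := AddCommGrpCat.ofHom
    { toFun := fun s => ⟨tensorRes B (leOfHom f.unop) s.1, F.res_mem _ s.2⟩
      map_zero' := by ext; simp
      map_add' := fun a b => by ext; simp }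
  map_id U := by
    ext s
    exact tensorRes_self s.1
  map_comp f g := by
    ext s
    exact (tensorRes_tensorRes _ _ s.1).symm

noncomputable instance (F : SubSheaf k X B) (U : (X.Opens)ᵒᵖ) :
    Module (X.ringCatSheaf.obj.obj U) (F.presheaf.obj U) :=
  inferInstanceAs (Module Γ(X, U.unop) (F.sec U.unop))

variable [Module.Finite k B]

lemma isSheaf (F : SubSheaf k X B) : TopCat.Presheaf.IsSheaf F.presheaf := by
  rw [TopCat.Presheaf.isSheaf_iff_isSheafUniqueGluing]
  intro ι U s hs
  obtain ⟨t, ht⟩ := tensor_gluing U (fun i => (s i).1) (fun i j => congrArg Subtype.val (hs i j))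
  have hmem : t ∈ F.sec (iSup U) := by
    refine F.local_mem fun x hx => ?_
    obtain ⟨i, hi⟩ := Opens.mem_iSup.1 hx
    exact ⟨U i, le_iSup U i, hi, by rw [ht]; exact (s i).2⟩
  refine ⟨⟨t, hmem⟩, fun i => Subtype.ext (ht i), fun t' ht' => Subtype.ext ?_⟩
  refine tensorRes_ext fun x hx => ?_
  obtain ⟨i, hi⟩ := Opens.mem_iSup.1 hx
  exact ⟨U i, le_iSup U i, hi, (congrArg Subtype.val (ht' i)).trans (ht i).symm⟩

/-- A subsheaf of `𝒪_X ⊗ B` as a sheaf of `𝒪_X`-modules. -/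
noncomputable def toModules (F : SubSheaf k X B) : X.Modules where
  val := PresheafOfModules.ofPresheaf F.presheaf
    (fun _ _ f r s => Subtype.ext (tensorRes_smul (leOfHom f.unop) r s.1))
  isSheaf := F.isSheaf

/-- A section of a subsheaf of `𝒪_X ⊗ B`, as an element of `Γ(X, U) ⊗ B`. -/
def val (F : SubSheaf k X B) {U : X.Opens} (s : Γ(F.toModules, U)) : Γ(X, U) ⊗[k] B :=
  Subtype.val (p := fun s => s ∈ F.sec U) s

/-- The inclusion of a smaller subsheaf in a larger one. -/
noncomputable def incl {F G : SubSheaf k X B} (h : ∀ U, F.sec U ≤ G.sec U) :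
    F.toModules ⟶ G.toModules where
  val := PresheafOfModules.homMk
    { app := fun U => AddCommGrpCat.ofHom (Submodule.inclusion (h U.unop)).toAddMonoidHom
      naturality := fun _ _ _ => rfl }
    (fun _ _ _ => rfl)

/-- The subsheaf of `𝒪_X ⊗ B` generated by sets of sections which are stable under restriction:
its sections are locally linear combinations of the given ones. -/
def generated (S : ∀ U : X.Opens, Set (Γ(X, U) ⊗[k] B))
    (hS : ∀ {U V : X.Opens} (h : V ≤ U), ∀ s ∈ S U, tensorRes B h s ∈ S V) :
    SubSheaf k X B where
  sec U :=
    { carrier := {s | ∀ x ∈ U, ∃ (V : X.Opens) (h : V ≤ U), x ∈ V ∧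
        tensorRes B h s ∈ Submodule.span Γ(X, V) (S V)}
      zero_mem' := fun x hx => ⟨U, le_rfl, hx, by rw [map_zero]; exact Submodule.zero_mem _⟩
      add_mem' := fun {s t} hs ht x hx => by
        obtain ⟨V, hV, hxV, hsV⟩ := hs x hx
        obtain ⟨V', hV', hxV', htV'⟩ := ht x hx
        refine ⟨V ⊓ V', inf_le_left.trans hV, ⟨hxV, hxV'⟩, ?_⟩
        rw [map_add, ← tensorRes_tensorRes hV inf_le_left s,
          ← tensorRes_tensorRes hV' inf_le_right t]
        exact Submodule.add_mem _ (span_res hS _ hsV) (span_res hS _ htV')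
      smul_mem' := fun a s hs x hx => by
        obtain ⟨V, hV, hxV, hsV⟩ := hs x hx
        refine ⟨V, hV, hxV, ?_⟩
        rw [tensorRes_smul]
        exact Submodule.smul_mem _ _ hsV }
  res_mem := fun {U V} h s hs x hx => by
    obtain ⟨V', hV', hxV', hsV'⟩ := hs x (h hx)
    refine ⟨V ⊓ V', inf_le_left, ⟨hx, hxV'⟩, ?_⟩
    rw [tensorRes_tensorRes, ← tensorRes_tensorRes hV' inf_le_right s]
    exact span_res hS _ hsV'
  local_mem := fun {U s} hs x hx => by
    obtain ⟨V, hV, hxV, hsV⟩ := hs x hx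
    obtain ⟨V', hV', hxV', hsV'⟩ := hsV x hxV
    refine ⟨V', hV'.trans hV, hxV', ?_⟩
    rwa [tensorRes_tensorRes] at hsV'

/-- The sheaf `𝒪_X ⊗ L ⊂ 𝒪_X ⊗ B` of a subspace `L ⊂ B`. -/
noncomputable def ofSubspace (L : Submodule k B) : SubSheaf k X B where
  sec U := L.baseChange Γ(X, U)
  res_mem h s hs := baseChange_res L h hs
  local_mem hs := by
    obtain ⟨e, he, he'⟩ := exists_proj L
    refine (mem_baseChange_iff he he').2 (tensorRes_ext fun x hx => ?_)
    obtain ⟨V, hV, hxV, hsV⟩ := hs x hx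
    refine ⟨V, hV, hxV, ?_⟩
    rw [← baseChange_tensorRes, (mem_baseChange_iff he he').1 hsV]

/-- The sections of `G` whose restriction to the open subset `W` belongs to `F`. -/
def restrictedBy (G F : SubSheaf k X B) (W : X.Opens) : SubSheaf k X B where
  sec U :=
    { carrier := {s | s ∈ G.sec U ∧ tensorRes B (inf_le_left : U ⊓ W ≤ U) s ∈ F.sec (U ⊓ W)}
      zero_mem' := ⟨Submodule.zero_mem _, by rw [map_zero]; exact Submodule.zero_mem _⟩
      add_mem' := fun {s t} hs ht => ⟨Submodule.add_mem _ hs.1 ht.1, by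
        rw [map_add]; exact Submodule.add_mem _ hs.2 ht.2⟩
      smul_mem' := fun a s hs => ⟨Submodule.smul_mem _ _ hs.1, by
        rw [tensorRes_smul]; exact Submodule.smul_mem _ _ hs.2⟩ }
  res_mem := fun {U V} h s hs => ⟨G.res_mem h hs.1, by
    have := F.res_mem (inf_le_inf_right W h) hs.2
    rwa [tensorRes_tensorRes] at this ⊢⟩
  local_mem := fun {U s} hs => by
    refine ⟨G.local_mem fun x hx => ?_, F.local_mem fun x hx => ?_⟩
    · obtain ⟨V, hV, hxV, hsV⟩ := hs x hx
      exact ⟨V, hV, hxV, hsV.1⟩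
    · obtain ⟨V, hV, hxV, hsV⟩ := hs x hx.1
      refine ⟨V ⊓ W, inf_le_inf_right W hV, ⟨hxV, hx.2⟩, ?_⟩
      have := hsV.2
      rwa [tensorRes_tensorRes] at this ⊢

end SubSheaf

end Sheaves

/-! ### Relative logarithmic differential forms -/

section Forms

variable (k : Type u) [Field k] {N N' : Type u} [AddCommGroup N] [AddCommGroup N']

/-- `M_{π,k}`, the cokernel of `π^* : k ⊗ M' → k ⊗ M`. -/
abbrev RelM (π : N →ₗ[ℤ] N') : Type u :=
  (k ⊗[ℤ] Dual ℤ N) ⧸ LinearMap.range (LinearMap.baseChange k π.dualMap)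

/-- The exterior algebra of `M_{π,k}`. -/
abbrev Wedge (π : N →ₗ[ℤ] N') : Type u := ExteriorAlgebra k (RelM k π)

instance (π : N →ₗ[ℤ] N') [Module.Finite ℤ N] : Module.Finite k (Wedge k π) :=
  Module.Finite.of_basis (finBasis k (RelM k π)).ExteriorAlgebra

noncomputable instance (F : Fan N) : (F.variety k).Over (Spec (.of k)) := ⟨F.structureMap k⟩

/-- The affine open subset `A_σ` of `P_Σ`. -/
noncomputable abbrev Fan.chartOpen (F : Fan N) (σ : F.cones) : (F.variety k).Opens :=
  F.chartι k σ ''ᵁ ⊤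

/-- The open subset `P^reg`, the union of all `A_σ` for nonsingular `σ ∈ Σ`. -/
noncomputable def Fan.regLocus (F : Fan N) : (F.variety k).Opens :=
  ⨆ (σ : F.cones) (_ : IsNonsingular σ.1), F.chartOpen k σ

/-- The function on an open subset of `A_σ` given by an element of `k[M ∩ σ^∨]`. -/
noncomputable def Fan.chartHom (F : Fan N) (σ : F.cones) {V : (F.variety k).Opens}
    (h : V ≤ F.chartOpen k σ) : CoordRing k σ.1 →ₐ[k] Γ(F.variety k, V) where
  toRingHom := ((Scheme.ΓSpecIso (.of (CoordRing k σ.1))).inv ≫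
    ((F.chartι k σ).appIso ⊤).inv ≫ (F.variety k).presheaf.map (homOfLE h).op).hom
  commutes' c := by
    have key : CommRingCat.ofHom (algebraMap k (CoordRing k σ.1)) ≫
        (Scheme.ΓSpecIso (.of (CoordRing k σ.1))).inv ≫ ((F.chartι k σ).appIso ⊤).inv =
        (Scheme.ΓSpecIso (.of k)).inv ≫
          (F.structureMap k).appLE ⊤ (F.chartι k σ ''ᵁ ⊤) (le_preimage_top _ _) := by
      have hcongr : ∀ {g g' : Spec (.of (CoordRing k σ.1)) ⟶ Spec (.of k)} (_ : g = g'),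
          g.appLE ⊤ ⊤ (le_preimage_top g _) = g'.appLE ⊤ ⊤ (le_preimage_top g' _) := by
        rintro g _ rfl
        rfl
      rw [← Category.assoc, Iso.comp_inv_eq, Category.assoc, Scheme.Hom.appIso_hom',
        Scheme.Hom.appLE_comp_appLE, Scheme.ΓSpecIso_inv_naturality,
        hcongr (F.chartι_structureMap k σ)]
      exact congrArg _ (Scheme.Hom.appLE_eq_app _).symm
    have h2 : CommRingCat.ofHom (algebraMap k (CoordRing k σ.1)) ≫
        (Scheme.ΓSpecIso (.of (CoordRing k σ.1))).inv ≫ ((F.chartι k σ).appIso ⊤).inv ≫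
          (F.variety k).presheaf.map (homOfLE h).op = (Scheme.ΓSpecIso (.of k)).inv ≫
          (F.structureMap k).appLE ⊤ V (le_preimage_top _ _) := by
      have := congrArg (· ≫ (F.variety k).presheaf.map (homOfLE h).op) key
      simp only [Category.assoc] at this
      rw [this, Scheme.Hom.appLE_map]
    exact congrArg (fun g => g.hom c) h2

lemma Fan.resHom_chartHom (F : Fan N) (σ : F.cones) {U V : (F.variety k).Opens} (h : V ≤ U)
    (hU : U ≤ F.chartOpen k σ) (a : CoordRing k σ.1) :
    resHom k h (F.chartHom k σ hU a) = F.chartHom k σ (h.trans hU) a := by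
  have : (((Scheme.ΓSpecIso (.of (CoordRing k σ.1))).inv ≫
      ((F.chartι k σ).appIso ⊤).inv ≫ (F.variety k).presheaf.map (homOfLE hU).op) ≫
        (F.variety k).presheaf.map (homOfLE h).op) =
      (Scheme.ΓSpecIso (.of (CoordRing k σ.1))).inv ≫
      ((F.chartι k σ).appIso ⊤).inv ≫
        (F.variety k).presheaf.map (homOfLE (h.trans hU)).op := by
    simp only [Category.assoc]
    rw [← Functor.map_comp]
    rfl
  exact congrArg (fun g => g.hom a) this

/-- The module `ω^1_{A_σ}` for a nonsingular cone `σ`, as a submodule of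
`ω^1_{A_σ}(log D) = k[M ∩ σ^∨] ⊗ M`, where `1 ⊗ u_j = dx_j / x_j`. If `(v_j)` is a basis of `N`
containing the generators of `σ`, with dual basis `(u_j)` and `x_j = χ^{u_j}`, then it is generated
by `dx_j = x_j ⊗ u_j` for the generators `v_j` of `σ` with `π(v_j) = 0` and by `dx_j / x_j` for
all other `j`. -/
noncomputable def omegaOne (π : N →ₗ[ℤ] N') (σ : Cone N) :
    Submodule (CoordRing k σ) (CoordRing k σ ⊗[ℤ] Dual ℤ N) :=
  Submodule.span _ {t | ∃ (d : ℕ) (b : Basis (Fin d) ℤ N) (S : Set (Fin d)) (j : Fin d),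
    IsAdapted σ b S ∧
    (((j ∈ S ∧ π (b j) = 0) ∧
        ∃ h : b.coord j ∈ dualMonoid σ, t = chi k ⟨b.coord j, h⟩ ⊗ₜ b.coord j) ∨
      (¬ (j ∈ S ∧ π (b j) = 0) ∧ t = 1 ⊗ₜ b.coord j))}

/-- The class of `1 ⊗ u` in `M_{π,k}`, as an element of the exterior algebra. -/
noncomputable def dlog (π : N →ₗ[ℤ] N') : Dual ℤ N →ₗ[ℤ] Wedge k π :=
  ((ExteriorAlgebra.ι k ∘ₗ Submodule.mkQ _).restrictScalars ℤ) ∘ₗ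
    (TensorProduct.mk ℤ k (Dual ℤ N) 1)

/-- The projection of `ω^1_{A_σ}(log D) = k[M ∩ σ^∨] ⊗ M` to the relative forms
`k[M ∩ σ^∨] ⊗ M_{π,k}`, placed in `k[M ∩ σ^∨] ⊗ ⋀ M_{π,k}`. -/
noncomputable def toRel (π : N →ₗ[ℤ] N') (σ : Cone N) :
    CoordRing k σ ⊗[ℤ] Dual ℤ N →ₗ[CoordRing k σ] CoordRing k σ ⊗[k] Wedge k π :=
  LinearMap.liftBaseChange (CoordRing k σ)
    ((Algebra.TensorProduct.includeRight :
      Wedge k π →ₐ[k] CoordRing k σ ⊗[k] Wedge k π).toLinearMap.restrictScalars ℤ ∘ₗ dlog k π)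

/-- The module `ω^1_{A_σ/A}` of relative forms, for a nonsingular cone `σ`: the image of
`ω^1_{A_σ}` in `ω^1_{A_σ/A}(log D) = k[M ∩ σ^∨] ⊗ M_{π,k}`, which is its quotient by the image
of `k[M ∩ σ^∨] ⊗ M'`. -/
noncomputable def relOmegaOne (π : N →ₗ[ℤ] N') (σ : Cone N) :
    Submodule (CoordRing k σ) (CoordRing k σ ⊗[k] Wedge k π) :=
  (omegaOne k π σ).map (toRel k π σ)

section

variable [Module.Finite ℤ N] (F : Fan N) (π : N →ₗ[ℤ] N')

/-- The sheaf `ω^p_{P/A}(log D) = 𝒪_P ⊗ ⋀^p M_{π,k}`. -/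
noncomputable def Fan.omegaLog (p : ℕ) : SubSheaf k (F.variety k) (Wedge k π) :=
  SubSheaf.ofSubspace (⋀[k]^p (RelM k π))

/-- The subsheaf generated on the charts `A_σ` for nonsingular `σ ∈ Σ` by
`⋀^p ω^1_{A_σ/A}`, the module spanned by the `p`-fold wedge products of elements of
`ω^1_{A_σ/A}`. On `P^reg` it is the sheaf `⋀^p ω^1_{P^reg/A}`. -/
noncomputable def Fan.omegaReg (p : ℕ) : SubSheaf k (F.variety k) (Wedge k π) :=
  SubSheaf.generated
    (fun V => {s | ∃ (σ : F.cones) (_ : IsNonsingular σ.1) (h : V ≤ F.chartOpen k σ),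
      ∃ t ∈ (relOmegaOne k π σ.1) ^ p,
        s = Algebra.TensorProduct.map (F.chartHom k σ h) (AlgHom.id k (Wedge k π)) t})
    (by
      rintro U V h _ ⟨σ, hσ, hU, t, ht, rfl⟩
      refine ⟨σ, hσ, h.trans hU, t, ht, ?_⟩
      clear ht
      induction t using TensorProduct.induction_on with
      | zero => simp
      | tmul a b => simp [F.resHom_chartHom k σ h hU]
      | add x y hx hy => rw [map_add, map_add, map_add, hx, hy])

/-- The sheaf `ω̃^p_{P/A}` of relative logarithmic `p`-forms of Zariski: the sections of
`ω^p_{P/A}(log D)` whose restriction to `P^reg` belongs to `⋀^p ω^1_{P^reg/A}`. -/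
noncomputable def Fan.omegaTilde (p : ℕ) : SubSheaf k (F.variety k) (Wedge k π) :=
  SubSheaf.restrictedBy (F.omegaLog k π p) (F.omegaReg k π p) (F.regLocus k)

/-- The subsheaf `W_r ω^p_{P/A}(log D)`, the image of
`ω^r_{P/A}(log D) ⊗ ω̃^{p-r}_{P/A} → ω^p_{P/A}(log D)`, `η ⊗ w ↦ η ∧ w`; it is zero unless
`0 ≤ r ≤ p`. -/
noncomputable def Fan.weight (p : ℕ) (r : ℤ) : SubSheaf k (F.variety k) (Wedge k π) :=
  SubSheaf.generated
    (fun V => {s | ∃ a b : ℕ, (a : ℤ) = r ∧ a + b = p ∧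
      ∃ η ∈ (F.omegaLog k π a).sec V, ∃ w ∈ (F.omegaTilde k π b).sec V, s = η * w})
    (by
      rintro U V h _ ⟨a, b, ha, hab, η, hη, w, hw, rfl⟩
      exact ⟨a, b, ha, hab, _, (F.omegaLog k π a).res_mem h hη, _,
        (F.omegaTilde k π b).res_mem h hw, map_mul _ _ _⟩)

end

end Forms

/-! ### The orbit closures `P_τ` and the Poincaré residue -/

section Residue

variable (k : Type u) [Field k] {N N' : Type u} [AddCommGroup N] [AddCommGroup N']

lemma descend_mem {τ σ : Cone N} {σ' : Cone (QuotLattice τ)} (hσ' : σ' = starCone τ σ)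
    (u : dualMonoid σ) (hu : ∀ x ∈ τ, pair u.1 x = 0) : descend u.1 hu ∈ dualMonoid σ' := by
  subst hσ'
  rintro _ ⟨x, hx, rfl⟩
  exact (u.2 x hx).trans_eq (pair_descend u.1 hu x).symm

open Classical in
/-- The map `ι_τ^* : k[M ∩ σ^∨] → k[M_τ ∩ [σ]_τ^∨]`: it sends `χ^u` to `χ^u_τ` if `u ∈ τ^⊥` and
to `0` otherwise. -/
noncomputable def starHom {τ σ : Cone N} (h : τ ≤ σ) {σ' : Cone (QuotLattice τ)}
    (hσ' : σ' = starCone τ σ) : CoordRing k σ →ₐ[k] CoordRing k σ' :=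
  AddMonoidAlgebra.lift k (CoordRing k σ') (dualMonoid σ)
    { toFun := fun u => if hu : ∀ x ∈ τ, pair u.toAdd.1 x = 0 then
        chi k ⟨descend u.toAdd.1 hu, descend_mem hσ' u.toAdd hu⟩ else 0
      map_one' := by
        have h0 : ∀ x ∈ τ, pair (0 : Dual ℤ N) x = 0 := fun x _ => pair_zero x
        have : descend (τ := τ) 0 h0 = 0 := by
          refine Submodule.linearMap_qext _ ?_
          rw [descend_comp]
          rfl
        simp only [toAdd_one, ZeroMemClass.coe_zero, pair_zero, implies_true, dite_true]
        rw [chi, AddMonoidAlgebra.one_def]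
        congr 1
        exact Subtype.ext this
      map_mul' := by
        intro a b
        have hadd : (∀ x ∈ τ, pair (a * b).toAdd.1 x = 0) ↔
            (∀ x ∈ τ, pair a.toAdd.1 x = 0) ∧ ∀ x ∈ τ, pair b.toAdd.1 x = 0 := by
          have e : ∀ x, pair (a * b).toAdd.1 x = pair a.toAdd.1 x + pair b.toAdd.1 x :=
            fun x => pair_add _ _ x
          constructor
          · intro hab
            constructor <;> intro x hx
            all_goals
              have h1 := hab x hx
              rw [e] at h1
              have h2 := a.toAdd.2 x (h hx)
              have h3 := b.toAdd.2 x (h hx)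
              linarith
          · rintro ⟨ha, hb⟩ x hx
            rw [e, ha x hx, hb x hx, add_zero]
        by_cases ha : ∀ x ∈ τ, pair a.toAdd.1 x = 0
        · by_cases hb : ∀ x ∈ τ, pair b.toAdd.1 x = 0
          · rw [dif_pos ha, dif_pos hb, dif_pos (hadd.2 ⟨ha, hb⟩), chi, chi, chi,
              AddMonoidAlgebra.single_mul_single, mul_one]
            congr 1
            refine Subtype.ext (Submodule.linearMap_qext _ ?_)
            rw [descend_comp]
            change _ = (descend _ ha + descend _ hb) ∘ₗ _
            rw [LinearMap.add_comp, descend_comp, descend_comp]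
            rfl
          · rw [dif_neg hb, mul_zero, dif_neg fun hab => hb (hadd.1 hab).2]
        · rw [dif_neg ha, zero_mul, dif_neg fun hab => ha (hadd.1 hab).1] }

lemma starHom_of_mem {τ σ : Cone N} (h : τ ≤ σ) {σ' : Cone (QuotLattice τ)}
    (hσ' : σ' = starCone τ σ) (u : dualMonoid σ) (hu : ∀ x ∈ τ, pair u.1 x = 0) :
    starHom k h hσ' (chi k u) = chi k ⟨descend u.1 hu, descend_mem hσ' u hu⟩ := by
  classical
  simp only [starHom, chi, AddMonoidAlgebra.lift_single, one_smul]
  exact dif_pos hu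

lemma starHom_of_notMem {τ σ : Cone N} (h : τ ≤ σ) {σ' : Cone (QuotLattice τ)}
    (hσ' : σ' = starCone τ σ) (u : dualMonoid σ) (hu : ¬ ∀ x ∈ τ, pair u.1 x = 0) :
    starHom k h hσ' (chi k u) = 0 := by
  classical
  simp only [starHom, chi, AddMonoidAlgebra.lift_single, one_smul]
  exact dif_neg hu

lemma starHom_coordMap {τ σ₁ σ₂ : Cone N} (h₁ : τ ≤ σ₁) (h₂ : τ ≤ σ₂) (h : σ₁ ≤ σ₂)
    {σ₁' σ₂' : Cone (QuotLattice τ)} (e₁ : σ₁' = starCone τ σ₁) (e₂ : σ₂' = starCone τ σ₂)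
    (h' : σ₁' ≤ σ₂') :
    (coordMap k h').comp (starHom k h₂ e₂) = (starHom k h₁ e₁).comp (coordMap k h) := by
  have key : ∀ u, coordMap k h' (starHom k h₂ e₂ (chi k u)) =
      starHom k h₁ e₁ (coordMap k h (chi k u)) := by
    intro u
    rw [coordMap_chi]
    by_cases hu : ∀ x ∈ τ, pair u.1 x = 0
    · rw [starHom_of_mem k h₂ e₂ u hu, coordMap_chi,
        starHom_of_mem k h₁ e₁ (AddSubmonoid.inclusion (dualMonoid_anti h) u) hu]
      rfl
    · rw [starHom_of_notMem k h₂ e₂ u hu,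
        starHom_of_notMem k h₁ e₁ (AddSubmonoid.inclusion (dualMonoid_anti h) u) hu, map_zero]
  refine AlgHom.ext fun x => ?_
  induction x using AddMonoidAlgebra.induction_linear with
  | zero => simp only [map_zero]
  | add x y hx hy => simp only [map_add, hx, hy]
  | single u c =>
    have hc : (AddMonoidAlgebra.single u c : CoordRing k σ₂) = c • chi k u := by
      simp [chi]
    rw [hc, map_smul, map_smul]
    exact congrArg (c • ·) (key u)

section

variable (F : Fan N) (τ : Cone N) (hτ : τ ∈ F.cones)

/-- The cone `σ ∈ Σ` containing `τ` with a given image `[σ]_τ ∈ Σ_τ`. -/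
noncomputable def Fan.starLift (σ' : (F.star τ hτ).cones) : F.cones :=
  ⟨σ'.2.choose, σ'.2.choose_spec.1⟩

lemma Fan.le_starLift (σ' : (F.star τ hτ).cones) : τ ≤ (F.starLift τ hτ σ').1 :=
  σ'.2.choose_spec.2.1

lemma Fan.starLift_eq (σ' : (F.star τ hτ).cones) : σ'.1 = starCone τ (F.starLift τ hτ σ').1 :=
  σ'.2.choose_spec.2.2

lemma Fan.starLift_mono {σ₁ σ₂ : (F.star τ hτ).cones} (h : σ₁ ≤ σ₂) :
    F.starLift τ hτ σ₁ ≤ F.starLift τ hτ σ₂ := by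
  refine F.le_of_starCone_le hτ (F.starLift τ hτ σ₁).2 (F.starLift τ hτ σ₂).2
    (F.le_starLift τ hτ σ₁) (F.le_starLift τ hτ σ₂) ?_
  rw [← F.starLift_eq, ← F.starLift_eq]
  exact h

/-- The closed immersion `ι_τ : P_τ ⟶ P`, where `P_τ` is the toric variety of `Σ_τ`. -/
noncomputable def Fan.starι : (F.star τ hτ).variety k ⟶ F.variety k :=
  colimit.desc ((F.star τ hτ).charts k)
    { pt := F.variety k
      ι :=
        { app := fun σ' =>
            Spec.map (CommRingCat.ofHom
              (starHom k (F.le_starLift τ hτ σ') (F.starLift_eq τ hτ σ')).toRingHom) ≫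
              F.chartι k (F.starLift τ hτ σ')
          naturality := fun σ₁ σ₂ f => by
            change Spec.map _ ≫ Spec.map _ ≫ _ = (Spec.map _ ≫ _) ≫ 𝟙 _
            rw [Category.comp_id, ← F.charts_w k (F.starLift_mono τ hτ (leOfHom f)),
              ← Category.assoc, ← Category.assoc, ← Spec.map_comp, ← Spec.map_comp,
              ← CommRingCat.ofHom_comp, ← CommRingCat.ofHom_comp]
            congr 3
            exact congrArg AlgHom.toRingHom (starHom_coordMap k (F.le_starLift τ hτ σ₁)
              (F.le_starLift τ hτ σ₂) (F.starLift_mono τ hτ (leOfHom f))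
              (F.starLift_eq τ hτ σ₁) (F.starLift_eq τ hτ σ₂) (leOfHom f)) } }

lemma Fan.chartι_starι (σ' : (F.star τ hτ).cones) :
    (F.star τ hτ).chartι k σ' ≫ F.starι k τ hτ =
      Spec.map (CommRingCat.ofHom
        (starHom k (F.le_starLift τ hτ σ') (F.starLift_eq τ hτ σ')).toRingHom) ≫
        F.chartι k (F.starLift τ hτ σ') :=
  colimit.ι_desc _ _

instance : (F.starι k τ hτ).IsOver (Spec (.of k)) where
  comp_over := by
    refine colimit.hom_ext (F := (F.star τ hτ).charts k) fun σ' => ?_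
    change (F.star τ hτ).chartι k σ' ≫ F.starι k τ hτ ≫ F.structureMap k =
      (F.star τ hτ).chartι k σ' ≫ (F.star τ hτ).structureMap k
    rw [← Category.assoc, F.chartι_starι k, Category.assoc, F.chartι_structureMap k,
      (F.star τ hτ).chartι_structureMap k, ← Spec.map_comp, ← CommRingCat.ofHom_comp]
    congr 2
    exact (starHom k (F.le_starLift τ hτ σ') (F.starLift_eq τ hτ σ')).comp_algebraMap

end

lemma lat_le_ker_of_map_eq_zero [Module.Free ℤ N'] {π : N →ₗ[ℤ] N'} {τ : Cone N}
    (h : ∀ x ∈ τ, π.baseChange ℝ x = 0) : lat τ ≤ LinearMap.ker π := by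
  intro v hv
  refine (forall_dual_apply_eq_zero_iff ℤ _).1 fun u => ?_
  have h1 : ∀ x, pair (u ∘ₗ π) x = pair u (π.baseChange ℝ x) := by
    intro x
    induction x using TensorProduct.induction_on with
    | zero => simp
    | tmul c v => simp [pair]
    | add a b ha hb => rw [map_add, map_add, map_add, ha, hb]
  have h2 : ∀ x ∈ τ, pair (u ∘ₗ π) x = 0 := fun x hx => by rw [h1, h x hx, map_zero]
  exact lat_le_ker h2 hv

/-- The set `Σ_π(r)` of all `r`-dimensional cones `τ ∈ Σ` with `τ ⊂ π_ℝ^{-1}(0)`. -/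
def Fan.relCones (F : Fan N) (π : N →ₗ[ℤ] N') (r : ℕ) : Set (Cone N) :=
  {τ | τ ∈ F.cones ∧ coneDim τ = r ∧ ∀ x ∈ τ, π.baseChange ℝ x = 0}

instance (F : Fan N) (π : N →ₗ[ℤ] N') (r : ℕ) : Finite (F.relCones π r) :=
  (F.finite.subset fun _ h => h.1).to_subtype

section

variable [Module.Free ℤ N'] (F : Fan N) (π : N →ₗ[ℤ] N') {r : ℕ} (τ : F.relCones π r)

/-- The homomorphism `π_τ : N_τ → N'`, `[v]_τ ↦ π(v)`, for `τ ∈ Σ_π(r)`. -/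
def Fan.starMap : QuotLattice τ.1 →ₗ[ℤ] N' :=
  (lat τ.1).liftQ π (lat_le_ker_of_map_eq_zero τ.2.2.2)

/-- The map `(M_τ)_{π_τ,k} → M_{π,k}` induced by the inclusion `M_τ ⊂ M`. -/
noncomputable def Fan.relIncl : RelM k (F.starMap π τ) →ₗ[k] RelM k π :=
  Submodule.mapQ _ _ (LinearMap.baseChange k (lat τ.1).mkQ.dualMap) (by
    rintro _ ⟨y, rfl⟩
    refine ⟨y, ?_⟩
    induction y using TensorProduct.induction_on with
    | zero => simp
    | tmul c u => rfl
    | add a b ha hb => rw [map_add, map_add, map_add, ha, hb])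

end

/-- The functional `⟨·, 1 ⊗ v⟩` on `M_{π,k}`, for `v ∈ N` with `π(v) = 0`. -/
noncomputable def rayForm (π : N →ₗ[ℤ] N') (v : LinearMap.ker π) : Dual k (RelM k π) :=
  Submodule.liftQ _
    (LinearMap.liftBaseChange k ((Algebra.linearMap ℤ k) ∘ₗ Dual.eval ℤ N v.1)) (by
    rintro _ ⟨y, rfl⟩
    induction y using TensorProduct.induction_on with
    | zero => simp
    | tmul c u => simp [LinearMap.mem_ker.1 v.2]
    | add a b ha hb => rw [map_add]; exact Submodule.add_mem _ ha hb)

/-- The functional `φ : ⋀^r M_{π,k} → k`, `η_1 ∧ ⋯ ∧ η_r ↦ det ⟨η_i, 1 ⊗ v_j⟩`. -/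
noncomputable def residueForm (π : N →ₗ[ℤ] N') {r : ℕ} (v : Fin r → LinearMap.ker π) :
    ⋀[k]^r (RelM k π) →ₗ[k] k :=
  exteriorPower.pairingDual k (RelM k π) r
    (exteriorPower.ιMulti k r fun j => rayForm k π (v j))

/-- `v` is an ordering of the generators `v_ρ` of the rays `ρ` of `τ`. -/
def Fan.IsRayOrdering (F : Fan N) {π : N →ₗ[ℤ] N'} {r : ℕ} (τ : Cone N)
    (v : Fin r → LinearMap.ker π) : Prop :=
  Function.Injective v ∧ Set.range (fun i => (v i : N)) = F.rayGens τ

noncomputable instance (X : Scheme.{u}) : HasFiniteBiproducts X.Modules :=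
  Abelian.hasFiniteBiproducts

section

variable [Module.Finite ℤ N] [Module.Free ℤ N'] (F : Fan N) (π : N →ₗ[ℤ] N')

/-- The sheaf `ι_{τ*} ω̃^q_{P_τ/A}` on `P`. -/
noncomputable def Fan.starForms {r : ℕ} (q : ℕ) (τ : F.relCones π r) : (F.variety k).Modules :=
  (Scheme.Modules.pushforward (F.starι k τ.1 τ.2.1)).obj
    ((F.star τ.1 τ.2.1).omegaTilde k (F.starMap π τ) q).toModules

/-- The section of `𝒪_{P_τ} ⊗ ⋀ M_{π,k}` over `ι_τ^{-1}(U)` given by a section over `U` of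
`ι_{τ*} ω̃^q_{P_τ/A}`, by means of the map `(M_τ)_{π_τ,k} → M_{π,k}`. -/
noncomputable def Fan.starFormsVal {r : ℕ} (q : ℕ) (τ : F.relCones π r)
    {U : (F.variety k).Opens} (s : Γ(F.starForms k π q τ, U)) :
    Γ((F.star τ.1 τ.2.1).variety k, F.starι k τ.1 τ.2.1 ⁻¹ᵁ U) ⊗[k] Wedge k π :=
  Algebra.TensorProduct.map (AlgHom.id k _) (ExteriorAlgebra.map (F.relIncl k π τ))
    (SubSheaf.val (F := (F.star τ.1 τ.2.1).omegaTilde k (F.starMap π τ) q) s)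

/-- The Poincaré residue map, with respect to orderings `v_τ` of the rays of the cones
`τ ∈ Σ_π(r)`: the component at `τ` of `Res (η ∧ w)` is `φ_τ(η) · ι_τ^* w`, for
`η ∈ ⋀^r M_{π,k}` and for sections `w` of `ω̃^q_{P/A}`. -/
def Fan.IsResidue {p r q : ℕ} (v : F.relCones π r → Fin r → LinearMap.ker π)
    (Res : (F.weight k π p r).toModules ⟶ ⨁ F.starForms k π (r := r) q) : Prop :=
  ∀ (τ : F.relCones π r) (U : (F.variety k).Opens) (η : ⋀[k]^r (RelM k π)),
    ∀ w ∈ (F.omegaTilde k π q).sec U, ∀ s : Γ((F.weight k π p r).toModules, U),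
    SubSheaf.val _ s = (1 ⊗ₜ (η : Wedge k π)) * w →
    F.starFormsVal k π q τ ((Res ≫ biproduct.π _ τ).app U s) =
      residueForm k π (v τ) η •
        Algebra.TensorProduct.map (pullHom k (F.starι k τ.1 τ.2.1) U) (AlgHom.id k (Wedge k π)) w

end

end Residue
end Toric

/-! ### Contractions in the exterior algebra -/

namespace ExteriorAlgebra

open CliffordAlgebra (contractLeft)

variable {k V : Type*} [Field k] [AddCommGroup V] [Module k V]

/-! Write `V` for `M_{π,k}`, put `q = p - r`, and call a ray generator `v` contracted if `π(v) = 0`.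
The theorem reduces to linear algebra in `⋀ V`, one character at a time.

On a chart `A_σ` everything is graded by the characters `u ∈ M ∩ σ^∨`. The part of `ω̃^q` of degree
`u` consists of the `m ∈ ⋀^q V` killed by contraction with every contracted ray `v` of `σ` with
`u(v) = 0` (`Fan.tildePart`). In other words, a logarithmic form is a Zariski form if and only if it
has no residue along the divisors of contracted rays. The condition is necessary because the generic
point of such a divisor lies in the chart of a ray, which is nonsingular (`Fan.rayRes_eq_zero`). It
is sufficient because on nonsingular charts the elements satisfying it are sums of wedge products of
regular one-forms (`Fan.tildePart_le`).

Since `σ` is simplicial and `m(σ)` is invertible in `k`, the functionals `⟨·, v⟩` of the contracted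
rays of `σ` have a dual family `e_v` in `V` (`Fan.exists_dual_relClass`). Fix `u`, let `A` be the
set of contracted rays in `σ ∩ u^⊥`, let `E` be the span of the `e_v`, `v ∈ A`, and let `W` be the
common kernel of the functionals of `A`. Then `V = E ⊕ W`, the degree `u` part of `ω̃^q` is `⋀^q W`
(`killed_eq`), and that of `W_r` is `⋀^r V · ⋀^q W`. Modulo `⋀^(r-1) V · ⋀^(q+1) W`, the part of
`W_(r-1)`, only `⋀^r E · ⋀^q W` remains (`pow_mul_killed_le`). Contraction with `r` distinct
elements of `A` kills the part of `W_(r-1)` and reads off the coefficient in `⋀^q W` of the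
corresponding product of the `e_v`. The sets of `r` elements of `A` correspond to the cones `τ ∈
Σ_π(r)` contained in `σ ∩ u^⊥`. So the common kernel of the residues is the part of `W_(r-1)`
(`mem_weightBelow`), and all coefficients occur.

It remains to recognise these coefficients as Zariski forms on `P_τ`. The map `(M_τ)_{π_τ,k} → V` is
injective, with image the common kernel of the rays of `τ` (`Fan.exists_relProj`). A ray of `Σ_τ`
is, up to an integer invertible in `k`, the image of a ray of `σ` outside `τ`, so the conditions on
both sides agree (`Fan.resOp_mem_killed`, `Fan.map_relIncl_mem_killed`). Characters outside `τ^⊥`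
restrict to zero on `P_τ`.

Over a principal open subset `D(f)` of a chart, sections come from the chart after multiplication by
a power of `f`, and `f` is a unit on `D(f)`. The statements on charts therefore give the inclusion,
the values and kernel of the residue, and its local surjectivity for the sheaves. -/

lemma contractLeft_ι_mul' (d : Dual k V) (x : V) (b : ExteriorAlgebra k V) :
    contractLeft d (ι k x * b) = d x • b - ι k x * contractLeft d b :=
  CliffordAlgebra.contractLeft_ι_mul _ _ _

/-- Elements of degree `q` of the exterior algebra which are killed by the contractions with
the forms `ℓ i`, `i ∈ A`. -/
noncomputable def killed {I : Type*} (ℓ : I → Dual k V) (A : Set I) (q : ℕ) :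
    Submodule k (ExteriorAlgebra k V) :=
  ⋀[k]^q V ⊓ ⨅ i ∈ A, LinearMap.ker (contractLeft (Q := (0 : QuadraticForm k V)) (ℓ i))

lemma mem_killed {I : Type*} {ℓ : I → Dual k V} {A : Set I} {q : ℕ} {m : ExteriorAlgebra k V} :
    m ∈ killed ℓ A q ↔ m ∈ ⋀[k]^q V ∧ ∀ i ∈ A, contractLeft (ℓ i) m = 0 := by
  simp [killed]

lemma killed_anti {I : Type*} (ℓ : I → Dual k V) {A B : Set I} (h : A ⊆ B) (q : ℕ) :
    killed ℓ B q ≤ killed ℓ A q := fun _ hm =>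
  mem_killed.2 ⟨(mem_killed.1 hm).1, fun i hi => (mem_killed.1 hm).2 i (h hi)⟩

/-- Since `e ∧ e = 0`, the algebra map induced by `x ↦ x - d(x) e` has no terms beyond the one
linear in the contraction. Vanishing of a contraction thus becomes invariance under an algebra
endomorphism, whatever the value of `d e`. -/
lemma map_id_sub_smul (d : Dual k V) (e : V) (m : ExteriorAlgebra k V) :
    map (LinearMap.id - d.smulRight e) m = m - ι k e * contractLeft d m := by
  induction m using CliffordAlgebra.left_induction with
  | algebraMap r =>
    rw [CliffordAlgebra.contractLeft_algebraMap]
    simp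
  | add x y hx hy => rw [map_add, hx, hy, map_add, mul_add]; abel
  | ι_mul x m hm =>
    have h1 : map (LinearMap.id - d.smulRight e) (ι k m) = ι k m - d m • ι k e := by
      rw [map_apply_ι]; simp
    have h2 : ι k e * ι k m = - (ι k m * ι k e) := eq_neg_of_add_eq_zero_left (ι_add_mul_swap e m)
    have h3 : ι k e * (ι k e * contractLeft d x) = 0 := by rw [← mul_assoc, ι_sq_zero, zero_mul]
    change map _ (ι k m * x) = ι k m * x - ι k e * contractLeft d (ι k m * x)
    have h4 : ι k e * (ι k m * contractLeft d x) = - (ι k m * (ι k e * contractLeft d x)) := by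
      rw [← mul_assoc, h2, neg_mul, mul_assoc]
    rw [map_mul, h1, hm, contractLeft_ι_mul', mul_sub (ι k e), mul_smul_comm, h4, sub_mul,
      smul_mul_assoc, mul_sub (ι k m), mul_sub (ι k e), h3, sub_zero]
    abel

/-- A contraction is an antiderivation, so it kills products of vectors in `ker d`. -/
lemma contractLeft_eq_zero_of_mem_pow {d : Dual k V} {n : ℕ} {a : ExteriorAlgebra k V}
    (ha : a ∈ ((LinearMap.ker d).map (ι k : V →ₗ[k] ExteriorAlgebra k V)) ^ n) :
    contractLeft d a = 0 := by
  induction ha using Submodule.pow_induction_on_left' with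
  | algebraMap r => exact CliffordAlgebra.contractLeft_algebraMap (Q := 0) d r
  | add x y i hx hy h1 h2 => rw [map_add, h1, h2, add_zero]
  | mem_mul x hx i y hy ih =>
    obtain ⟨x, hx, rfl⟩ := hx
    rw [contractLeft_ι_mul', ih, LinearMap.mem_ker.1 hx, zero_smul, mul_zero, sub_zero]

/-! ### Dual families -/

section Dual

variable {I : Type*} [DecidableEq I] {ℓ : I → Dual k V} {e : I → V}

/-- The projection `x ↦ x - ∑ ℓ i x • e i`. -/
noncomputable def dualProj (ℓ : I → Dual k V) (e : I → V) (A : Finset I) : V →ₗ[k] V :=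
  LinearMap.id - ∑ i ∈ A, (ℓ i).smulRight (e i)

omit [DecidableEq I] in
lemma dualProj_apply (A : Finset I) (x : V) :
    dualProj ℓ e A x = x - ∑ i ∈ A, ℓ i x • e i := by
  simp [dualProj]

lemma apply_dualProj {A : Finset I} (he : ∀ i ∈ A, ∀ j ∈ A, ℓ i (e j) = if i = j then 1 else 0)
    {i : I} (hi : i ∈ A) (x : V) : ℓ i (dualProj ℓ e A x) = 0 := by
  rw [dualProj_apply, map_sub, map_sum, Finset.sum_eq_single i]
  · simp [he i hi i hi]
  · intro j hj hji
    simp [he i hi j hj, hji.symm]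
  · exact fun h => (h hi).elim

/-- The projection is a composite of maps `x ↦ x - ℓ i x • e i`, and each of these fixes `m` by
`map_id_sub_smul`. -/
lemma map_dualProj {A : Finset I} (he : ∀ i ∈ A, ∀ j ∈ A, ℓ i (e j) = if i = j then 1 else 0)
    {m : ExteriorAlgebra k V} (hm : ∀ i ∈ A, contractLeft (ℓ i) m = 0) :
    map (dualProj ℓ e A) m = m := by
  induction A using Finset.induction_on with
  | empty => simp [dualProj]
  | insert i A hi ih =>
    -- The cross terms in the composite vanish because `ℓ j (e i) = 0` for `j ≠ i`.
    have h1 : dualProj ℓ e (insert i A) =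
        dualProj ℓ e A ∘ₗ (LinearMap.id - (ℓ i).smulRight (e i)) := by
      ext x
      have h2 : ∑ j ∈ A, ℓ j (e i) • e j = 0 := by
        refine Finset.sum_eq_zero fun j hj => ?_
        rw [he j (Finset.mem_insert_of_mem hj) i (Finset.mem_insert_self _ _),
          if_neg (fun h : j = i => hi (h ▸ hj)), zero_smul]
      rw [LinearMap.comp_apply, LinearMap.sub_apply, map_sub, LinearMap.id_apply,
        LinearMap.smulRight_apply, map_smul, dualProj_apply, dualProj_apply, dualProj_apply, h2,
        Finset.sum_insert hi]
      module
    rw [h1, ← map_comp_map, AlgHom.comp_apply, map_id_sub_smul, hm i (Finset.mem_insert_self _ _), mul_zero, sub_zero]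
    exact ih (fun j hj l hl => he j (Finset.mem_insert_of_mem hj) l (Finset.mem_insert_of_mem hl))
      fun j hj => hm j (Finset.mem_insert_of_mem hj)

/-- The range of `dualProj` is the common kernel of the `ℓ i`. An element killed by all of them is
fixed by the induced projection, hence is a form in vectors of this kernel; the converse is the
antiderivation rule. -/
lemma killed_eq {A : Finset I} (he : ∀ i ∈ A, ∀ j ∈ A, ℓ i (e j) = if i = j then 1 else 0)
    (q : ℕ) : killed ℓ A q = ((LinearMap.range (dualProj ℓ e A)).map (ι k)) ^ q := by
  apply le_antisymm
  · intro m hm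
    obtain ⟨h1, h2⟩ := mem_killed.1 hm
    rw [← map_dualProj he h2]
    have h3 : Submodule.map (map (dualProj ℓ e A)).toLinearMap (⋀[k]^q V) =
        ((LinearMap.range (dualProj ℓ e A)).map (ι k)) ^ q := by
      rw [exteriorPower, Submodule.map_pow]
      congr 1
      ext x
      simp
    rw [← h3]
    exact Submodule.mem_map_of_mem h1
  · intro m hm
    refine mem_killed.2 ⟨?_, fun i hi => ?_⟩
    · refine pow_le_pow_left' (M := Submodule k (ExteriorAlgebra k V)) ?_ q hm
      rintro _ ⟨x, -, rfl⟩
      exact ⟨x, rfl⟩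
    · refine contractLeft_eq_zero_of_mem_pow (n := q) (pow_le_pow_left' (M := Submodule k (ExteriorAlgebra k V)) ?_ q hm)
      refine Submodule.map_mono ?_
      rintro _ ⟨x, rfl⟩
      exact apply_dualProj he hi x

end Dual

/-! ### Iterated contractions -/

/-- The iterated contraction with `d 0`, then `d 1`, and so on. -/
noncomputable def iterContract : ∀ {r : ℕ}, (Fin r → Dual k V) →
    (ExteriorAlgebra k V →ₗ[k] ExteriorAlgebra k V)
  | 0, _ => LinearMap.id
  | _ + 1, d => iterContract (Fin.tail d) ∘ₗ contractLeft (d 0)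

lemma iterContract_succ {r : ℕ} (d : Fin (r + 1) → Dual k V) (m : ExteriorAlgebra k V) :
    iterContract d m = iterContract (Fin.tail d) (contractLeft (d 0) m) := rfl

lemma iterContract_eq_zero {r : ℕ} {d : Fin r → Dual k V} (h : r ≠ 0) {m : ExteriorAlgebra k V}
    (hm : ∀ i, contractLeft (d i) m = 0) : iterContract d m = 0 := by
  cases r with
  | zero => exact (h rfl).elim
  | succ r => rw [iterContract_succ, hm, map_zero]

/-- The antiderivation rule, applied factor by factor; the signs are those of a Laplace expansion.
-/
lemma contractLeft_ιMulti_mul (d : Dual k V) {r : ℕ} (x : Fin (r + 1) → V)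
    {m : ExteriorAlgebra k V} (hm : contractLeft d m = 0) :
    contractLeft d (ιMulti k (r + 1) x * m) =
      ∑ i : Fin (r + 1), ((-1) ^ (i : ℕ) * d (x i)) •
        (ιMulti k r (fun j => x (i.succAbove j)) * m) := by
  induction r with
  | zero =>
    have h1 : ιMulti k (0 + 1) x = ι k (x 0) := by simp [ιMulti_apply]
    rw [h1, contractLeft_ι_mul', hm, mul_zero, sub_zero]
    simp [ιMulti_zero_apply]
  | succ r ih =>
    rw [ιMulti_succ_apply, mul_assoc, contractLeft_ι_mul', ih, Fin.sum_univ_succ (n := r + 1), Finset.mul_sum,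
      sub_eq_add_neg, ← Finset.sum_neg_distrib]
    congr 1
    · simp [Matrix.vecTail, Function.comp_def]
    · refine Finset.sum_congr rfl fun i _ => ?_
      rw [ιMulti_succ_apply]
      simp only [Matrix.vecTail, Function.comp_def, Fin.succ_succAbove_zero,
        Fin.succ_succAbove_succ, Fin.val_succ, pow_succ, mul_neg, mul_one, neg_mul, neg_smul,
        mul_smul_comm, mul_assoc]

/-- Contracting with `d 0` first is the expansion of the determinant along its first column, so no
further sign appears. -/
lemma iterContract_ιMulti_mul {r : ℕ} (d : Fin r → Dual k V) (x : Fin r → V)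
    {m : ExteriorAlgebra k V} (hm : ∀ i, contractLeft (d i) m = 0) :
    iterContract d (ιMulti k r x * m) = (Matrix.of fun i j => d j (x i)).det • m := by
  induction r with
  | zero => simp [iterContract]
  | succ r ih =>
    rw [iterContract_succ, contractLeft_ιMulti_mul _ _ (hm 0), map_sum,
      Matrix.det_succ_column_zero, Finset.sum_smul]
    refine Finset.sum_congr rfl fun i _ => ?_
    rw [map_smul, ih (Fin.tail d) _ (fun j => hm j.succ), smul_smul]
    rfl

lemma iterContract_mul {r : ℕ} (d : Fin r → Dual k V) (η : ⋀[k]^r V)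
    {m : ExteriorAlgebra k V} (hm : ∀ i, contractLeft (d i) m = 0) :
    iterContract d ((η : ExteriorAlgebra k V) * m) =
      exteriorPower.pairingDual k V r (exteriorPower.ιMulti k r d) η • m := by
  have hη : η ∈ Submodule.span k (Set.range (exteriorPower.ιMulti k r (M := V))) := by
    rw [exteriorPower.ιMulti_span]; trivial
  induction hη using Submodule.span_induction with
  | mem η h =>
    obtain ⟨x, rfl⟩ := h
    rw [exteriorPower.pairingDual_ιMulti_ιMulti, exteriorPower.ιMulti_apply_coe,
      iterContract_ιMulti_mul d x hm]
  | zero => simp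
  | add a b _ _ ha hb => rw [map_add, add_smul, ← ha, ← hb, ← map_add, ← add_mul]; rfl
  | smul c a _ ha => rw [map_smul, smul_assoc, ← ha, ← map_smul, ← smul_mul_assoc]; rfl

/-- The contraction can only remove a factor from `⋀^(s+1) V`, as it vanishes on `K`. -/
lemma contractLeft_mem_pow_mul {d : Dual k V} {K : Submodule k (ExteriorAlgebra k V)}
    (hK : ∀ m ∈ K, contractLeft d m = 0) {s : ℕ} {y : ExteriorAlgebra k V}
    (hy : y ∈ LinearMap.range (ι k : V →ₗ[k] _) ^ (s + 1) * K) :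
    contractLeft d y ∈ LinearMap.range (ι k : V →ₗ[k] _) ^ s * K := by
  rw [pow_succ', mul_assoc] at hy
  induction s generalizing y with
  | zero =>
    rw [pow_zero, one_mul] at hy ⊢
    refine Submodule.mul_induction_on hy ?_ fun a b ha hb => by
      rw [map_add]; exact Submodule.add_mem _ ha hb
    rintro _ ⟨x, rfl⟩ m hm
    rw [contractLeft_ι_mul', hK m hm, mul_zero, sub_zero]
    exact Submodule.smul_mem _ _ hm
  | succ s ih =>
    refine Submodule.mul_induction_on hy ?_ fun a b ha hb => by
      rw [map_add]; exact Submodule.add_mem _ ha hb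
    rintro _ ⟨x, rfl⟩ m hm
    rw [contractLeft_ι_mul']
    refine Submodule.sub_mem _ (Submodule.smul_mem _ _ hm) ?_
    rw [pow_succ', mul_assoc]
    refine Submodule.mul_mem_mul ⟨x, rfl⟩ (ih ?_)
    rwa [pow_succ', mul_assoc] at hm

/-- After `s` contractions the element lies in `K`, and a further one is left to kill it. This is
why residues along `r`-dimensional cones vanish on `W_(r-1)`. -/
lemma iterContract_eq_zero_of_mem {r s : ℕ} (hs : s < r) {d : Fin r → Dual k V}
    {K : Submodule k (ExteriorAlgebra k V)} (hK : ∀ i, ∀ m ∈ K, contractLeft (d i) m = 0)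
    {y : ExteriorAlgebra k V} (hy : y ∈ LinearMap.range (ι k : V →ₗ[k] _) ^ s * K) :
    iterContract d y = 0 := by
  induction s generalizing r y with
  | zero =>
    rw [pow_zero, one_mul] at hy
    exact iterContract_eq_zero hs.ne' fun i => hK i y hy
  | succ s ih =>
    obtain ⟨r, rfl⟩ : ∃ r', r = r' + 1 := ⟨r - 1, by omega⟩
    exact ih (by omega) (fun i => hK i.succ) (contractLeft_mem_pow_mul (hK 0) hy)

/-! ### The weight filtration in one degree -/

section Weight

variable {I : Type*} [DecidableEq I] {ℓ : I → Dual k V} {e : I → V} {A : Finset I}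

/-- By `killed_eq` a linear factor splits off from `killed ℓ A (q + 1)` and can be moved into the
left-hand power. -/
lemma pow_mul_killed_succ_le
    (he : ∀ i ∈ A, ∀ j ∈ A, ℓ i (e j) = if i = j then 1 else 0) (r q : ℕ) :
    ⋀[k]^r V * killed ℓ A (q + 1) ≤ ⋀[k]^(r + 1) V * killed ℓ A q := by
  rw [killed_eq he, killed_eq he, exteriorPower, exteriorPower, pow_succ', pow_succ, mul_assoc]
  refine mul_le_mul' le_rfl (mul_le_mul' ?_ le_rfl)
  rintro _ ⟨x, -, rfl⟩
  exact ⟨x, rfl⟩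

/-- Vectors anticommute, so the products of subspaces they span commute. -/
lemma map_ι_mul_comm (P Q : Submodule k V) :
    P.map (ι k) * Q.map (ι k) = Q.map (ι k) * P.map (ι k) := by
  have key : ∀ P Q : Submodule k V, P.map (ι k) * Q.map (ι k) ≤ Q.map (ι k) * P.map (ι k) := by
    intro P Q
    refine Submodule.mul_le.2 ?_
    rintro _ ⟨x, hx, rfl⟩ _ ⟨y, hy, rfl⟩
    rw [eq_neg_of_add_eq_zero_left (ι_add_mul_swap (R := k) x y)]
    exact Submodule.neg_mem _ (Submodule.mul_mem_mul ⟨y, hy, rfl⟩ ⟨x, hx, rfl⟩)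
  exact le_antisymm (key P Q) (key Q P)

/-- The part of filtration index `r - 1` of the weight filtration. -/
noncomputable def weightBelow (ℓ : I → Dual k V) (A : Set I) :
    ℕ → ℕ → Submodule k (ExteriorAlgebra k V)
  | 0, _ => ⊥
  | r + 1, q => ⋀[k]^r V * killed ℓ A (q + 1)

/-- Each vector splits into a part in `E`, the span of the `e i`, and a part in the common kernel
`W`. A term of the expanded product which uses a vector of `W` can be rewritten with one factor
fewer on the left and one more in `⋀ W`, so it drops to the smaller part. -/
lemma pow_mul_killed_le
    (he : ∀ i ∈ A, ∀ j ∈ A, ℓ i (e j) = if i = j then 1 else 0) (r q : ℕ) :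
    ⋀[k]^r V * killed ℓ A q ≤
      (Submodule.span k (ι k '' (e '' A))) ^ r * killed ℓ A q ⊔ weightBelow ℓ A r q := by
  set E : Submodule k (ExteriorAlgebra k V) := Submodule.span k (ι k '' (e '' A)) with hE
  set W := (LinearMap.range (dualProj ℓ e A)).map (ι k) with hW
  have hE' : E = (Submodule.span k (e '' A)).map (ι k) := by rw [hE, Submodule.map_span]
  have hEV : E ≤ LinearMap.range (ι k) := by
    rw [hE']; rintro _ ⟨x, -, rfl⟩; exact ⟨x, rfl⟩
  have hV : LinearMap.range (ι k : V →ₗ[k] _) ≤ E ⊔ W := by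
    rintro _ ⟨x, rfl⟩
    have h1 : x = ∑ i ∈ A, ℓ i x • e i + dualProj ℓ e A x := by rw [dualProj_apply]; abel
    rw [h1, map_add]
    refine Submodule.add_mem_sup ?_ ⟨_, ⟨x, rfl⟩, rfl⟩
    rw [hE']
    exact ⟨_, Submodule.sum_mem _ fun i hi => Submodule.smul_mem _ _
      (Submodule.subset_span ⟨i, hi, rfl⟩), rfl⟩
  have hcomm : Commute W E := by
    rw [hE']; exact map_ι_mul_comm _ _
  induction r generalizing q with
  | zero => rw [exteriorPower, pow_zero, pow_zero]; exact le_sup_left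
  | succ r ih =>
    have h0 : ⋀[k]^(r + 1) V * killed ℓ A q =
        LinearMap.range (ι k : V →ₗ[k] _) * (⋀[k]^r V * killed ℓ A q) := by
      rw [exteriorPower, pow_succ', mul_assoc]
    rw [h0]
    refine (mul_le_mul' le_rfl (ih q)).trans ?_
    rw [Submodule.mul_sup]
    refine sup_le ?_ ?_
    · refine (mul_le_mul' hV le_rfl).trans ?_
      rw [Submodule.sup_mul]
      refine sup_le_sup ?_ ?_
      · rw [pow_succ', mul_assoc]
      -- The vector of `W` is moved past `E ^ r` and absorbed in `⋀^(q+1) W`.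
      · rw [← mul_assoc, (hcomm.pow_right r).eq, mul_assoc]
        refine mul_le_mul' (pow_le_pow_left' hEV r) ?_
        rw [killed_eq he, killed_eq he, pow_succ']
    · refine le_trans ?_ le_sup_right
      -- One more factor from `V` takes the smaller part for `r` to the one for `r + 1`; for `r = 0`
      -- it is zero.
      cases r with
      | zero => simp [weightBelow]
      | succ r =>
        rw [weightBelow, weightBelow, exteriorPower, exteriorPower, pow_succ', mul_assoc]

lemma iterContract_ιMulti_dual {r : ℕ} {f : Fin r → I} (hf : Function.Injective f)
    (hfA : ∀ i, f i ∈ A) (he : ∀ i ∈ A, ∀ j ∈ A, ℓ i (e j) = if i = j then 1 else 0)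
    {m : ExteriorAlgebra k V} (hm : ∀ i ∈ A, contractLeft (ℓ i) m = 0) :
    iterContract (ℓ ∘ f) (ιMulti k r (e ∘ f) * m) = m := by
  rw [iterContract_ιMulti_mul (ℓ ∘ f) _ fun i => hm _ (hfA i)]
  have : (Matrix.of fun i j => (ℓ ∘ f) j ((e ∘ f) i)) = (1 : Matrix (Fin r) (Fin r) k) := by
    ext i j
    simp [he _ (hfA j) _ (hfA i), Matrix.one_apply, hf.eq_iff, eq_comm]
  rw [this, Matrix.det_one, one_smul]

/-- An index in the range of `f` but not of `g` gives a zero row of the matrix of pairings. -/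
lemma iterContract_ιMulti_dual_eq_zero {r : ℕ} {f g : Fin r → I} (hfA : ∀ i, f i ∈ A)
    (hgA : ∀ i, g i ∈ A) (hfg : ¬ Set.range f ⊆ Set.range g)
    (he : ∀ i ∈ A, ∀ j ∈ A, ℓ i (e j) = if i = j then 1 else 0)
    {m : ExteriorAlgebra k V} (hm : ∀ i ∈ A, contractLeft (ℓ i) m = 0) :
    iterContract (ℓ ∘ g) (ιMulti k r (e ∘ f) * m) = 0 := by
  rw [iterContract_ιMulti_mul (ℓ ∘ g) _ fun i => hm _ (hgA i)]
  obtain ⟨_, ⟨i, rfl⟩, hi⟩ := Set.not_subset.1 hfg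
  rw [Matrix.det_eq_zero_of_row_eq_zero i, zero_smul]
  intro j
  simp only [Matrix.of_apply, Function.comp_apply]
  rw [he _ (hgA j) _ (hfA i), if_neg fun h => hi ⟨j, h⟩]

/-- An element of `⋀^r V ∧ killed ℓ A q` all of whose residues vanish lies in the smaller part of
the weight filtration. -/
lemma mem_weightBelow {T : Type*} [Fintype T] {r q : ℕ} (v : T → Fin r → I)
    (hv : ∀ t, Function.Injective (v t)) (hvA : ∀ t i, v t i ∈ A)
    (hex : ∀ f : Fin r → I, Function.Injective f → (∀ i, f i ∈ A) →
      ∃ t, Set.range (v t) = Set.range f)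
    (huniq : ∀ t t', Set.range (v t) = Set.range (v t') → t = t')
    (he : ∀ i ∈ A, ∀ j ∈ A, ℓ i (e j) = if i = j then 1 else 0)
    {x : ExteriorAlgebra k V} (hx : x ∈ ⋀[k]^r V * killed ℓ A q)
    (h0 : ∀ t, iterContract (ℓ ∘ v t) x = 0) : x ∈ weightBelow ℓ A r q := by
  obtain ⟨y, hy, z, hz, rfl⟩ := Submodule.mem_sup.1 (pow_mul_killed_le he r q hx)
  refine Submodule.add_mem _ ?_ hz
  -- The component in the smaller part has no residues, so those of `y` vanish as well.
  have hz0 : ∀ t, iterContract (ℓ ∘ v t) z = 0 := by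
    intro t
    cases r with
    | zero => rw [(Submodule.mem_bot k).1 hz, map_zero]
    | succ r =>
      exact iterContract_eq_zero_of_mem (Nat.lt_succ_self r)
        (fun i m hm => (mem_killed.1 hm).2 _ (hvA t i)) hz
  -- An element of `E ^ r * killed ℓ A q` is recovered from its residues by multiplying them with
  -- the products of the dual vectors.
  suffices h : y = ∑ t, ιMulti k r (e ∘ v t) * iterContract (ℓ ∘ v t) y by
    have hy0 : y = 0 := by
      rw [h]
      refine Finset.sum_eq_zero fun t _ => ?_
      have := h0 t
      rw [map_add, hz0, add_zero] at this
      rw [this, mul_zero]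
    rw [hy0]
    exact Submodule.zero_mem _
  clear h0 hx
  rw [Submodule.span_pow] at hy
  refine Submodule.mul_induction_on hy ?_ ?_
  · intro a ha m hm
    have hm' : ∀ i ∈ A, contractLeft (ℓ i) m = 0 := (mem_killed.1 hm).2
    induction ha using Submodule.span_induction with
    | zero => simp
    | add a b _ _ ha hb =>
      rw [add_mul]
      nth_rw 1 [ha, hb]
      rw [← Finset.sum_add_distrib]
      exact Finset.sum_congr rfl fun t _ => by rw [map_add, mul_add]
    | smul c a _ ha =>
      rw [smul_mul_assoc]
      nth_rw 1 [ha]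
      rw [Finset.smul_sum]
      exact Finset.sum_congr rfl fun t _ => by rw [map_smul, mul_smul_comm]
    | mem a ha =>
      obtain ⟨g, rfl⟩ := Set.mem_pow.1 ha
      choose g' hg' hgg' using fun i => (g i).2
      choose f hfA hf using hg'
      have hprod : (List.ofFn fun i => ((g i : ι k '' (e '' A)) : ExteriorAlgebra k V)).prod =
          ιMulti k r (e ∘ f) := by
        rw [ιMulti_apply]
        congr 1
        refine congrArg List.ofFn (funext fun i => ?_)
        rw [← hgg', ← hf]
        rfl
      rw [hprod]
      by_cases hfi : Function.Injective f
      · obtain ⟨t, ht⟩ := hex f hfi hfA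
        -- Two orderings of the same set differ by a permutation, whose sign occurs on both sides of
        -- the expansion.
        obtain ⟨σ, hσ⟩ : ∃ σ : Equiv.Perm (Fin r), f = v t ∘ σ := by
          have h1 : ∀ i, ∃ j, v t j = f i := fun i => ht.ge ⟨i, rfl⟩
          choose s hs using h1
          have hsi : Function.Injective s := fun i j hij => hfi (by rw [← hs, ← hs, hij])
          exact ⟨Equiv.ofBijective s (Finite.injective_iff_bijective.1 hsi),
            funext fun i => (hs i).symm⟩
        have hperm : ιMulti k r (e ∘ f) = Equiv.Perm.sign σ • ιMulti k r (e ∘ v t) := by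
          rw [← AlternatingMap.map_perm, hσ]
          rfl
        rw [Finset.sum_eq_single t]
        · rw [hperm, smul_mul_assoc, Units.smul_def, map_zsmul,
            iterContract_ιMulti_dual (hv t) (hvA t) he hm', mul_smul_comm]
        -- Both index sets have `r` elements, so an inclusion would be an equality and force `t' =
        -- t`.
        · intro t' _ htt'
          rw [iterContract_ιMulti_dual_eq_zero hfA (hvA t') ?_ he hm', mul_zero]
          intro hsub
          refine htt' (huniq t' t (Eq.symm ?_))
          rw [← ht] at hsub
          refine Set.eq_of_subset_of_ncard_le hsub ?_ (Set.finite_range _)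
          rw [Set.ncard_range_of_injective (hv t), Set.ncard_range_of_injective (hv t')]
        · exact fun h => (h (Finset.mem_univ _)).elim
      · have h1 : ιMulti k r (e ∘ f) = 0 := by
          obtain ⟨i, j, hij, hne⟩ : ∃ i j, f i = f j ∧ i ≠ j := by
            simpa [Function.Injective] using hfi
          exact (ιMulti k r).map_eq_zero_of_eq _ (by simp [hij]) hne
        simp [h1]
  · intro a b ha hb
    nth_rw 1 [ha, hb]
    rw [← Finset.sum_add_distrib]
    exact Finset.sum_congr rfl fun t _ => by rw [map_add, mul_add]

end Weight

end ExteriorAlgebra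

namespace Toric

section Cones

variable {N : Type u} [AddCommGroup N]

/-! ### Generators of cones and faces -/

lemma pt_mem_hull {S : Set N} {v : N} (hv : v ∈ S) : pt v ∈ PointedCone.hull ℝ (pt '' S) :=
  Submodule.subset_span (Set.mem_image_of_mem _ hv)

lemma hull_pt_mono {S T : Set N} (h : S ⊆ T) :
    (PointedCone.hull ℝ (pt '' S) : Cone N) ≤ PointedCone.hull ℝ (pt '' T) :=
  Submodule.span_mono (Set.image_mono h)

/-- A sum of nonnegative terms vanishes only if each term does, so a point at which `f` vanishes
involves only generators at which `f` vanishes. -/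
lemma mem_hull_of_apply_eq_zero {E : Type*} [AddCommGroup E] [Module ℝ E] {s : Set E}
    {f : E →ₗ[ℝ] ℝ} (hf : ∀ a ∈ s, 0 ≤ f a) {x : E} (hx : x ∈ PointedCone.hull ℝ s) :
    0 ≤ f x ∧ (f x = 0 → x ∈ PointedCone.hull ℝ {a ∈ s | f a = 0}) := by
  induction hx using Submodule.span_induction with
  | mem x hx => exact ⟨hf x hx, fun h => Submodule.subset_span ⟨hx, h⟩⟩
  | zero => exact ⟨by simp, fun _ => Submodule.zero_mem _⟩
  | add x y _ _ hx hy =>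
    refine ⟨by rw [map_add]; linarith [hx.1, hy.1], fun h => ?_⟩
    rw [map_add] at h
    exact Submodule.add_mem _ (hx.2 (by linarith [hx.1, hy.1])) (hy.2 (by linarith [hx.1, hy.1]))
  | smul c x _ hx =>
    have h1 : f (c • x) = (c : ℝ) * f x := by
      change f ((c : ℝ) • x) = _
      rw [map_smul, smul_eq_mul]
    refine ⟨by rw [h1]; exact mul_nonneg c.2 hx.1, fun h => ?_⟩
    rw [h1] at h
    rcases mul_eq_zero.1 h with h | h
    · have : c = 0 := Subtype.ext h
      rw [this, zero_smul]
      exact Submodule.zero_mem _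
    · exact Submodule.smul_mem _ _ (hx.2 h)

lemma IsFace.eq_hull {τ : Cone N} {s : Set (ℝ ⊗[ℤ] N)} (h : IsFace τ (PointedCone.hull ℝ s)) :
    ∃ u : Dual ℤ N, (∀ a ∈ s, 0 ≤ pair u a) ∧
      τ = PointedCone.hull ℝ {a ∈ s | pair u a = 0} := by
  obtain ⟨u, hu0, hu⟩ := h
  have h0 : ∀ a ∈ s, 0 ≤ pair u a := fun a ha => hu0 a (Submodule.subset_span ha)
  refine ⟨u, h0, le_antisymm (fun x hx => ?_) (Submodule.span_le.2 ?_)⟩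
  · exact (mem_hull_of_apply_eq_zero h0 ((hu x).1 hx).1).2 ((hu x).1 hx).2
  · rintro a ⟨ha, ha0⟩
    exact (hu a).2 ⟨Submodule.subset_span ha, ha0⟩

lemma isFace_hull {s : Set (ℝ ⊗[ℤ] N)} {u : Dual ℤ N} (hu : ∀ a ∈ s, 0 ≤ pair u a) :
    IsFace (PointedCone.hull ℝ {a ∈ s | pair u a = 0}) (PointedCone.hull ℝ s) := by
  refine ⟨u, fun x hx => (mem_hull_of_apply_eq_zero hu hx).1, fun x => ⟨fun hx => ⟨?_, ?_⟩,
    fun hx => (mem_hull_of_apply_eq_zero hu hx.1).2 hx.2⟩⟩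
  · exact Submodule.span_mono (Set.sep_subset _ _) hx
  · induction hx using Submodule.span_induction with
    | mem x hx => exact hx.2
    | zero => simp
    | add x y _ _ hx hy => rw [map_add, hx, hy, add_zero]
    | smul c x _ hx =>
      change pair u ((c : ℝ) • x) = 0
      rw [map_smul, hx, smul_zero]

lemma linSpan_hull (s : Set (ℝ ⊗[ℤ] N)) :
    linSpan (PointedCone.hull ℝ s) = Submodule.span ℝ s :=
  le_antisymm (Submodule.span_le.2 (PointedCone.hull_le_span ℝ s))
    (Submodule.span_mono Submodule.subset_span)

lemma coneDim_hull {s : Set (ℝ ⊗[ℤ] N)} (hs : s.Finite) (hli : LinearIndepOn ℝ id s) :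
    coneDim (PointedCone.hull ℝ s) = s.ncard := by
  have := hs.fintype
  rw [coneDim, linSpan_hull, finrank_span_set_eq_card hli, Set.ncard_eq_toFinset_card']

/-- A face is generated by the generators on which its functional vanishes. By linear independence
their number is the dimension of the face. -/
lemma IsFace.exists_eq_hull_singleton {ρ : Cone N} {s : Set (ℝ ⊗[ℤ] N)} (hs : s.Finite)
    (hli : LinearIndepOn ℝ id s) (h : IsFace ρ (PointedCone.hull ℝ s)) (hρ : coneDim ρ = 1) :
    ∃ a ∈ s, ρ = PointedCone.hull ℝ {a} := by
  obtain ⟨u, -, rfl⟩ := h.eq_hull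
  rw [coneDim_hull (hs.subset (Set.sep_subset _ _)) (hli.mono (Set.sep_subset _ _)),
    Set.ncard_eq_one] at hρ
  obtain ⟨a, ha⟩ := hρ
  have : a ∈ {a ∈ s | pair u a = 0} := by rw [ha]; rfl
  exact ⟨a, this.1, by rw [ha]⟩

lemma mem_hull_singleton {E : Type*} [AddCommGroup E] [Module ℝ E] {a x : E} :
    x ∈ PointedCone.hull ℝ {a} ↔ ∃ c : ℝ, 0 ≤ c ∧ x = c • a := by
  rw [PointedCone.hull, Submodule.mem_span_singleton]
  constructor
  · rintro ⟨c, rfl⟩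
    exact ⟨c, c.2, rfl⟩
  · rintro ⟨c, hc, rfl⟩
    exact ⟨⟨c, hc⟩, rfl⟩

lemma pt_injective [Module.Free ℤ N] : Function.Injective (pt : N → ℝ ⊗[ℤ] N) := by
  intro v w h
  rw [← sub_eq_zero]
  refine (forall_dual_apply_eq_zero_iff ℤ _).1 fun u => ?_
  have := congrArg (pair u) h
  rw [pair_pt, pair_pt] at this
  rw [map_sub, sub_eq_zero]
  exact_mod_cast this

lemma pt_add (v w : N) : pt (v + w) = pt v + pt w := TensorProduct.tmul_add _ _ _

@[simp] lemma pt_zero : pt (0 : N) = 0 := TensorProduct.tmul_zero _ _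

lemma pt_zsmul (n : ℤ) (v : N) : pt (n • v) = (n : ℝ) • pt v := by
  rw [pt, pt, TensorProduct.tmul_smul, TensorProduct.smul_tmul', TensorProduct.smul_tmul']
  simp

lemma pt_nsmul (n : ℕ) (v : N) : pt (n • v) = (n : ℝ) • pt v := by
  have := pt_zsmul (n : ℤ) v
  simpa using this

lemma mem_span_pt_of_mem_span {S : Set N} {x : N} (hx : x ∈ Submodule.span ℤ S) :
    pt x ∈ Submodule.span ℝ (pt '' S) := by
  induction hx using Submodule.span_induction with
  | mem x hx => exact Submodule.subset_span ⟨x, hx, rfl⟩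
  | zero => simp
  | add x y _ _ hx hy => rw [pt_add]; exact Submodule.add_mem _ hx hy
  | smul c x _ hx => rw [pt_zsmul]; exact Submodule.smul_mem _ _ hx

/-! ### Primitive generators -/

lemma IsPrimitiveGenerator.mem {ρ : Cone N} {v : N} (h : IsPrimitiveGenerator ρ v) : pt v ∈ ρ :=
  (h v).2 ⟨1, (one_smul ℕ v).symm⟩

lemma IsPrimitiveGenerator.eq_hull {ρ : Cone N} {v : N} (h : IsPrimitiveGenerator ρ v)
    (hρ : IsRationalPolyhedral ρ) : ρ = PointedCone.hull ℝ {pt v} := by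
  obtain ⟨S, -, rfl⟩ := hρ
  refine le_antisymm (Submodule.span_le.2 ?_) (Submodule.span_le.2 ?_)
  · rintro _ ⟨x, hx, rfl⟩
    obtain ⟨n, rfl⟩ := (h x).1 (pt_mem_hull hx)
    exact mem_hull_singleton.2 ⟨n, n.cast_nonneg, pt_nsmul n v⟩
  · rintro _ rfl
    exact h.mem

lemma coneDim_hull_singleton {a : ℝ ⊗[ℤ] N} (ha : a ≠ 0) :
    coneDim (PointedCone.hull ℝ {a}) = 1 := by
  rw [coneDim_hull (Set.finite_singleton a), Set.ncard_singleton]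
  exact (linearIndepOn_singleton_iff ℝ).2 ha

lemma IsPrimitiveGenerator.pt_ne_zero {ρ : Cone N} {v : N} (h : IsPrimitiveGenerator ρ v)
    (hρ : IsRationalPolyhedral ρ) (h1 : coneDim ρ = 1) : pt v ≠ 0 := by
  intro h0
  rw [h.eq_hull hρ, h0, coneDim, linSpan_hull] at h1
  rw [Submodule.span_zero_singleton, finrank_bot] at h1
  exact zero_ne_one h1

lemma IsPrimitiveGenerator.ne_zero {ρ : Cone N} {v : N} (h : IsPrimitiveGenerator ρ v)
    (hρ : IsRationalPolyhedral ρ) (h1 : coneDim ρ = 1) : v ≠ 0 := by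
  rintro rfl
  exact h.pt_ne_zero hρ h1 pt_zero

lemma eq_one_of_smul_eq [Module.Free ℤ N] {v : N} (hv : v ≠ 0) {n : ℤ} (hn : 0 ≤ n) {m : ℤ}
    (h : v = n • m • v) : n = 1 := by
  rw [smul_smul] at h
  have h1 : ((n * m) - 1) • v = 0 := by rw [sub_smul, one_smul, ← h, sub_self]
  have h2 : n * m = 1 := by
    have := (smul_eq_zero.1 h1).resolve_right hv
    linarith
  rcases Int.eq_one_or_neg_one_of_mul_eq_one h2 with h | h <;> omega

lemma IsPrimitiveGenerator.unique [Module.Free ℤ N] {ρ : Cone N} {v w : N}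
    (h : IsPrimitiveGenerator ρ v) (h' : IsPrimitiveGenerator ρ w) (hv : v ≠ 0) : v = w := by
  obtain ⟨n, hn⟩ := (h' v).1 h.mem
  obtain ⟨m, hm⟩ := (h w).1 h'.mem
  have : (n : ℤ) = 1 := eq_one_of_smul_eq hv n.cast_nonneg (m := m) (by
    rw [natCast_zsmul, natCast_zsmul, ← hm, ← hn])
  have hn1 : n = 1 := by exact_mod_cast this
  rw [hn, hn1, one_smul]

/-- If `pt x = c • pt v`, then `c` equals `u x`, hence is an integer. -/
lemma IsPrimitiveGenerator.of_dual_eq_one [Module.Free ℤ N] {v : N} {u : Dual ℤ N}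
    (hu : u v = 1) : IsPrimitiveGenerator (PointedCone.hull ℝ {pt v}) v := by
  intro x
  rw [mem_hull_singleton]
  constructor
  · rintro ⟨c, hc, hx⟩
    have h1 := congrArg (pair u) hx
    rw [map_smul, pair_pt, pair_pt, hu, Int.cast_one, smul_eq_mul, mul_one] at h1
    have h2 : 0 ≤ u x := by rw [← h1] at hc; exact_mod_cast hc
    refine ⟨(u x).toNat, pt_injective ?_⟩
    rw [hx, pt_nsmul, ← h1]
    congr 1
    have : ((u x).toNat : ℤ) = u x := Int.toNat_of_nonneg h2
    exact_mod_cast this.symm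
  · rintro ⟨n, rfl⟩
    exact ⟨n, n.cast_nonneg, pt_nsmul n v⟩

lemma exists_primitive [Module.Free ℤ N] [Module.Finite ℤ N] {s : N} (hs : s ≠ 0) :
    ∃ (v : N) (g : ℕ), s = g • v ∧ IsPrimitiveGenerator (PointedCone.hull ℝ {pt s}) v := by
  -- The generator `g` of the ideal of all values `u s` divides every coordinate of `s`. The
  -- quotient `w` of `s` by `g` then takes the value one under some functional.
  have hI := IsPrincipalIdealRing.principal (LinearMap.range (Dual.eval ℤ N s))
  obtain ⟨g, hg⟩ := hI.principal
  have hdvd : ∀ u : Dual ℤ N, g ∣ u s := by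
    intro u
    have : u s ∈ Submodule.span ℤ {g} := by rw [← hg]; exact ⟨u, rfl⟩
    obtain ⟨c, hc⟩ := Submodule.mem_span_singleton.1 this
    exact ⟨c, by rw [← hc, smul_eq_mul, mul_comm]⟩
  obtain ⟨u, hu⟩ : ∃ u : Dual ℤ N, u s = g := by
    have : g ∈ LinearMap.range (Dual.eval ℤ N s) := by
      rw [hg]; exact Submodule.mem_span_singleton_self g
    exact this
  have hg0 : g ≠ 0 := by
    rintro rfl
    exact hs ((forall_dual_apply_eq_zero_iff ℤ _).1 fun u => zero_dvd_iff.1 (hdvd u))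
  let b := Module.Free.chooseBasis ℤ N
  choose c hc using fun i => hdvd (b.coord i)
  let w : N := ∑ i, c i • b i
  have hw : s = g • w := by
    rw [Finset.smul_sum, ← b.sum_repr s]
    exact Finset.sum_congr rfl fun i _ => by rw [smul_smul, ← hc]; rfl
  have huw : u w = 1 := by
    have h1 : g * u w = g * 1 := by rw [mul_one, ← smul_eq_mul, ← map_smul, ← hw, hu]
    exact mul_left_cancel₀ hg0 h1
  -- The generator of the ideal is determined up to sign; a negative one is replaced by its absolute
  -- value, at the cost of changing the signs of `w` and `u`.
  obtain ⟨g', v, u', hg', hv, hu'⟩ : ∃ (g' : ℕ) (v : N) (u' : Dual ℤ N), 0 < g' ∧ s = g' • v ∧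
      u' v = 1 := by
    rcases hg0.lt_or_gt with h | h
    · refine ⟨g.natAbs, -w, -u, by omega, ?_, by simp [huw]⟩
      rw [hw, ← natCast_zsmul, smul_neg, ← neg_smul]
      congr 1
      omega
    · refine ⟨g.natAbs, w, u, by omega, ?_, huw⟩
      rw [hw, ← natCast_zsmul]
      congr 1
      omega
  refine ⟨v, g', hv, ?_⟩
  have : (PointedCone.hull ℝ {pt s} : Cone N) = PointedCone.hull ℝ {pt v} := by
    have h0 : (0 : ℝ) < g' := by exact_mod_cast hg'
    refine le_antisymm (Submodule.span_le.2 ?_) (Submodule.span_le.2 ?_)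
    · rintro _ rfl
      exact mem_hull_singleton.2 ⟨g', h0.le, by rw [hv, pt_nsmul]⟩
    · rintro _ rfl
      refine mem_hull_singleton.2 ⟨(g' : ℝ)⁻¹, by positivity, ?_⟩
      rw [hv, pt_nsmul, smul_smul, inv_mul_cancel₀ h0.ne', one_smul]
  rw [this]
  exact .of_dual_eq_one hu'

/-! ### Nonsingular cones -/

/-- Primitivity of `v` makes `N / ℤ v` torsion-free, hence free, so that `v` extends to a basis.
Consequently the charts of rays lie in the regular locus. -/
lemma isNonsingular_of_isPrimitiveGenerator [Module.Free ℤ N] [Module.Finite ℤ N] {ρ : Cone N}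
    {v : N} (h : IsPrimitiveGenerator ρ v) (hρ : IsRationalPolyhedral ρ) (h1 : coneDim ρ = 1) :
    IsNonsingular ρ := by
  have hv := h.ne_zero hρ h1
  have hρ' := h.eq_hull hρ
  let W := Submodule.span ℤ {v}
  have htf : Module.IsTorsionFree ℤ (N ⧸ W) := by
    refine .of_smul_eq_zero fun n x hx => or_iff_not_imp_left.2 fun hn => ?_
    obtain ⟨x, rfl⟩ := W.mkQ_surjective x
    rw [← map_smul, Submodule.mkQ_apply, Submodule.Quotient.mk_eq_zero,
      Submodule.mem_span_singleton] at hx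
    rw [Submodule.mkQ_apply, Submodule.Quotient.mk_eq_zero, Submodule.mem_span_singleton]
    obtain ⟨m, hm⟩ := hx
    -- If `m` and `n` have the same sign, `x` lies on the ray itself; otherwise this applies to
    -- `-x`.
    have key : ∀ (n m : ℤ) (x : N), n ≠ 0 → m • v = n • x → 0 ≤ m * n → ∃ a : ℕ, x = a • v := by
      intro n m x hn hm h0
      refine (h x).1 ?_
      rw [hρ', mem_hull_singleton]
      have hn' : (n : ℝ) ≠ 0 := by exact_mod_cast hn
      refine ⟨m / n, ?_, ?_⟩
      · have : (0 : ℝ) ≤ m * n := by exact_mod_cast h0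
        rw [← mul_div_mul_right _ _ hn']
        exact div_nonneg this (mul_self_nonneg _)
      · have := congrArg pt hm
        rw [pt_zsmul, pt_zsmul] at this
        rw [div_eq_inv_mul, ← smul_smul, this, smul_smul, inv_mul_cancel₀ hn', one_smul]
    rcases le_total 0 (m * n) with h0 | h0
    · obtain ⟨a, rfl⟩ := key n m x hn hm h0
      exact ⟨a, natCast_zsmul v a⟩
    · obtain ⟨a, ha⟩ := key n (-m) (-x) hn (by rw [neg_smul, hm, smul_neg]) (by linarith)
      exact ⟨-a, by rw [neg_smul, natCast_zsmul, ← ha, neg_neg]⟩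
  have hvli : LinearIndependent ℤ (fun _ : Fin 1 => v) := by
    rw [linearIndependent_unique_iff]
    exact hv
  let bW : Basis (Fin 1) ℤ W := (Basis.span hvli).map
    (LinearEquiv.ofEq _ _ (by rw [Set.range_const]))
  have hbW : (bW 0 : N) = v := by
    change ((Basis.span hvli 0 : Submodule.span ℤ _) : N) = v
    rw [Basis.span_apply]
  let bQ := Module.finBasis ℤ (N ⧸ W)
  let b := (bW.sumQuot bQ).reindex finSumFinEquiv
  refine ⟨_, b, {finSumFinEquiv (Sum.inl 0)}, ?_⟩
  rw [IsAdapted, Set.image_singleton, Set.image_singleton, hρ']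
  congr 3
  simp [b, hbW]

lemma linearIndepOn_pt_of_basis {ι : Type*} (b : Basis ι ℤ N) (S : Set ι) :
    LinearIndepOn ℝ id (pt '' (b '' S)) := by
  have h1 : LinearIndependent ℝ (fun i => pt (b i)) := by
    have : (fun i => pt (b i)) = (b.baseChange ℝ) := by
      ext i
      simp [pt]
    rw [this]
    exact Basis.linearIndependent _
  have h2 : LinearIndepOn ℝ id (Set.range fun i => pt (b i)) := h1.linearIndepOn_id
  refine h2.mono ?_
  rintro _ ⟨_, ⟨i, -, rfl⟩, rfl⟩
  exact ⟨i, rfl⟩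

lemma IsAdapted.of_isFace {τ σ : Cone N} {d : ℕ} {b : Basis (Fin d) ℤ N} {S : Set (Fin d)}
    (hS : IsAdapted σ b S) (h : IsFace τ σ) : ∃ S', IsAdapted τ b S' := by
  rw [IsAdapted] at hS
  subst hS
  obtain ⟨u, -, rfl⟩ := h.eq_hull
  refine ⟨{j ∈ S | pair u (pt (b j)) = 0}, ?_⟩
  rw [IsAdapted]
  congr 1
  ext x
  constructor
  · rintro ⟨⟨_, ⟨j, hj, rfl⟩, rfl⟩, hx⟩
    exact ⟨_, ⟨j, ⟨hj, hx⟩, rfl⟩, rfl⟩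
  · rintro ⟨_, ⟨j, ⟨hj, hx⟩, rfl⟩, rfl⟩
    exact ⟨⟨_, ⟨j, hj, rfl⟩, rfl⟩, hx⟩

lemma IsNonsingular.of_isFace {τ σ : Cone N} (hσ : IsNonsingular σ) (h : IsFace τ σ) :
    IsNonsingular τ := by
  obtain ⟨d, b, S, hS⟩ := hσ
  exact ⟨d, b, (hS.of_isFace h).choose, (hS.of_isFace h).choose_spec⟩

/-- A one-dimensional face is spanned by a single `b j`, and `b j` is primitive because its dual
coordinate takes the value one on it. -/
lemma IsAdapted.exists_of_mem_rayGens {F : Fan N} {σ : Cone N} (hσ : σ ∈ F.cones) {d : ℕ}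
    {b : Basis (Fin d) ℤ N} {S : Set (Fin d)} (hS : IsAdapted σ b S) {v : N}
    (hv : v ∈ F.rayGens σ) : ∃ j ∈ S, v = b j := by
  have := Module.Free.of_basis b
  obtain ⟨ρ, hρ, hd, hle, hprim⟩ := hv
  have hf := F.isFace hρ hσ hle
  rw [IsAdapted] at hS
  subst hS
  obtain ⟨a, ha, hρa⟩ := hf.exists_eq_hull_singleton (Set.toFinite _)
    (linearIndepOn_pt_of_basis b S) hd
  obtain ⟨_, ⟨j, hj, rfl⟩, rfl⟩ := ha
  refine ⟨j, hj, hprim.unique (w := b j) ?_ (hprim.ne_zero (F.rational _ hρ) hd)⟩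
  rw [hρa]
  exact .of_dual_eq_one (u := b.coord j) (by simp)

lemma IsAdapted.mem_rayGens {F : Fan N} {σ : Cone N} (hσ : σ ∈ F.cones) {d : ℕ}
    {b : Basis (Fin d) ℤ N} {S : Set (Fin d)} (hS : IsAdapted σ b S) {j : Fin d} (hj : j ∈ S) :
    b j ∈ F.rayGens σ := by
  classical
  have := Module.Free.of_basis b
  rw [IsAdapted] at hS
  have hprim : IsPrimitiveGenerator (PointedCone.hull ℝ {pt (b j)}) (b j) :=
    .of_dual_eq_one (u := b.coord j) (by simp)
  -- The sum of the other coordinates is nonnegative on `σ` and, among the generators, vanishes only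
  -- at `b j`, so it cuts out the ray of `b j`.
  let u : Dual ℤ N := ∑ i ∈ Finset.univ.erase j, b.coord i
  have hu : ∀ i, u (b i) = if i = j then 0 else 1 := by
    intro i
    simp only [u, LinearMap.sum_apply, Basis.coord_apply, Basis.repr_self]
    rw [Finset.sum_congr rfl (g := fun l => if i = l then (1 : ℤ) else 0)
      (fun l _ => Finsupp.single_apply), Finset.sum_ite_eq]
    simp [ite_not]
  have hface : IsFace (PointedCone.hull ℝ {pt (b j)}) σ := by
    have h1 : ∀ a ∈ pt '' (b '' S), 0 ≤ pair u a := by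
      rintro _ ⟨_, ⟨i, -, rfl⟩, rfl⟩
      rw [pair_pt, hu]
      split_ifs <;> simp
    have h2 := isFace_hull h1
    rw [← hS] at h2
    convert h2
    ext x
    constructor
    · rintro rfl
      exact ⟨⟨_, ⟨j, hj, rfl⟩, rfl⟩, by rw [pair_pt, hu]; simp⟩
    · rintro ⟨⟨_, ⟨i, -, rfl⟩, rfl⟩, hx⟩
      rw [pair_pt, hu] at hx
      have : i = j := by
        by_contra hij
        simp [hij] at hx
      rw [this]; rfl
  refine ⟨_, F.face_mem σ hσ _ hface, coneDim_hull_singleton ?_, hface.le, hprim⟩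
  rw [← pt_zero]
  exact fun h => b.ne_zero j (pt_injective h)

end Cones

end Toric

/-! ### Simplicial fans and multiplicities -/

namespace Toric

section Simplicial

variable {N : Type u} [AddCommGroup N]

instance lat_quotient_isTorsionFree (σ : Cone N) : Module.IsTorsionFree ℤ (QuotLattice σ) := by
  refine .of_smul_eq_zero fun n x hx => or_iff_not_imp_left.2 fun hn => ?_
  obtain ⟨x, rfl⟩ := (lat σ).mkQ_surjective x
  rw [← map_smul, Submodule.mkQ_apply, Submodule.Quotient.mk_eq_zero, mem_lat, pt_zsmul] at hx
  rw [Submodule.mkQ_apply, Submodule.Quotient.mk_eq_zero, mem_lat]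
  have hn' : (n : ℝ) ≠ 0 := by exact_mod_cast hn
  have := Submodule.smul_mem _ (n : ℝ)⁻¹ hx
  rwa [smul_smul, inv_mul_cancel₀ hn', one_smul] at this

variable (F : Fan N)

lemma Fan.rayGens_mono {τ σ : Cone N} (h : τ ≤ σ) : F.rayGens τ ⊆ F.rayGens σ := by
  rintro v ⟨ρ, hρ, hd, hle, hv⟩
  exact ⟨ρ, hρ, hd, hle.trans h, hv⟩

lemma Fan.pt_mem_of_mem_rayGens {σ : Cone N} {v : N} (hv : v ∈ F.rayGens σ) : pt v ∈ σ := by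
  obtain ⟨ρ, -, -, hle, hv⟩ := hv
  exact hle hv.mem

lemma Fan.ne_zero_of_mem_rayGens {σ : Cone N} {v : N} (hv : v ∈ F.rayGens σ) : v ≠ 0 := by
  obtain ⟨ρ, hρ, hd, -, hv⟩ := hv
  exact hv.ne_zero (F.rational _ hρ) hd

/-- The index of a subgroup annihilates the quotient. An infinite index counts as zero, and then the
claim is trivial. -/
lemma Fan.mult_smul_mem {σ : Cone N} {x : N} (hx : x ∈ lat σ) :
    F.mult σ • x ∈ Submodule.span ℤ (F.rayGens σ) :=
  AddSubgroup.nsmul_relIndex_mem (H := (Submodule.span ℤ (F.rayGens σ)).toAddSubgroup)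
    (K := (lat σ).toAddSubgroup) hx

variable {F}

/-- A nonzero multiple of every lattice point of `σ_ℝ` is a combination of ray generators. So the
rays span without an appeal to the theorem that a strongly convex cone is generated by its rays. -/
lemma Fan.linSpan_le {σ : Cone N} (hσ : σ ∈ F.cones) (hm : F.mult σ ≠ 0) :
    linSpan σ ≤ Submodule.span ℝ (pt '' F.rayGens σ) := by
  obtain ⟨S, -, hS⟩ := F.rational σ hσ
  have hS' : ∀ s ∈ S, pt s ∈ linSpan σ := fun s hs => by
    rw [hS]; exact Submodule.subset_span (pt_mem_hull hs)
  have : linSpan σ = Submodule.span ℝ (pt '' S) := by rw [hS, linSpan_hull]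
  rw [this, Submodule.span_le]
  rintro _ ⟨s, hs, rfl⟩
  have h1 := mem_span_pt_of_mem_span (F.mult_smul_mem (mem_lat.2 (hS' s hs)))
  have h0 : (F.mult σ : ℝ) ≠ 0 := by exact_mod_cast hm
  have := Submodule.smul_mem _ (F.mult σ : ℝ)⁻¹ h1
  rwa [pt_nsmul, smul_smul, inv_mul_cancel₀ h0, one_smul] at this

variable [Module.Free ℤ N]

/-- Every ray is spanned by one of the independent generators given by simpliciality, and different
rays by different ones. All generators occur, because the rays span `σ_ℝ`. -/
lemma Fan.rayGens_spec (hF : F.IsSimplicial) {σ : Cone N} (hσ : σ ∈ F.cones)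
    (hm : F.mult σ ≠ 0) : (F.rayGens σ).Finite ∧ LinearIndepOn ℝ pt (F.rayGens σ) ∧
      σ = PointedCone.hull ℝ (pt '' F.rayGens σ) := by
  obtain ⟨w, hw, hli, hwσ⟩ := hF σ hσ
  have key : ∀ v : F.rayGens σ, ∃ a : w, ∃ c : ℝˣ, 0 < (c : ℝ) ∧ pt v.1 = c • a.1 ∧
      IsPrimitiveGenerator (PointedCone.hull ℝ {a.1}) v.1 := by
    rintro ⟨v, ρ, hρ, hd, hle, hv⟩
    have hf := F.isFace hρ hσ hle
    rw [← hwσ] at hf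
    obtain ⟨a, ha, hρa⟩ := hf.exists_eq_hull_singleton hw hli hd
    have hmem := hv.mem
    rw [hρa] at hmem
    obtain ⟨c, hc, hca⟩ := mem_hull_singleton.1 hmem
    have hc0 : c ≠ 0 := by
      rintro rfl
      exact hv.pt_ne_zero (F.rational _ hρ) hd (by rw [hca, zero_smul])
    refine ⟨⟨a, ha⟩, Units.mk0 c hc0, lt_of_le_of_ne hc hc0.symm, hca, ?_⟩
    rwa [← hρa]
  choose a c hc hac hprim using key
  have hinj : Function.Injective a := by
    intro v v' h
    refine Subtype.ext ((hprim v).unique ?_ (F.ne_zero_of_mem_rayGens v.2))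
    rw [h]
    exact hprim v'
  have hfin : (F.rayGens σ).Finite := by
    have := hw.to_subtype
    exact Set.finite_coe_iff.1 (Finite.of_injective a hinj)
  have hli' : LinearIndepOn ℝ pt (F.rayGens σ) := by
    have h1 : LinearIndependent ℝ (fun v => (a v : ℝ ⊗[ℤ] N)) :=
      LinearIndependent.comp (v := fun x : w => (x : ℝ ⊗[ℤ] N)) hli a hinj
    have h2 := h1.units_smul c
    have h3 : (c • fun v => (a v : ℝ ⊗[ℤ] N)) = fun v : F.rayGens σ => pt v.1 := by
      ext v
      exact (hac v).symm
    rw [h3] at h2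
    exact h2
  refine ⟨hfin, hli', le_antisymm ?_ ?_⟩
  · conv_lhs => rw [← hwσ]
    refine Submodule.span_le.2 fun x hx => ?_
    have h1 : x ∈ linSpan σ := by
      rw [← hwσ]; exact Submodule.subset_span (Submodule.subset_span hx)
    have h2 : x ∈ Submodule.span ℝ (Set.range fun v => (a v : ℝ ⊗[ℤ] N)) := by
      have h3 : Submodule.span ℝ (pt '' F.rayGens σ) ≤
          Submodule.span ℝ (Set.range fun v => (a v : ℝ ⊗[ℤ] N)) := by
        refine Submodule.span_le.2 ?_
        rintro _ ⟨v, hv, rfl⟩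
        rw [hac ⟨v, hv⟩]
        exact Submodule.smul_mem _ (c ⟨v, hv⟩ : ℝ) (Submodule.subset_span ⟨⟨v, hv⟩, rfl⟩)
      exact h3 (F.linSpan_le hσ hm h1)
    -- The generator `x` lies in the span of those which come from rays, so by independence it is
    -- one of them.
    have h4 : x ∈ Set.range fun v => (a v : ℝ ⊗[ℤ] N) := by
      refine ((hli.mono ?_).mem_span_iff_id).1 h2 (hli.mono ?_)
      · rintro _ ⟨v, rfl⟩
        exact (a v).2
      · rintro y (rfl | ⟨v, rfl⟩)
        exacts [hx, (a v).2]
    obtain ⟨v, rfl⟩ := h4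
    have h5 : (a v : ℝ ⊗[ℤ] N) = ((c v : ℝ)⁻¹) • pt v.1 := by
      rw [hac v, Units.smul_def, smul_smul, inv_mul_cancel₀ (hc v).ne', one_smul]
    have h6 : (a v : ℝ ⊗[ℤ] N) ∈ PointedCone.hull ℝ {pt v.1} :=
      mem_hull_singleton.2 ⟨_, inv_nonneg.2 (hc v).le, h5⟩
    have h7 : {pt v.1} ⊆ pt '' F.rayGens σ := Set.singleton_subset_iff.2 ⟨v.1, v.2, rfl⟩
    exact Submodule.span_mono h7 h6
  · refine Submodule.span_le.2 ?_
    rintro _ ⟨v, hv, rfl⟩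
    exact F.pt_mem_of_mem_rayGens hv

variable [Module.Finite ℤ N]

open Classical in
-- The saturated sublattice `N ∩ σ_ℝ` is a direct summand of `N`. A projection onto it, multiplied
-- by `mult σ`, takes values in the lattice spanned by the rays, and the coordinates there are
-- integral functionals on `N`.
lemma Fan.exists_dual (hF : F.IsSimplicial) {σ : Cone N} (hσ : σ ∈ F.cones)
    (hm : F.mult σ ≠ 0) : ∃ e : N → Dual ℤ N, ∀ v ∈ F.rayGens σ, ∀ w ∈ F.rayGens σ,
      e v w = if v = w then (F.mult σ : ℤ) else 0 := by
  obtain ⟨-, hli, -⟩ := F.rayGens_spec hF hσ hm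
  have hliZ : LinearIndependent ℤ (fun v : F.rayGens σ => (v : N)) := by
    have h1 : LinearIndependent ℤ (fun v : F.rayGens σ => pt (v : N)) :=
      LinearIndependent.restrict_scalars (R := ℤ) (K := ℝ)
        (by intro a b h; simpa using h) hli
    exact LinearIndependent.of_comp (TensorProduct.mk ℤ ℝ N 1) h1
  have : Module.Free ℤ (QuotLattice σ) := inferInstance
  -- The quotient by the saturated sublattice is free, so the projection has a section `s`, and `id
  -- - s ∘ mkQ` projects onto the sublattice.
  obtain ⟨s, hs⟩ := Module.projective_lifting_property (lat σ).mkQ LinearMap.id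
    (lat σ).mkQ_surjective
  have hq : ∀ x, x - s ((lat σ).mkQ x) ∈ lat σ := by
    intro x
    rw [← Submodule.Quotient.mk_eq_zero, ← Submodule.mkQ_apply, map_sub, sub_eq_zero]
    exact (LinearMap.congr_fun hs _).symm
  let q : N →ₗ[ℤ] Submodule.span ℤ (Set.range fun v : F.rayGens σ => (v : N)) :=
    LinearMap.codRestrict _ (F.mult σ • (LinearMap.id - s ∘ₗ (lat σ).mkQ)) (fun x => by
      rw [Subtype.range_coe]
      exact F.mult_smul_mem (hq x))
  refine ⟨fun v => if h : v ∈ F.rayGens σ then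
    Finsupp.lapply (⟨v, h⟩ : F.rayGens σ) ∘ₗ hliZ.repr ∘ₗ q else 0, fun v hv w hw => ?_⟩
  have hw' : (lat σ).mkQ w = 0 := by
    rw [Submodule.mkQ_apply, Submodule.Quotient.mk_eq_zero, mem_lat]
    exact Submodule.subset_span (F.pt_mem_of_mem_rayGens hw)
  have hqw : q w = F.mult σ • ⟨w, Submodule.subset_span ⟨⟨w, hw⟩, rfl⟩⟩ := by
    ext
    simp [q, hw']
  beta_reduce
  rw [dif_pos hv]
  simp only [LinearMap.comp_apply, hqw, map_nsmul]
  change F.mult σ • (hliZ.repr ⟨w, _⟩ ⟨v, hv⟩) = _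
  rw [hliZ.repr_eq_single ⟨w, hw⟩ _ rfl, Finsupp.single_apply]
  simp [eq_comm]

/-- The sum of the dual functionals of the rays outside `J` is nonnegative on `σ` and vanishes on
exactly the rays in `J`; hence every set of rays spans a face. -/
lemma Fan.hull_mem (hF : F.IsSimplicial) {σ : Cone N} (hσ : σ ∈ F.cones) (hm : F.mult σ ≠ 0)
    {J : Set N} (hJ : J ⊆ F.rayGens σ) : PointedCone.hull ℝ (pt '' J) ∈ F.cones := by
  classical
  obtain ⟨hfin, hli, hσR⟩ := F.rayGens_spec hF hσ hm
  obtain ⟨e, he⟩ := F.exists_dual hF hσ hm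
  let u : Dual ℤ N := ∑ v ∈ hfin.toFinset.filter (· ∉ J), e v
  have hu : ∀ w ∈ F.rayGens σ, u w = if w ∈ J then 0 else (F.mult σ : ℤ) := by
    intro w hw
    simp only [u, LinearMap.sum_apply]
    rw [Finset.sum_congr rfl (g := fun v => if v = w then (F.mult σ : ℤ) else 0)
      (fun v hv => he v (hfin.mem_toFinset.1 (Finset.mem_filter.1 hv).1) w hw),
      Finset.sum_ite_eq']
    simp [hw, ite_not]
  have h1 : ∀ a ∈ pt '' F.rayGens σ, 0 ≤ pair u a := by
    rintro _ ⟨w, hw, rfl⟩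
    rw [pair_pt, hu w hw]
    split_ifs <;> simp
  have h2 := isFace_hull h1
  rw [← hσR] at h2
  refine F.face_mem σ hσ _ ?_
  convert h2 using 2
  ext x
  constructor
  · rintro ⟨w, hw, rfl⟩
    exact ⟨⟨w, hJ hw, rfl⟩, by rw [pair_pt, hu w (hJ hw), if_pos hw, Int.cast_zero]⟩
  · rintro ⟨⟨w, hw, rfl⟩, h⟩
    rw [pair_pt, hu w hw] at h
    refine ⟨w, ?_, rfl⟩
    by_contra hwJ
    rw [if_neg hwJ] at h
    exact hm (by exact_mod_cast h)

omit [Module.Free ℤ N] [Module.Finite ℤ N] in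
lemma Fan.hull_le {σ : Cone N} {J : Set N} (hJ : J ⊆ F.rayGens σ) :
    PointedCone.hull ℝ (pt '' J) ≤ σ := by
  refine Submodule.span_le.2 ?_
  rintro _ ⟨v, hv, rfl⟩
  exact F.pt_mem_of_mem_rayGens (hJ hv)

omit [Module.Finite ℤ N] in
lemma Fan.mem_rayGens_of_pt_mem (hF : F.IsSimplicial) {σ : Cone N}
    (hσ : σ ∈ F.cones) (hm : F.mult σ ≠ 0) {J : Set N} (hJ : J ⊆ F.rayGens σ)
    {v : N} (hv : v ∈ F.rayGens σ) (hvτ : pt v ∈ Submodule.span ℝ (pt '' J)) : v ∈ J := by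
  obtain ⟨hfin, hli, hσR⟩ := F.rayGens_spec hF hσ hm
  exact ((hli.mono hJ).mem_span_iff).1 hvτ (hli.mono (Set.insert_subset hv hJ))

omit [Module.Finite ℤ N] in
lemma Fan.rayGens_hull (hF : F.IsSimplicial) {σ : Cone N} (hσ : σ ∈ F.cones)
    (hm : F.mult σ ≠ 0) {J : Set N} (hJ : J ⊆ F.rayGens σ) :
    F.rayGens (PointedCone.hull ℝ (pt '' J)) = J := by
  apply subset_antisymm
  · intro v hv
    exact F.mem_rayGens_of_pt_mem hF hσ hm hJ (F.rayGens_mono (F.hull_le hJ) hv)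
      (PointedCone.hull_le_span ℝ _ (F.pt_mem_of_mem_rayGens hv))
  · intro v hv
    obtain ⟨ρ, hρ, hd, hle, hprim⟩ := hJ hv
    refine ⟨ρ, hρ, hd, ?_, hprim⟩
    rw [hprim.eq_hull (F.rational _ hρ)]
    exact Submodule.span_mono (Set.singleton_subset_iff.2 ⟨v, hv, rfl⟩)

omit [Module.Finite ℤ N] in
lemma Fan.coneDim_eq (hF : F.IsSimplicial) {σ : Cone N} (hσ : σ ∈ F.cones)
    (hm : F.mult σ ≠ 0) : coneDim σ = (F.rayGens σ).ncard := by
  obtain ⟨hfin, hli, hσR⟩ := F.rayGens_spec hF hσ hm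
  have hinj := hli.injOn
  conv_lhs => rw [hσR]
  rw [coneDim_hull (hfin.image _) hli.id_image, hinj.ncard_image]

omit [Module.Free ℤ N] [Module.Finite ℤ N] in
lemma Fan.mult_ne_zero {k : Type*} [Field k] (hm : (F.totalMult : k) ≠ 0) {σ : Cone N}
    (hσ : σ ∈ F.cones) : (F.mult σ : k) ≠ 0 := by
  rw [Fan.totalMult, Nat.cast_prod, Finset.prod_ne_zero_iff] at hm
  exact hm σ (F.finite.mem_toFinset.2 hσ)

/-! ### The star of a cone -/

omit [Module.Free ℤ N] [Module.Finite ℤ N] in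
lemma projR_eq_zero_of_mem {τ : Cone N} (hτ : τ ∈ F.cones) {x : ℝ ⊗[ℤ] N} (hx : x ∈ τ) :
    projR τ x = 0 :=
  (projR_eq_zero (F.rational τ hτ)).2 (Submodule.subset_span hx)

omit [Module.Free ℤ N] [Module.Finite ℤ N] in
lemma starCone_hull (τ : Cone N) (J : Set N) :
    starCone τ (PointedCone.hull ℝ (pt '' J)) =
      PointedCone.hull ℝ (pt '' ((lat τ).mkQ '' J)) := by
  rw [starCone, PointedCone.map, PointedCone.hull, Submodule.map_span]
  congr 1
  ext y
  simp only [Set.mem_image, exists_exists_and_eq_and]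
  constructor
  · rintro ⟨v, hv, rfl⟩
    exact ⟨v, hv, (projR_pt τ v).symm⟩
  · rintro ⟨v, hv, rfl⟩
    exact ⟨v, hv, projR_pt τ v⟩

variable (k : Type*) [Field k]

/-- A ray of the star comes from a ray of `σ`, up to an integer invertible in `k`. -/
lemma Fan.exists_of_mem_rayGens_star (hF : F.IsSimplicial)
    (hm : ∀ σ ∈ F.cones, (F.mult σ : k) ≠ 0) {τ σ : Cone N} (hτ : τ ∈ F.cones)
    (hσ : σ ∈ F.cones) (h : τ ≤ σ) {v' : QuotLattice τ}
    (hv' : v' ∈ (F.star τ hτ).rayGens (starCone τ σ)) :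
    ∃ v ∈ F.rayGens σ, v ∉ F.rayGens τ ∧ ∃ c : ℕ, (c : k) ≠ 0 ∧ (lat τ).mkQ v = c • v' := by
  classical
  have hm' : ∀ σ ∈ F.cones, F.mult σ ≠ 0 := fun σ hσ h0 => hm σ hσ (by rw [h0, Nat.cast_zero])
  obtain ⟨_, ⟨σ₁, hσ₁, h₁, rfl⟩, hd, hle, hprim⟩ := hv'
  have hle' := F.le_of_starCone_le hτ hσ₁ hσ h₁ h hle
  -- If all rays of `σ₁` were rays of `τ`, the image of `σ₁` would be zero and not a ray.
  obtain ⟨v, hv, hvτ⟩ : ∃ v ∈ F.rayGens σ₁, v ∉ F.rayGens τ := by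
    by_contra! hall
    have h2 : starCone τ σ₁ = PointedCone.hull ℝ {0} := by
      refine le_antisymm ?_ (Submodule.span_le.2 (Set.singleton_subset_iff.2 (Submodule.zero_mem _)))
      rw [(F.rayGens_spec hF hσ₁ (hm' _ hσ₁)).2.2, starCone_hull]
      refine Submodule.span_mono ?_
      rintro _ ⟨_, ⟨v, hv, rfl⟩, rfl⟩
      rw [← projR_pt, projR_eq_zero_of_mem hτ (F.pt_mem_of_mem_rayGens (hall v hv))]
      rfl
    rw [h2, coneDim, linSpan_hull, Submodule.span_zero_singleton, finrank_bot] at hd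
    exact zero_ne_one hd
  refine ⟨v, F.rayGens_mono hle' hv, hvτ, ?_⟩
  obtain ⟨c, hc⟩ : ∃ c : ℕ, (lat τ).mkQ v = c • v' := by
    refine (hprim _).1 ?_
    rw [← projR_pt]
    exact ⟨_, F.pt_mem_of_mem_rayGens hv, rfl⟩
  refine ⟨c, fun hc0 => ?_, hc⟩
  -- The functional `e v` vanishes on `τ` and descends to `N_τ`. Its value `mult σ₁` at the image of
  -- `v` is divisible by `c`, so `c` is nonzero in `k`.
  obtain ⟨e, he⟩ := F.exists_dual hF hσ₁ (hm' _ hσ₁)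
  have hdesc : ∀ x ∈ τ, pair (e v) x = 0 := by
    intro x hx
    rw [(F.rayGens_spec hF hτ (hm' _ hτ)).2.2] at hx
    induction hx using Submodule.span_induction with
    | mem x hx =>
      obtain ⟨w, hw, rfl⟩ := hx
      rw [pair_pt, he v hv w (F.rayGens_mono h₁ hw), if_neg (fun h : v = w => hvτ (h ▸ hw)), Int.cast_zero]
    | zero => simp
    | add x y _ _ hx hy => rw [map_add, hx, hy, add_zero]
    | smul c x _ hx =>
      change pair (e v) ((c : ℝ) • x) = 0
      rw [map_smul, hx, smul_zero]
  have h3 : (F.mult σ₁ : ℤ) = c * descend (e v) hdesc v' := by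
    have h4 : descend (e v) hdesc ((lat τ).mkQ v) = e v v :=
      LinearMap.congr_fun (descend_comp (e v) hdesc) v
    rw [he v hv v hv, if_pos rfl, hc, map_nsmul, nsmul_eq_mul] at h4
    exact h4.symm
  have h5 := congrArg (Int.cast : ℤ → k) h3
  push_cast at h5
  rw [hc0, zero_mul] at h5
  exact hm _ hσ₁ h5

/-- A ray of `σ` not in `τ` gives a ray of the star, up to an integer invertible in `k`. -/
lemma Fan.exists_mem_rayGens_star (hF : F.IsSimplicial)
    (hm : ∀ σ ∈ F.cones, F.mult σ ≠ 0) {τ σ : Cone N} (hτ : τ ∈ F.cones)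
    (hσ : σ ∈ F.cones) (h : τ ≤ σ) {v : N} (hv : v ∈ F.rayGens σ) (hvτ : v ∉ F.rayGens τ) :
    ∃ v' ∈ (F.star τ hτ).rayGens (starCone τ σ), ∃ c : ℕ, (lat τ).mkQ v = c • v' := by
  -- The cone spanned by `τ` and `v` belongs to the fan, and its image in `N_τ` is a ray.
  have hJ : insert v (F.rayGens τ) ⊆ F.rayGens σ :=
    Set.insert_subset hv (F.rayGens_mono h)
  have hmem := F.hull_mem hF hσ (hm _ hσ) hJ
  have hle : τ ≤ PointedCone.hull ℝ (pt '' insert v (F.rayGens τ)) := by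
    conv_lhs => rw [(F.rayGens_spec hF hτ (hm _ hτ)).2.2]
    exact hull_pt_mono (Set.subset_insert _ _)
  have hv0 : (lat τ).mkQ v ≠ 0 := by
    intro h0
    rw [Submodule.mkQ_apply, Submodule.Quotient.mk_eq_zero, mem_lat,
      (F.rayGens_spec hF hτ (hm _ hτ)).2.2, linSpan_hull] at h0
    exact hvτ (F.mem_rayGens_of_pt_mem hF hσ (hm _ hσ) (F.rayGens_mono h) hv h0)
  have hcone : starCone τ (PointedCone.hull ℝ (pt '' insert v (F.rayGens τ))) =
      PointedCone.hull ℝ {pt ((lat τ).mkQ v)} := by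
    rw [starCone_hull]
    refine le_antisymm (Submodule.span_le.2 ?_) (Submodule.span_mono ?_)
    · rintro _ ⟨_, ⟨w, (rfl | hw), rfl⟩, rfl⟩
      · exact Submodule.subset_span rfl
      · rw [← projR_pt τ w, projR_eq_zero_of_mem hτ (F.pt_mem_of_mem_rayGens hw)]
        exact Submodule.zero_mem _
    · rintro _ rfl
      exact ⟨_, ⟨v, Set.mem_insert _ _, rfl⟩, rfl⟩
  obtain ⟨v', c, hc, hprim⟩ := exists_primitive hv0
  refine ⟨v', ⟨_, ⟨_, hmem, hle, rfl⟩, ?_, starCone_mono τ (F.hull_le hJ), ?_⟩, c, hc⟩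
  · rw [hcone]
    refine coneDim_hull_singleton ?_
    rw [← pt_zero]
    exact fun h => hv0 (pt_injective h)
  · rwa [hcone]

end Simplicial

end Toric

namespace Toric

/-! ### Graded components -/

section Graded

variable {k : Type*} [Field k] {G G' : Type*} [AddCommMonoid G] [AddCommMonoid G']
  {B B' : Type*} [AddCommGroup B] [Module k B] [AddCommGroup B'] [Module k B']

/-- The coefficient at `u` of an element of a monoid algebra. -/
def coeffAt (u : G) : AddMonoidAlgebra k G →ₗ[k] k where
  toFun a := a.coeff u
  map_add' _ _ := rfl
  map_smul' _ _ := rfl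

omit [AddCommMonoid G] in
lemma coeffAt_single [DecidableEq G] (u w : G) (c : k) :
    coeffAt u (AddMonoidAlgebra.single w c) = if w = u then c else 0 :=
  Finsupp.single_apply

/-- The component of degree `u` of an element of `k[G] ⊗ B`. -/
noncomputable def gradedComp (u : G) : AddMonoidAlgebra k G ⊗[k] B →ₗ[k] B :=
  (TensorProduct.lid k B).toLinearMap ∘ₗ LinearMap.rTensor B (coeffAt u)

omit [AddCommMonoid G] in
lemma gradedComp_single_tmul [DecidableEq G] (u w : G) (b : B) :
    gradedComp u ((AddMonoidAlgebra.single w (1 : k)) ⊗ₜ[k] b) = if w = u then b else 0 := by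
  rw [gradedComp, LinearMap.comp_apply, LinearMap.rTensor_tmul, coeffAt_single]
  split_ifs <;> simp

omit [AddCommMonoid G] in
lemma gradedComp_single_tmul_self (u : G) (b : B) :
    gradedComp u ((AddMonoidAlgebra.single u (1 : k)) ⊗ₜ[k] b) = b := by
  classical
  rw [gradedComp_single_tmul, if_pos rfl]

lemma graded_induction {P : AddMonoidAlgebra k G ⊗[k] B → Prop} (h0 : P 0)
    (hadd : ∀ s t, P s → P t → P (s + t))
    (hsingle : ∀ (u : G) (b : B), P (AddMonoidAlgebra.single u (1 : k) ⊗ₜ[k] b)) (t) : P t := by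
  induction t using TensorProduct.induction_on with
  | zero => exact h0
  | add x y hx hy => exact hadd x y hx hy
  | tmul a b =>
    induction a using AddMonoidAlgebra.induction_linear with
    | zero => rw [TensorProduct.zero_tmul]; exact h0
    | add x y hx hy => rw [TensorProduct.add_tmul]; exact hadd _ _ hx hy
    | single u c =>
      have : (AddMonoidAlgebra.single u c : AddMonoidAlgebra k G) =
          c • AddMonoidAlgebra.single u 1 := by simp
      rw [this, TensorProduct.smul_tmul]
      exact hsingle u (c • b)

lemma exists_sum_gradedComp (t : AddMonoidAlgebra k G ⊗[k] B) : ∃ s : Finset G,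
    t = ∑ u ∈ s, AddMonoidAlgebra.single u (1 : k) ⊗ₜ[k] gradedComp u t := by
  classical
  -- The claim for all larger finite sets lets the supports of two summands be replaced by their
  -- union.
  suffices h : ∃ s : Finset G, ∀ s', s ⊆ s' →
      t = ∑ u ∈ s', AddMonoidAlgebra.single u (1 : k) ⊗ₜ[k] gradedComp u t by
    obtain ⟨s, hs⟩ := h
    exact ⟨s, hs s subset_rfl⟩
  induction t using graded_induction with
  | h0 => exact ⟨∅, fun s' _ => by simp⟩
  | hadd x y hx hy =>
    obtain ⟨s, hs⟩ := hx
    obtain ⟨s', hs'⟩ := hy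
    refine ⟨s ∪ s', fun s'' h => ?_⟩
    simp only [map_add, TensorProduct.tmul_add, Finset.sum_add_distrib]
    rw [← hs s'' (Finset.union_subset_left h), ← hs' s'' (Finset.union_subset_right h)]
  | hsingle u b =>
    refine ⟨{u}, fun s' h => ?_⟩
    rw [Finset.sum_eq_single u, gradedComp_single_tmul_self]
    · intro w _ hw
      rw [gradedComp_single_tmul, if_neg hw.symm, TensorProduct.tmul_zero]
    · exact fun hu => (hu (h (Finset.mem_singleton_self u))).elim

lemma ext_gradedComp {s t : AddMonoidAlgebra k G ⊗[k] B}
    (h : ∀ u, gradedComp u s = gradedComp u t) : s = t := by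
  rw [← sub_eq_zero]
  obtain ⟨S, hS⟩ := exists_sum_gradedComp (s - t)
  rw [hS]
  refine Finset.sum_eq_zero fun u _ => ?_
  rw [map_sub, h, sub_self, TensorProduct.tmul_zero]

/-- The elements of `k[G] ⊗ B` whose component of degree `u` belongs to `L u`. -/
noncomputable def gradedPart (L : G → Submodule k B) :
    Submodule k (AddMonoidAlgebra k G ⊗[k] B) :=
  ⨅ u, (L u).comap (gradedComp u)

omit [AddCommMonoid G] in
lemma mem_gradedPart {L : G → Submodule k B} {t : AddMonoidAlgebra k G ⊗[k] B} :
    t ∈ gradedPart L ↔ ∀ u, gradedComp u t ∈ L u := by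
  simp [gradedPart]

omit [AddCommMonoid G] in
lemma single_tmul_mem_gradedPart {L : G → Submodule k B} {u : G} {b : B} (hb : b ∈ L u) :
    AddMonoidAlgebra.single u (1 : k) ⊗ₜ[k] b ∈ gradedPart L := by
  classical
  refine mem_gradedPart.2 fun w => ?_
  rw [gradedComp_single_tmul]
  split_ifs with h
  · rwa [← h]
  · exact Submodule.zero_mem _

lemma gradedPart_induction {L : G → Submodule k B} {P : AddMonoidAlgebra k G ⊗[k] B → Prop}
    (h0 : P 0) (hadd : ∀ s t, P s → P t → P (s + t))
    (hsingle : ∀ (u : G), ∀ b ∈ L u, P (AddMonoidAlgebra.single u (1 : k) ⊗ₜ[k] b))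
    {t} (ht : t ∈ gradedPart L) : P t := by
  obtain ⟨s, hs⟩ := exists_sum_gradedComp t
  rw [hs]
  exact Finset.sum_induction _ P hadd h0 fun u _ => hsingle u _ (mem_gradedPart.1 ht u)

omit [AddCommMonoid G] in
lemma gradedPart_mono {L L' : G → Submodule k B} (h : ∀ u, L u ≤ L' u) :
    gradedPart L ≤ gradedPart L' := fun _ ht =>
  mem_gradedPart.2 fun u => h u (mem_gradedPart.1 ht u)

/-- Multiplication by a character shifts the degree, and by assumption the allowed subspaces can
only grow under such shifts. -/
lemma smul_mem_gradedPart {L : G → Submodule k B} (hL : ∀ u w, L u ≤ L (w + u))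
    (a : AddMonoidAlgebra k G) {t : AddMonoidAlgebra k G ⊗[k] B} (ht : t ∈ gradedPart L) :
    a • t ∈ gradedPart L := by
  induction a using AddMonoidAlgebra.induction_linear with
  | zero => rw [zero_smul]; exact Submodule.zero_mem _
  | add x y hx hy => rw [add_smul]; exact Submodule.add_mem _ hx hy
  | single w c =>
    refine gradedPart_induction (P := fun t => AddMonoidAlgebra.single w c • t ∈ gradedPart L)
      ?_ ?_ ?_ ht
    · rw [smul_zero]; exact Submodule.zero_mem _
    · intro s t hs ht
      rw [smul_add]; exact Submodule.add_mem _ hs ht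
    · intro u b hb
      rw [TensorProduct.smul_tmul', smul_eq_mul, AddMonoidAlgebra.single_mul_single, mul_one]
      have : (AddMonoidAlgebra.single (w + u) c : AddMonoidAlgebra k G) =
          c • AddMonoidAlgebra.single (w + u) 1 := by simp
      rw [this, TensorProduct.smul_tmul]
      exact single_tmul_mem_gradedPart (Submodule.smul_mem _ _ (hL u w hb))

omit [AddCommMonoid G] in
lemma gradedComp_tmul (u : G) (a : AddMonoidAlgebra k G) (b : B) :
    gradedComp u (a ⊗ₜ[k] b) = coeffAt u a • b := by
  simp [gradedComp]

omit [AddCommMonoid G] [AddCommMonoid G'] in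
lemma gradedComp_map {f : AddMonoidAlgebra k G →ₗ[k] AddMonoidAlgebra k G'} (g : B →ₗ[k] B')
    {u : G} {u' : G'} (h : ∀ a, coeffAt u' (f a) = coeffAt u a) (t : AddMonoidAlgebra k G ⊗[k] B) :
    gradedComp u' (TensorProduct.map f g t) = g (gradedComp u t) := by
  induction t using TensorProduct.induction_on with
  | zero => simp
  | add x y hx hy => simp only [map_add, hx, hy]
  | tmul a b => rw [TensorProduct.map_tmul, gradedComp_tmul, gradedComp_tmul, h, map_smul]

end Graded

/-! ### Residues along a ray -/

section Ray

variable (k : Type u) [Field k] {N N' : Type u} [AddCommGroup N] [AddCommGroup N']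

lemma dualMonoid_nonneg {σ : Cone N} (u : dualMonoid σ) {v : N} (hv : pt v ∈ σ) : 0 ≤ u.1 v := by
  have := u.2 _ hv
  rw [pair_pt] at this
  exact_mod_cast this

lemma mem_dualMonoid_hull {S : Set N} {u : Dual ℤ N} (hu : ∀ s ∈ S, 0 ≤ u s) :
    u ∈ dualMonoid (PointedCone.hull ℝ (pt '' S)) := by
  have h : ∀ a ∈ pt '' S, 0 ≤ pair u a := by
    rintro _ ⟨s, hs, rfl⟩
    rw [pair_pt]
    exact_mod_cast hu s hs
  exact fun x hx => (mem_hull_of_apply_eq_zero h hx).1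

open Classical in
/-- The ring homomorphism `k[M ∩ σ^∨] → k[M]` which sends `χ^u` to `χ^u` if `u(v) = 0` and to `0`
otherwise, for a lattice point `v` of `σ`. -/
noncomputable def rayHom {σ : Cone N} (v : N) (hv : pt v ∈ σ) :
    CoordRing k σ →ₐ[k] AddMonoidAlgebra k (Dual ℤ N) :=
  AddMonoidAlgebra.lift k _ (dualMonoid σ)
    { toFun := fun u => if u.toAdd.1 v = 0 then AddMonoidAlgebra.single u.toAdd.1 1 else 0
      map_one' := by
        rw [if_pos (show (Multiplicative.toAdd (1 : Multiplicative (dualMonoid σ))).1 v = 0 from rfl)]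
        rfl
      map_mul' := by
        intro a b
        have ha := dualMonoid_nonneg a.toAdd hv
        have hb := dualMonoid_nonneg b.toAdd hv
        have hab : (a * b).toAdd.1 v = a.toAdd.1 v + b.toAdd.1 v := rfl
        by_cases h1 : a.toAdd.1 v = 0
        · by_cases h2 : b.toAdd.1 v = 0
          · rw [if_pos h1, if_pos h2, if_pos (by rw [hab, h1, h2, add_zero]),
              AddMonoidAlgebra.single_mul_single, mul_one]
            rfl
          · rw [if_neg h2, mul_zero, if_neg (by rw [hab]; omega)]
        · rw [if_neg h1, zero_mul, if_neg (by rw [hab]; omega)] }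

open Classical in
lemma rayHom_chi {σ : Cone N} (v : N) (hv : pt v ∈ σ) (u : dualMonoid σ) :
    rayHom k v hv (chi k u) = if u.1 v = 0 then AddMonoidAlgebra.single u.1 1 else 0 := by
  simp only [rayHom, chi, AddMonoidAlgebra.lift_single, one_smul]
  rfl

lemma coordRing_induction {σ : Cone N} {P : CoordRing k σ → Prop} (h0 : P 0)
    (hadd : ∀ a b, P a → P b → P (a + b)) (hsmul : ∀ (c : k) (u : dualMonoid σ), P (c • chi k u))
    (a : CoordRing k σ) : P a := by
  induction a using AddMonoidAlgebra.induction_linear with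
  | zero => exact h0
  | add x y hx hy => exact hadd _ _ hx hy
  | single u c =>
    have : (AddMonoidAlgebra.single u c : CoordRing k σ) = c • chi k u := by simp [chi]
    rw [this]
    exact hsmul c u

/-- The target `k[M]` of `rayHom` is the same for all cones, so residues computed on different
charts containing the divisor can be compared. -/
lemma rayHom_coordMap {τ σ : Cone N} (h : τ ≤ σ) (v : N) (hv : pt v ∈ τ) (a : CoordRing k σ) :
    rayHom k v hv (coordMap k h a) = rayHom k v (h hv) a := by
  induction a using coordRing_induction with
  | h0 => simp only [map_zero]
  | hadd x y hx hy => simp only [map_add, hx, hy]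
  | hsmul c u => rw [map_smul, map_smul, map_smul, coordMap_chi, rayHom_chi, rayHom_chi]; rfl

variable {k} in
/-- The residue of a form along the divisor of `v`. -/
noncomputable def rayRes (π : N →ₗ[ℤ] N') {σ : Cone N} (v : LinearMap.ker π) (hv : pt v.1 ∈ σ) :
    CoordRing k σ ⊗[k] Wedge k π →ₗ[k] AddMonoidAlgebra k (Dual ℤ N) ⊗[k] Wedge k π :=
  TensorProduct.map (rayHom k v.1 hv).toLinearMap
    (CliffordAlgebra.contractLeft (Q := (0 : QuadraticForm k (RelM k π))) (rayForm k π v))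

variable {π : N →ₗ[ℤ] N'}

lemma rayRes_tmul {σ : Cone N} (v : LinearMap.ker π) (hv : pt v.1 ∈ σ) (a : CoordRing k σ)
    (b : Wedge k π) : rayRes π v hv (a ⊗ₜ b) =
      rayHom k v.1 hv a ⊗ₜ CliffordAlgebra.contractLeft (rayForm k π v) b := rfl

lemma rayRes_smul {σ : Cone N} (v : LinearMap.ker π) (hv : pt v.1 ∈ σ) (a : CoordRing k σ)
    (t : CoordRing k σ ⊗[k] Wedge k π) :
    rayRes π v hv (a • t) = rayHom k v.1 hv a • rayRes π v hv t := by
  induction t using TensorProduct.induction_on with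
  | zero => simp
  | add x y hx hy => rw [smul_add, map_add, hx, hy, map_add, smul_add]
  | tmul c b =>
    rw [TensorProduct.smul_tmul', rayRes_tmul, rayRes_tmul, smul_eq_mul, map_mul,
      TensorProduct.smul_tmul', smul_eq_mul]

lemma rayRes_coordMap {τ σ : Cone N} (h : τ ≤ σ) (v : LinearMap.ker π) (hv : pt v.1 ∈ τ)
    (t : CoordRing k σ ⊗[k] Wedge k π) :
    rayRes π v hv (Algebra.TensorProduct.map (coordMap k h) (AlgHom.id k _) t) =
      rayRes π v (h hv) t := by
  induction t using TensorProduct.induction_on with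
  | zero => simp
  | add x y hx hy => rw [map_add, map_add, map_add, hx, hy]
  | tmul c b =>
    rw [Algebra.TensorProduct.map_tmul, rayRes_tmul, rayRes_tmul, rayHom_coordMap]
    rfl

/-- In degrees orthogonal to `v` the residue is the contraction with `v`. Absence of a residue thus
becomes the condition in `killed`, degree by degree. -/
lemma gradedComp_rayRes {σ : Cone N} (v : LinearMap.ker π) (hv : pt v.1 ∈ σ) (u : dualMonoid σ)
    (hu : u.1 v = 0) (t : CoordRing k σ ⊗[k] Wedge k π) :
    gradedComp u.1 (rayRes π v hv t) =
      CliffordAlgebra.contractLeft (rayForm k π v) (gradedComp u t) := by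
  refine gradedComp_map _ (fun a => ?_) t
  classical
  induction a using coordRing_induction with
  | h0 => simp only [map_zero]
  | hadd x y hx hy => simp only [map_add, hx, hy]
  | hsmul c w =>
    rw [map_smul, map_smul, map_smul]
    congr 1
    rw [AlgHom.toLinearMap_apply, rayHom_chi, chi, coeffAt_single]
    by_cases h : w = u
    · subst h
      rw [if_pos hu, coeffAt_single]
      simp
    · rw [if_neg h]
      split_ifs with hw
      · rw [coeffAt_single, if_neg (fun h' => h (Subtype.ext h'))]
      · rw [map_zero]

end Ray

end Toric

/-! ### Graded description of forms on a chart -/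

namespace Toric

open ExteriorAlgebra

section ChartForms

variable (k : Type u) [Field k] {N N' : Type u} [AddCommGroup N] [AddCommGroup N']

/-- The class of `1 ⊗ u` in `M_{π,k}`. -/
noncomputable def relClass (π : N →ₗ[ℤ] N') (u : Dual ℤ N) : RelM k π :=
  Submodule.Quotient.mk (1 ⊗ₜ u)

lemma dlog_eq (π : N →ₗ[ℤ] N') (u : Dual ℤ N) : dlog k π u = ι k (relClass k π u) := rfl

lemma rayForm_relClass (π : N →ₗ[ℤ] N') (v : LinearMap.ker π) (u : Dual ℤ N) :
    rayForm k π v (relClass k π u) = (u v.1 : k) := by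
  change (LinearMap.liftBaseChange k _) (1 ⊗ₜ[ℤ] u) = _
  rw [LinearMap.liftBaseChange_tmul, one_smul]
  rfl

lemma toRel_tmul (π : N →ₗ[ℤ] N') (σ : Cone N) (a : CoordRing k σ) (u : Dual ℤ N) :
    toRel k π σ (a ⊗ₜ u) = a ⊗ₜ ι k (relClass k π u) := by
  rw [toRel, LinearMap.liftBaseChange_tmul]
  change a • ((1 : CoordRing k σ) ⊗ₜ[k] dlog k π u) = _
  rw [TensorProduct.smul_tmul', smul_eq_mul, mul_one, dlog_eq]

variable {k}

lemma relClass_span (π : N →ₗ[ℤ] N') {d : ℕ} (b : Basis (Fin d) ℤ N) (x : RelM k π) :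
    ∃ c : Fin d → k, x = ∑ j, c j • relClass k π (b.coord j) := by
  classical
  obtain ⟨y, rfl⟩ := Submodule.Quotient.mk_surjective _ x
  refine ⟨fun j => (b.dualBasis.baseChange k).repr y j, ?_⟩
  conv_lhs => rw [← (b.dualBasis.baseChange k).sum_repr y]
  change Submodule.mkQ _ _ = _
  rw [map_sum]
  refine Finset.sum_congr rfl fun j _ => ?_
  rw [map_smul, Basis.baseChange_apply, Basis.coe_dualBasis]
  rfl

/-- The set of all lattice points `v_ρ` in the kernel of `π`, for the rays `ρ ⊂ σ ∩ u^⊥`. -/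
def Fan.relRays (F : Fan N) (π : N →ₗ[ℤ] N') (σ : Cone N) (u : Dual ℤ N) :
    Set (LinearMap.ker π) :=
  {v | v.1 ∈ F.rayGens σ ∧ u v.1 = 0}

variable (k) in
/-- The sections over `A_σ` of `ω̃^q_{P/A}`. -/
noncomputable def Fan.tildePart (F : Fan N) (π : N →ₗ[ℤ] N') (σ : Cone N) (q : ℕ) :
    Submodule k (CoordRing k σ ⊗[k] Wedge k π) :=
  gradedPart fun u => killed (rayForm k π) (F.relRays π σ u.1) q

variable (k) in
/-- The sections over `A_σ` of the image of `ω^r_{P/A}(log D) ⊗ ω̃^q_{P/A}`. -/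
noncomputable def Fan.weightPart (F : Fan N) (π : N →ₗ[ℤ] N') (σ : Cone N) (r q : ℕ) :
    Submodule k (CoordRing k σ ⊗[k] Wedge k π) :=
  gradedPart fun u => ⋀[k]^r (RelM k π) * killed (rayForm k π) (F.relRays π σ u.1) q

variable (F : Fan N) (π : N →ₗ[ℤ] N')

/-- Both characters are nonnegative on the rays of `σ`, so their sum vanishes on a ray only if both
do. Larger degrees impose fewer conditions, which makes the graded parts modules over the coordinate
ring. -/
lemma Fan.relRays_add {σ : Cone N} (u w : dualMonoid σ) :
    F.relRays π σ (w + u).1 ⊆ F.relRays π σ u.1 := by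
  rintro v ⟨hv, h0⟩
  have h1 := dualMonoid_nonneg u (F.pt_mem_of_mem_rayGens hv)
  have h2 := dualMonoid_nonneg w (F.pt_mem_of_mem_rayGens hv)
  have h3 : w.1 v.1 + u.1 v.1 = 0 := h0
  exact ⟨hv, by omega⟩

lemma Fan.smul_mem_tildePart {σ : Cone N} {q : ℕ} (a : CoordRing k σ)
    {t : CoordRing k σ ⊗[k] Wedge k π} (ht : t ∈ F.tildePart k π σ q) :
    a • t ∈ F.tildePart k π σ q :=
  smul_mem_gradedPart (fun u w => killed_anti _ (F.relRays_add π u w) q) a ht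

lemma Fan.smul_mem_weightPart {σ : Cone N} {r q : ℕ} (a : CoordRing k σ)
    {t : CoordRing k σ ⊗[k] Wedge k π} (ht : t ∈ F.weightPart k π σ r q) :
    a • t ∈ F.weightPart k π σ r q :=
  smul_mem_gradedPart
    (fun u w => mul_le_mul' le_rfl (killed_anti _ (F.relRays_add π u w) q)) a ht

lemma Fan.coordMap_mem_tildePart {τ σ : Cone N} (h : τ ≤ σ) {q : ℕ}
    {t : CoordRing k σ ⊗[k] Wedge k π} (ht : t ∈ F.tildePart k π σ q) :
    Algebra.TensorProduct.map (coordMap k h) (AlgHom.id k _) t ∈ F.tildePart k π τ q := by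
  refine gradedPart_induction
    (P := fun t => Algebra.TensorProduct.map (coordMap k h) (AlgHom.id k _) t ∈
      F.tildePart k π τ q) ?_ ?_ ?_ ht
  · rw [map_zero]; exact Submodule.zero_mem _
  · intro s t hs ht
    rw [map_add]; exact Submodule.add_mem _ hs ht
  · intro u m hm
    have h1 : Algebra.TensorProduct.map (coordMap k h) (AlgHom.id k (Wedge k π))
        (AddMonoidAlgebra.single u (1 : k) ⊗ₜ m) =
          AddMonoidAlgebra.single (AddSubmonoid.inclusion (dualMonoid_anti h) u) (1 : k) ⊗ₜ m := by
      rw [Algebra.TensorProduct.map_tmul, coordMap_single]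
      rfl
    rw [h1]
    refine single_tmul_mem_gradedPart (killed_anti _ ?_ q hm)
    rintro v ⟨hv, h0⟩
    exact ⟨F.rayGens_mono h hv, h0⟩

/-! ### Forms on nonsingular charts -/

section Generic

variable {A R V : Type*} [CommRing A] [Algebra k A] [CommRing R] [Algebra k R] [AddCommGroup V]
  [Module k V]

lemma tensorMap_smul {B : Type*} [Ring B] [Algebra k B] (h : A →ₐ[k] R) (a : A) (s : A ⊗[k] B) :
    Algebra.TensorProduct.map h (AlgHom.id k B) (a • s) =
      h a • Algebra.TensorProduct.map h (AlgHom.id k B) s := by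
  induction s using TensorProduct.induction_on with
  | zero => simp
  | add x y hx hy => rw [smul_add, map_add, map_add, smul_add, hx, hy]
  | tmul b m =>
    rw [TensorProduct.smul_tmul', smul_eq_mul, Algebra.TensorProduct.map_tmul, map_mul,
      Algebra.TensorProduct.map_tmul, TensorProduct.smul_tmul', smul_eq_mul]

lemma tensorMap_linear_smul {B B' : Type*} [AddCommGroup B] [Module k B] [AddCommGroup B']
    [Module k B'] (h : A →ₐ[k] R) (g : B →ₗ[k] B') (a : A) (s : A ⊗[k] B) :
    TensorProduct.map h.toLinearMap g (a • s) = h a • TensorProduct.map h.toLinearMap g s := by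
  induction s using TensorProduct.induction_on with
  | zero => simp
  | add x y hx hy => rw [smul_add, map_add, map_add, smul_add, hx, hy]
  | tmul b m =>
    rw [TensorProduct.smul_tmul', smul_eq_mul, TensorProduct.map_tmul, AlgHom.toLinearMap_apply,
      map_mul, TensorProduct.map_tmul, TensorProduct.smul_tmul', smul_eq_mul]
    rfl

/-- The residue is an antiderivation relative to the restriction `h` of functions to the divisor. -/
lemma map_contractLeft_ι_mul (h : A →ₐ[k] R) (d : Dual k V) (a : A) (x : V)
    (y : A ⊗[k] ExteriorAlgebra k V) :
    TensorProduct.map h.toLinearMap (CliffordAlgebra.contractLeft (Q := (0 : QuadraticForm k V)) d)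
        ((a ⊗ₜ ι k x) * y) =
      d x • (h a • Algebra.TensorProduct.map h (AlgHom.id k _) y) - (h a ⊗ₜ ι k x) *
        TensorProduct.map h.toLinearMap
          (CliffordAlgebra.contractLeft (Q := (0 : QuadraticForm k V)) d) y := by
  induction y using TensorProduct.induction_on with
  | zero => simp
  | add y z hy hz =>
    rw [mul_add, map_add, hy, hz, map_add, map_add, mul_add, smul_add, smul_add]; abel
  | tmul c b =>
    rw [Algebra.TensorProduct.tmul_mul_tmul, TensorProduct.map_tmul, TensorProduct.map_tmul,
      contractLeft_ι_mul', Algebra.TensorProduct.tmul_mul_tmul, TensorProduct.tmul_sub,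
      Algebra.TensorProduct.map_tmul, TensorProduct.smul_tmul', TensorProduct.tmul_smul,
      smul_eq_mul, AlgHom.toLinearMap_apply, AlgHom.toLinearMap_apply, map_mul]
    rfl

/-- A generator `a ⊗ x` contributes to the residue of a product only through `d x` times `h a`. If
this vanishes for each generator, all products are without residue. -/
lemma map_contractLeft_eq_zero (h : A →ₐ[k] R) (d : Dual k V)
    {S : Set (A ⊗[k] ExteriorAlgebra k V)}
    (hS : ∀ g ∈ S, ∃ a x, g = a ⊗ₜ ι k x ∧ (h a = 0 ∨ d x = 0)) {p : ℕ}
    {t : A ⊗[k] ExteriorAlgebra k V} (ht : t ∈ (Submodule.span A S) ^ p) :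
    TensorProduct.map h.toLinearMap
      (CliffordAlgebra.contractLeft (Q := (0 : QuadraticForm k V)) d) t = 0 := by
  induction ht using Submodule.pow_induction_on_left' with
  | algebraMap r =>
    rw [Algebra.TensorProduct.algebraMap_apply, TensorProduct.map_tmul,
      CliffordAlgebra.contractLeft_one, TensorProduct.tmul_zero]
  | add x y i hx hy h1 h2 => rw [map_add, h1, h2, add_zero]
  | mem_mul t ht i y hy ih =>
    induction ht using Submodule.span_induction with
    | zero => rw [zero_mul, map_zero]
    | add s t _ _ hs ht => rw [add_mul, map_add, hs, ht, add_zero]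
    | smul a t _ ht => rw [smul_mul_assoc, tensorMap_linear_smul, ht, smul_zero]
    | mem t ht =>
      obtain ⟨a, x, rfl, hax⟩ := hS t ht
      rw [map_contractLeft_ι_mul, ih, mul_zero, sub_zero]
      rcases hax with h0 | h0
      · rw [h0, zero_smul, smul_zero]
      · rw [h0, zero_smul]

end Generic

variable {F π}

/-- The ray `v` is a member `b i` of the adapted basis. The generator `dx_i` is divisible by `x_i`,
which vanishes on the divisor of `v`, and every other generator is orthogonal to `v`. -/
lemma rayRes_eq_zero_of_mem_relOmegaOne_pow {σ : Cone N} (hσ : σ ∈ F.cones)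
    {v : LinearMap.ker π} (hv : v.1 ∈ F.rayGens σ) (hvσ : pt v.1 ∈ σ) {p : ℕ}
    {t : CoordRing k σ ⊗[k] Wedge k π} (ht : t ∈ (relOmegaOne k π σ) ^ p) :
    rayRes π v hvσ t = 0 := by
  classical
  rw [relOmegaOne, omegaOne, Submodule.map_span] at ht
  refine map_contractLeft_eq_zero (rayHom k v.1 hvσ) (rayForm k π v) ?_ ht
  rintro _ ⟨t, ⟨d, b, S, j, hS, ht⟩, rfl⟩
  obtain ⟨i, hi, hvi⟩ := hS.exists_of_mem_rayGens hσ hv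
  have hπi : π (b i) = 0 := by rw [← hvi]; exact v.2
  have hval : i ≠ j → rayForm k π v (relClass k π (b.coord j)) = 0 := by
    intro hij
    rw [rayForm_relClass, hvi, Basis.coord_apply, Basis.repr_self,
      Finsupp.single_apply, if_neg hij, Int.cast_zero]
  rcases ht with ⟨⟨hj, hπj⟩, hmem, rfl⟩ | ⟨hj, rfl⟩
  · refine ⟨_, _, toRel_tmul k π σ _ _, ?_⟩
    by_cases hij : i = j
    · subst hij
      left
      rw [rayHom_chi, if_neg]
      rw [hvi]
      simp
    · exact Or.inr (hval hij)
  · refine ⟨_, _, toRel_tmul k π σ _ _, Or.inr (hval ?_)⟩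
    -- The index of `v` is of the first kind, since `v` is a contracted generator of `σ`.
    rintro rfl
    exact hj ⟨hi, hπi⟩

end ChartForms

end Toric

/-! ### Forms without residues on nonsingular charts are wedge products -/

namespace Toric

open ExteriorAlgebra

section NonsingularForms

variable {k : Type u} [Field k] {N N' : Type u} [AddCommGroup N] [AddCommGroup N']
  {F : Fan N} {π : N →ₗ[ℤ] N'}

lemma IsAdapted.mem_dualMonoid {σ : Cone N} {d : ℕ} {b : Basis (Fin d) ℤ N} {S : Set (Fin d)}
    (hS : IsAdapted σ b S) {u : Dual ℤ N} (hu : ∀ j ∈ S, 0 ≤ u (b j)) : u ∈ dualMonoid σ := by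
  rw [IsAdapted] at hS
  subst hS
  refine mem_dualMonoid_hull ?_
  rintro _ ⟨j, hj, rfl⟩
  exact hu j hj

lemma IsAdapted.pt_mem {σ : Cone N} {d : ℕ} {b : Basis (Fin d) ℤ N} {S : Set (Fin d)}
    (hS : IsAdapted σ b S) {j : Fin d} (hj : j ∈ S) : pt (b j) ∈ σ := by
  rw [IsAdapted] at hS
  rw [hS]
  exact pt_mem_hull ⟨j, hj, rfl⟩

lemma mul_mem_pow_succ {A C : Type*} [CommSemiring A] [Semiring C] [Algebra A C]
    {Ω : Submodule A C} {x y : C} (hx : x ∈ Ω) {n : ℕ} (hy : y ∈ Ω ^ n) : x * y ∈ Ω ^ (n + 1) := by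
  rw [pow_succ']
  exact Submodule.mul_mem_mul hx hy

lemma tmul_one_mem_pow_zero {A B : Type*} [CommRing A] [Algebra k A] [Ring B] [Algebra k B]
    (Ω : Submodule A (A ⊗[k] B)) (a : A) : a ⊗ₜ[k] (1 : B) ∈ Ω ^ 0 := by
  rw [pow_zero]
  exact Submodule.mem_one.2 ⟨a, rfl⟩

/-- Each occurrence of `dx_j / x_j` with `b j` a contracted generator of `σ` uses up one factor
`x_j` of `χ^u` to become `dx_j`. The bound on the multiplicities says that `χ^u` has enough such
factors. -/
lemma IsAdapted.list_prod_mem {σ : Cone N} {d : ℕ} {b : Basis (Fin d) ℤ N} {S : Set (Fin d)}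
    (hS : IsAdapted σ b S) (l : List (Fin d)) (u : dualMonoid σ)
    (h : ∀ j ∈ S, π (b j) = 0 → (l.count j : ℤ) ≤ u.1 (b j)) :
    chi k u ⊗ₜ[k] (l.map fun j => ι k (relClass k π (b.coord j))).prod ∈
      relOmegaOne k π σ ^ l.length := by
  classical
  induction l generalizing u with
  | nil => exact tmul_one_mem_pow_zero _ _
  | cons j l ih =>
    rw [List.length_cons, List.map_cons, List.prod_cons]
    have hcoord : ∀ i, b.coord j (b i) = if i = j then 1 else 0 := fun i => by
      rw [Basis.coord_apply, Basis.repr_self, Finsupp.single_apply]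
    by_cases hj : j ∈ S ∧ π (b j) = 0
    · have hmem : b.coord j ∈ dualMonoid σ := hS.mem_dualMonoid fun i _ => by
        rw [hcoord]; split_ifs <;> simp
      have hc := h j hj.1 hj.2
      rw [List.count_cons_self] at hc
      push_cast at hc
      have hmem' : u.1 - b.coord j ∈ dualMonoid σ := hS.mem_dualMonoid fun i hi => by
        have := dualMonoid_nonneg u (hS.pt_mem hi)
        rw [LinearMap.sub_apply, hcoord]
        split_ifs with hij
        · subst hij; omega
        · omega
      have hsplit : chi k u = chi k ⟨b.coord j, hmem⟩ * chi k ⟨u.1 - b.coord j, hmem'⟩ := by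
        rw [chi, chi, chi, AddMonoidAlgebra.single_mul_single, mul_one]
        congr 1
        exact Subtype.ext (add_sub_cancel _ _).symm
      rw [hsplit, ← Algebra.TensorProduct.tmul_mul_tmul]
      refine mul_mem_pow_succ ?_ (ih _ fun i hi hπ => ?_)
      · rw [← toRel_tmul]
        exact Submodule.mem_map_of_mem (Submodule.subset_span
          ⟨d, b, S, j, hS, Or.inl ⟨hj, hmem, rfl⟩⟩)
      · have h1 := h i hi hπ
        change _ ≤ (u.1 - b.coord j) (b i)
        rw [LinearMap.sub_apply, hcoord]
        rw [List.count_cons] at h1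
        push_cast at h1
        by_cases hij : i = j
        · subst hij
          simp at h1 ⊢
          omega
        · have hij' : ¬ j = i := fun h => hij h.symm
          simp [hij, hij'] at h1 ⊢
          omega
    · rw [← one_mul (chi k u), ← Algebra.TensorProduct.tmul_mul_tmul]
      refine mul_mem_pow_succ ?_ (ih _ fun i hi hπ => ?_)
      · rw [← toRel_tmul]
        exact Submodule.mem_map_of_mem (Submodule.subset_span
          ⟨d, b, S, j, hS, Or.inr ⟨hj, rfl⟩⟩)
      · refine le_trans ?_ (h i hi hπ)
        exact_mod_cast List.count_le_count_cons

/-- The contracted rays in `σ ∩ u^⊥` are members of the adapted basis, with dual family the classes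
of their coordinates. The common kernel of their functionals is spanned by the classes of the
remaining coordinates. -/
lemma IsAdapted.killed_le {σ : Cone N} (hσ : σ ∈ F.cones) {d : ℕ} {b : Basis (Fin d) ℤ N}
    {S : Set (Fin d)} (hS : IsAdapted σ b S) (u : Dual ℤ N) (p : ℕ) :
    killed (rayForm k π) (F.relRays π σ u) p ≤ (Submodule.span k
      ((fun j => ι k (relClass k π (b.coord j))) ''
        {j | ¬ (j ∈ S ∧ π (b j) = 0 ∧ u (b j) = 0)})) ^ p := by
  classical
  have hfin : (F.relRays π σ u).Finite := by
    have h1 : (Set.range b).Finite := Set.finite_range b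
    refine Set.Finite.of_finite_image (f := Subtype.val) (h1.subset ?_)
      Subtype.val_injective.injOn
    rintro _ ⟨v, hv, rfl⟩
    obtain ⟨j, -, hj⟩ := hS.exists_of_mem_rayGens hσ hv.1
    exact ⟨j, hj.symm⟩
  let e : LinearMap.ker π → RelM k π := fun v =>
    if h : ∃ j, v.1 = b j then relClass k π (b.coord h.choose) else 0
  have he : ∀ v ∈ hfin.toFinset, ∀ w ∈ hfin.toFinset,
      rayForm k π v (e w) = if v = w then 1 else 0 := by
    intro v hv w hw
    obtain ⟨i, -, hi⟩ := hS.exists_of_mem_rayGens hσ (hfin.mem_toFinset.1 hv).1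
    obtain ⟨j, -, hj⟩ := hS.exists_of_mem_rayGens hσ (hfin.mem_toFinset.1 hw).1
    have hw' : ∃ j, w.1 = b j := ⟨j, hj⟩
    have hvw : v = w ↔ i = hw'.choose := by
      have : Nontrivial ℤ := inferInstance
      rw [← b.injective.eq_iff, ← hi, ← hw'.choose_spec, Subtype.ext_iff]
    simp only [e, dif_pos hw']
    rw [rayForm_relClass, hi, Basis.coord_apply, Basis.repr_self, Finsupp.single_apply]
    simp only [hvw]
    split_ifs <;> simp
  have h1 := killed_eq he p
  rw [hfin.coe_toFinset] at h1
  rw [h1]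
  refine pow_le_pow_left' (M := Submodule k (Wedge k π)) ?_ p
  rintro _ ⟨_, ⟨x, rfl⟩, rfl⟩
  obtain ⟨c, hc⟩ := relClass_span π b (dualProj (rayForm k π) e hfin.toFinset x)
  -- The classes of the coordinates need not be independent in `M_{π,k}`, but for contracted `b j`
  -- the pairing with `b j` is well defined and reads off `c j`.
  have hc0 : ∀ j, (j ∈ S ∧ π (b j) = 0 ∧ u (b j) = 0) → c j = 0 := by
    rintro j ⟨hj, hπ, huj⟩
    have hmem : (⟨b j, hπ⟩ : LinearMap.ker π) ∈ hfin.toFinset :=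
      hfin.mem_toFinset.2 ⟨hS.mem_rayGens hσ hj, huj⟩
    have h2 := apply_dualProj he hmem x
    rw [hc, map_sum, Finset.sum_eq_single j] at h2
    · rw [map_smul, rayForm_relClass] at h2
      simpa using h2
    · intro i _ hij
      rw [map_smul, rayForm_relClass, Basis.coord_apply, Basis.repr_self, Finsupp.single_apply,
        if_neg hij.symm, Int.cast_zero, smul_zero]
    · exact fun h => (h (Finset.mem_univ j)).elim
  rw [hc, map_sum]
  refine Submodule.sum_mem _ fun j _ => ?_
  by_cases hj : j ∈ S ∧ π (b j) = 0 ∧ u (b j) = 0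
  · rw [hc0 j hj, zero_smul, map_zero]
    exact Submodule.zero_mem _
  · rw [map_smul]
    exact Submodule.smul_mem _ _ (Submodule.subset_span ⟨j, hj, rfl⟩)

/-- In degree `u` only products of coordinate classes occur in which every index of a contracted
generator `b j` has `u (b j) ≥ 1`. Without repeated indices such a product meets the bound of
`IsAdapted.list_prod_mem`; with a repeated index it is zero. -/
lemma Fan.tildePart_le {σ : Cone N} (hσ : σ ∈ F.cones) (hns : IsNonsingular σ) {p : ℕ}
    {t : CoordRing k σ ⊗[k] Wedge k π} (ht : t ∈ F.tildePart k π σ p) :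
    t ∈ relOmegaOne k π σ ^ p := by
  classical
  obtain ⟨d, b, S, hS⟩ := hns
  refine gradedPart_induction (P := fun t => t ∈ relOmegaOne k π σ ^ p) (Submodule.zero_mem _)
    (fun s t hs ht => Submodule.add_mem _ hs ht) (fun u m hm => ?_) ht
  have h1 := hS.killed_le hσ u.1 p hm
  clear hm
  rw [Submodule.span_pow] at h1
  change chi k u ⊗ₜ m ∈ _
  induction h1 using Submodule.span_induction with
  | zero => rw [TensorProduct.tmul_zero]; exact Submodule.zero_mem _
  | add x y _ _ hx hy =>
    rw [TensorProduct.tmul_add]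
    exact Submodule.add_mem _ hx hy
  | smul c x _ hx =>
    rw [TensorProduct.tmul_smul, ← algebraMap_smul (CoordRing k σ)]
    exact Submodule.smul_mem _ _ hx
  | mem x hx =>
    obtain ⟨g, rfl⟩ := Set.mem_pow.1 hx
    choose f hf hfg using fun i => (g i).2
    have hg : (List.ofFn fun i => (g i : Wedge k π)) =
        (List.ofFn f).map fun j => ι k (relClass k π (b.coord j)) := by
      rw [List.map_ofFn]
      exact congrArg List.ofFn (funext fun i => (hfg i).symm)
    rw [hg]
    by_cases hinj : Function.Injective f
    · have h2 := hS.list_prod_mem (k := k) (π := π) (List.ofFn f) u fun j hj hπ => ?_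
      · rwa [List.length_ofFn] at h2
      · have h0 := dualMonoid_nonneg u (hS.pt_mem hj)
        have h3 := List.nodup_iff_count_le_one.1 (List.nodup_ofFn.2 hinj) j
        by_cases hmem : j ∈ List.ofFn f
        · obtain ⟨i, rfl⟩ := List.mem_ofFn.1 hmem
          have h4 : u.1 (b (f i)) ≠ 0 := fun h => hf i ⟨hj, hπ, h⟩
          omega
        · rw [List.count_eq_zero_of_not_mem hmem]
          exact_mod_cast h0
    · have h2 : ((List.ofFn f).map fun j => ι k (relClass k π (b.coord j))).prod = 0 := by
        rw [List.map_ofFn]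
        exact (ιMulti_apply _).symm.trans (ιMulti_eq_zero_of_not_inj
          (v := fun i => relClass k π (b.coord (f i))) fun h => hinj fun i j hij => h (by simp [hij]))
      rw [h2, TensorProduct.tmul_zero]
      exact Submodule.zero_mem _

end NonsingularForms

end Toric

/-! ### Charts of a toric variety and their principal open subsets -/

namespace Toric

section ChartOpens

variable (k : Type u) [Field k] {N : Type u} [AddCommGroup N] (F : Fan N)

/-- An arbitrary morphism `g` that factors through the chart is allowed, so that the inclusions of
smaller charts and the maps from charts of orbit closures are treated alike. -/
lemma Fan.chartHom_appLE (σ : F.cones) {V : (F.variety k).Opens} (h : V ≤ F.chartOpen k σ)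
    {S : CommRingCat.{u}} (φ : CommRingCat.of (CoordRing k σ.1) ⟶ S)
    (g : Spec S ⟶ F.variety k) (hg : g = Spec.map φ ≫ F.chartι k σ) (W : (Spec S).Opens)
    (e : W ≤ g ⁻¹ᵁ V) (a : CoordRing k σ.1) :
    g.appLE V W e (F.chartHom k σ h a) =
      (Spec S).presheaf.map (homOfLE (le_top : W ≤ ⊤)).op ((Scheme.ΓSpecIso S).inv (φ a)) := by
  subst hg
  have h1 : ((Scheme.ΓSpecIso (.of (CoordRing k σ.1))).inv ≫
      ((F.chartι k σ).appIso ⊤).inv ≫ (F.variety k).presheaf.map (homOfLE h).op) ≫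
        (Spec.map φ ≫ F.chartι k σ).appLE V W e =
      φ ≫ (Scheme.ΓSpecIso S).inv ≫ (Spec S).presheaf.map (homOfLE (le_top : W ≤ ⊤)).op := by
    have e' : W ≤ Spec.map φ ⁻¹ᵁ (F.chartι k σ ⁻¹ᵁ V) := e
    rw [Category.assoc, Category.assoc, Scheme.Hom.map_appLE,
      ← Scheme.Hom.appLE_comp_appLE (Spec.map φ) (F.chartι k σ) _ ⊤ W (by simp) le_top,
      Scheme.Hom.appIso_inv_appLE_assoc, ← Category.assoc φ, Scheme.ΓSpecIso_inv_naturality,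
      Category.assoc]
    congr 1
  exact congrArg (fun g => g.hom a) h1

lemma Fan.chartι_app_injective (σ : F.cones) {V : (F.variety k).Opens} (h : V ≤ F.chartOpen k σ) :
    Function.Injective ((F.chartι k σ).appLE V (F.chartι k σ ⁻¹ᵁ V) le_rfl) := by
  have : IsIso ((F.chartι k σ).app V) :=
    Scheme.Hom.isIso_app _ _ (h.trans (by simp [Scheme.Hom.image_top_eq_opensRange]))
  rw [Scheme.Hom.appLE_eq_app]
  exact (ConcreteCategory.bijective_of_isIso ((F.chartι k σ).app V)).1

lemma Fan.chartι_coordMap_apply {τ σ : F.cones} (h : τ ≤ σ) (x : Spec (.of (CoordRing k τ.1))) :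
    F.chartι k σ (Spec.map (CommRingCat.ofHom (coordMap k h).toRingHom) x) = F.chartι k τ x := by
  rw [← Scheme.Hom.comp_apply, F.charts_w k h]

lemma Fan.chartOpen_mono {τ σ : F.cones} (h : τ ≤ σ) : F.chartOpen k τ ≤ F.chartOpen k σ := by
  rintro _ ⟨x, -, rfl⟩
  exact ⟨_, trivial, F.chartι_coordMap_apply k h x⟩

lemma Fan.chartHom_coordMap {τ σ : F.cones} (h : τ ≤ σ) {V : (F.variety k).Opens}
    (hV : V ≤ F.chartOpen k τ) (a : CoordRing k σ.1) :
    F.chartHom k τ hV (coordMap k h a) =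
      F.chartHom k σ (hV.trans (F.chartOpen_mono k h)) a := by
  refine F.chartι_app_injective k τ hV ?_
  rw [F.chartHom_appLE k τ hV (𝟙 _) _ (by simp),
    F.chartHom_appLE k σ _ (CommRingCat.ofHom (coordMap k h).toRingHom) _ (F.charts_w k h).symm]
  rfl

/-- In the gluing, points of two charts are identified only through the chart of a cone contained in
both. -/
lemma Fan.chartOpen_inf_le (σ σ' : F.cones) : F.chartOpen k σ ⊓ F.chartOpen k σ' ≤
    F.chartOpen k ⟨σ.1 ⊓ σ'.1, F.inf_mem σ.2 σ'.2⟩ := by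
  rintro x ⟨⟨y, -, hy⟩, ⟨y', -, hy'⟩⟩
  obtain ⟨τ, f, f', z, hz, -⟩ := (Scheme.IsLocallyDirected.ι_eq_ι_iff (F.charts k)
    (xi := y) (xj := y')).1 (hy.trans hy'.symm)
  refine F.chartOpen_mono k (τ := τ) (show τ.1 ≤ σ.1 ⊓ σ'.1 from le_inf (leOfHom f) (leOfHom f')) ⟨z, trivial, ?_⟩
  refine ((F.chartι_coordMap_apply k (leOfHom f) z).symm.trans ?_).trans hy
  exact congrArg (F.chartι k σ) hz

lemma Fan.exists_mem_chartOpen (x : F.variety k) : ∃ σ, x ∈ F.chartOpen k σ := by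
  obtain ⟨σ, y, hy⟩ := (Scheme.IsLocallyDirected.openCover (F.charts k)).exists_eq x
  exact ⟨σ, y, trivial, hy⟩

/-- The principal open subset of `A_σ` defined by `f`. -/
noncomputable def Fan.chartBasic (σ : F.cones) (f : CoordRing k σ.1) : (F.variety k).Opens :=
  (F.variety k).basicOpen (F.chartHom k σ le_rfl f)

lemma Fan.chartBasic_le (σ : F.cones) (f : CoordRing k σ.1) :
    F.chartBasic k σ f ≤ F.chartOpen k σ := Scheme.basicOpen_le _ _

lemma Fan.isAffineOpen_chartOpen (σ : F.cones) : IsAffineOpen (F.chartOpen k σ) :=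
  (isAffineOpen_top _).image_of_isOpenImmersion _

lemma Fan.chartHom_bijective (σ : F.cones) :
    Function.Bijective (F.chartHom k σ (le_refl (F.chartOpen k σ))) := by
  have : IsIso ((Scheme.ΓSpecIso (.of (CoordRing k σ.1))).inv ≫
    ((F.chartι k σ).appIso ⊤).inv ≫
      (F.variety k).presheaf.map (homOfLE (le_refl (F.chartOpen k σ))).op) := by
    have : IsIso ((F.variety k).presheaf.map (homOfLE (le_refl (F.chartOpen k σ))).op) := by
      change IsIso ((F.variety k).presheaf.map (𝟙 _))
      infer_instance
    infer_instance
  exact ConcreteCategory.bijective_of_isIso ((Scheme.ΓSpecIso (.of (CoordRing k σ.1))).inv ≫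
    ((F.chartι k σ).appIso ⊤).inv ≫
      (F.variety k).presheaf.map (homOfLE (le_refl (F.chartOpen k σ))).op)

lemma Fan.exists_mem_chartBasic (σ : F.cones) {x : F.variety k} (hx : x ∈ F.chartOpen k σ)
    {U : (F.variety k).Opens} (hU : x ∈ U) :
    ∃ f, x ∈ F.chartBasic k σ f ∧ F.chartBasic k σ f ≤ U := by
  obtain ⟨f, hf, hx⟩ := (F.isAffineOpen_chartOpen k σ).exists_basicOpen_le ⟨x, hU⟩ hx
  obtain ⟨f, rfl⟩ := (F.chartHom_bijective k σ).2 f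
  exact ⟨f, hx, hf⟩

lemma Fan.isUnit_chartHom (σ : F.cones) {f : CoordRing k σ.1} {V : (F.variety k).Opens}
    (hV : V ≤ F.chartBasic k σ f) :
    IsUnit (F.chartHom k σ (hV.trans (F.chartBasic_le k σ f)) f) := by
  have h := RingedSpace.isUnit_res_basicOpen _ (F.chartHom k σ le_rfl f)
  have h2 : IsUnit (F.chartHom k σ (F.chartBasic_le k σ f) f) := by
    rw [← F.resHom_chartHom k σ (F.chartBasic_le k σ f) le_rfl f]
    exact h
  rw [← F.resHom_chartHom k σ hV (F.chartBasic_le k σ f) f]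
  exact h2.map _

/-- Functions on a principal open subset form a localization. This fact and its counterpart
`Fan.exists_chartHom_eq` are stated with powers of `f`, a form which passes to tensor products with
`B`. -/
lemma Fan.chartHom_eq_zero (σ : F.cones) {f a : CoordRing k σ.1}
    (h : F.chartHom k σ (F.chartBasic_le k σ f) a = 0) : ∃ n : ℕ, f ^ n * a = 0 := by
  let _ : Algebra Γ(F.variety k, F.chartOpen k σ) Γ(F.variety k, F.chartBasic k σ f) :=
    ((F.variety k).presheaf.map (homOfLE (F.chartBasic_le k σ f)).op).hom.toAlgebra
  have : IsLocalization.Away (F.chartHom k σ le_rfl f) Γ(F.variety k, F.chartBasic k σ f) :=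
    (F.isAffineOpen_chartOpen k σ).isLocalization_basicOpen (F.chartHom k σ le_rfl f)
  rw [← F.resHom_chartHom k σ (F.chartBasic_le k σ f) le_rfl a] at h
  obtain ⟨⟨_, n, rfl⟩, hn⟩ := (IsLocalization.map_eq_zero_iff
    (Submonoid.powers (F.chartHom k σ le_rfl f)) Γ(F.variety k, F.chartBasic k σ f) (F.chartHom k σ le_rfl a)).1 h
  refine ⟨n, (F.chartHom_bijective k σ).1 ?_⟩
  rw [map_mul, map_pow, map_zero]
  exact hn

lemma Fan.exists_chartHom_eq (σ : F.cones) (f : CoordRing k σ.1)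
    (s : Γ(F.variety k, F.chartBasic k σ f)) : ∃ (n : ℕ) (a : CoordRing k σ.1),
      F.chartHom k σ (F.chartBasic_le k σ f) a =
        F.chartHom k σ (F.chartBasic_le k σ f) f ^ n * s := by
  let _ : Algebra Γ(F.variety k, F.chartOpen k σ) Γ(F.variety k, F.chartBasic k σ f) :=
    ((F.variety k).presheaf.map (homOfLE (F.chartBasic_le k σ f)).op).hom.toAlgebra
  have : IsLocalization.Away (F.chartHom k σ le_rfl f) Γ(F.variety k, F.chartBasic k σ f) :=
    (F.isAffineOpen_chartOpen k σ).isLocalization_basicOpen (F.chartHom k σ le_rfl f)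
  obtain ⟨⟨a, ⟨_, n, rfl⟩⟩, h⟩ := IsLocalization.surj
    (Submonoid.powers (F.chartHom k σ le_rfl f)) s
  obtain ⟨a, rfl⟩ := (F.chartHom_bijective k σ).2 a
  refine ⟨n, a, ?_⟩
  rw [← F.resHom_chartHom k σ (F.chartBasic_le k σ f) le_rfl a,
    ← F.resHom_chartHom k σ (F.chartBasic_le k σ f) le_rfl f, ← map_pow, mul_comm]
  exact h.symm

lemma Fan.chartι_mem_chartBasic (σ : F.cones) (f : CoordRing k σ.1)
    (y : PrimeSpectrum (CoordRing k σ.1)) :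
    (F.chartι k σ) y ∈ F.chartBasic k σ f ↔ f ∉ y.asIdeal := by
  have h1 := Scheme.preimage_basicOpen (F.chartι k σ) (F.chartHom k σ le_rfl f)
  have h2 : (F.chartι k σ) y ∈ F.chartBasic k σ f ↔
    y ∈ (F.chartι k σ) ⁻¹ᵁ (F.variety k).basicOpen (F.chartHom k σ le_rfl f) := Iff.rfl
  rw [h2, h1]
  have h3 := F.chartHom_appLE k σ le_rfl (𝟙 _) (F.chartι k σ) (by simp) _ le_rfl f
  rw [Scheme.Hom.appLE_eq_app] at h3
  rw [h3]
  have h4 := Scheme.basicOpen_res (Spec (.of (CoordRing k σ.1)))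
    ((Scheme.ΓSpecIso (.of (CoordRing k σ.1))).inv f)
    (homOfLE (le_top : F.chartι k σ ⁻¹ᵁ F.chartOpen k σ ≤ ⊤)).op
  rw [show ((𝟙 (CommRingCat.of (CoordRing k σ.1))) f : CoordRing k σ.1) = f from rfl, h4,
    basicOpen_eq_of_affine]
  constructor
  · exact fun h => h.2
  · exact fun h => ⟨⟨y, trivial, rfl⟩, h⟩

end ChartOpens

end Toric

/-! ### Sections of `𝒪 ⊗ B` on principal open subsets -/

namespace Toric

section Tensor

variable {k : Type*} [Field k] {A R B : Type*} [CommRing A] [Algebra k A] [CommRing R]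
  [Algebra k R] [Ring B] [Algebra k B]

lemma tensorMap_equivFinsupp {ι : Type*} [DecidableEq ι] (b : Basis ι k B) (φ : A →ₐ[k] R) (t : A ⊗[k] B) (i : ι) :
    TensorProduct.equivFinsuppOfBasisRight b (Algebra.TensorProduct.map φ (AlgHom.id k B) t) i =
      φ (TensorProduct.equivFinsuppOfBasisRight b t i) := by
  induction t using TensorProduct.induction_on with
  | zero => simp
  | add x y hx hy => simp only [map_add, Finsupp.add_apply, hx, hy]
  | tmul a c => simp

lemma equivFinsupp_smul {ι : Type*} [DecidableEq ι] (b : Basis ι k B) (a : A) (t : A ⊗[k] B) (i : ι) :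
    TensorProduct.equivFinsuppOfBasisRight b (a • t) i =
      a * TensorProduct.equivFinsuppOfBasisRight b t i := by
  induction t using TensorProduct.induction_on with
  | zero => simp
  | add x y hx hy =>
    rw [smul_add, map_add, map_add, Finsupp.add_apply, Finsupp.add_apply, hx, hy, mul_add]
  | tmul c d => simp [TensorProduct.smul_tmul']

lemma smul_eq_zero_of_tensorMap_eq_zero [Module.Finite k B] (φ : A →ₐ[k] R) {f : A}
    (h : ∀ a, φ a = 0 → ∃ n : ℕ, f ^ n * a = 0) {t : A ⊗[k] B}
    (ht : Algebra.TensorProduct.map φ (AlgHom.id k B) t = 0) : ∃ n : ℕ, f ^ n • t = 0 := by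
  let b := finBasis k B
  have h1 : ∀ i, ∃ n : ℕ, f ^ n * TensorProduct.equivFinsuppOfBasisRight b t i = 0 := fun i =>
    h _ (by rw [← tensorMap_equivFinsupp, ht, map_zero, Finsupp.zero_apply])
  choose n hn using h1
  -- The sum of the exponents serves for all coordinates at once.
  refine ⟨∑ i, n i, (TensorProduct.equivFinsuppOfBasisRight b).injective (Finsupp.ext fun i => ?_)⟩
  rw [equivFinsupp_smul, map_zero, Finsupp.zero_apply, ← Finset.add_sum_erase _ _ (Finset.mem_univ i),
    pow_add, mul_right_comm, hn, zero_mul]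

lemma exists_tensorMap_eq (φ : A →ₐ[k] R) {f : A}
    (h : ∀ s, ∃ (n : ℕ) (a : A), φ a = φ f ^ n * s) (s : R ⊗[k] B) :
    ∃ (n : ℕ) (t : A ⊗[k] B), Algebra.TensorProduct.map φ (AlgHom.id k B) t = φ f ^ n • s := by
  induction s using TensorProduct.induction_on with
  | zero => exact ⟨0, 0, by simp⟩
  | add x y hx hy =>
    obtain ⟨n, t, ht⟩ := hx
    obtain ⟨n', t', ht'⟩ := hy
    refine ⟨n + n', f ^ n' • t + f ^ n • t', ?_⟩
    rw [map_add, tensorMap_smul, tensorMap_smul, ht, ht', map_pow, map_pow, smul_add, smul_smul,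
      smul_smul, ← pow_add, ← pow_add, add_comm n']
  | tmul r c =>
    obtain ⟨n, a, ha⟩ := h r
    exact ⟨n, a ⊗ₜ c, by rw [Algebra.TensorProduct.map_tmul, ha, TensorProduct.smul_tmul']; rfl⟩

end Tensor

section ChartMap

variable (k : Type u) [Field k] {N : Type u} [AddCommGroup N] (F : Fan N)
  (B : Type u) [Ring B] [Algebra k B]

/-- The section of `𝒪_P ⊗ B` on an open subset of `A_σ` given by an element of
`k[M ∩ σ^∨] ⊗ B`. -/
noncomputable def Fan.chartMap (σ : F.cones) {V : (F.variety k).Opens}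
    (h : V ≤ F.chartOpen k σ) : CoordRing k σ.1 ⊗[k] B →ₐ[k] Γ(F.variety k, V) ⊗[k] B :=
  Algebra.TensorProduct.map (F.chartHom k σ h) (AlgHom.id k B)

variable {B}

lemma Fan.chartMap_tmul (σ : F.cones) {V : (F.variety k).Opens} (h : V ≤ F.chartOpen k σ)
    (a : CoordRing k σ.1) (b : B) :
    F.chartMap k B σ h (a ⊗ₜ b) = F.chartHom k σ h a ⊗ₜ b := rfl

lemma Fan.chartMap_smul (σ : F.cones) {V : (F.variety k).Opens} (h : V ≤ F.chartOpen k σ)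
    (a : CoordRing k σ.1) (t : CoordRing k σ.1 ⊗[k] B) :
    F.chartMap k B σ h (a • t) = F.chartHom k σ h a • F.chartMap k B σ h t :=
  tensorMap_smul _ _ _

lemma Fan.tensorRes_chartMap (σ : F.cones) {U V : (F.variety k).Opens} (h : V ≤ U)
    (hU : U ≤ F.chartOpen k σ) (t : CoordRing k σ.1 ⊗[k] B) :
    tensorRes B h (F.chartMap k B σ hU t) = F.chartMap k B σ (h.trans hU) t := by
  induction t using TensorProduct.induction_on with
  | zero => rw [map_zero, map_zero, map_zero]
  | add x y hx hy => rw [map_add, map_add, map_add, hx, hy]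
  | tmul a b =>
    rw [F.chartMap_tmul k, F.chartMap_tmul k, tensorRes_tmul, F.resHom_chartHom k]

lemma Fan.chartMap_coordMap {τ σ : F.cones} (h : τ ≤ σ) {V : (F.variety k).Opens}
    (hV : V ≤ F.chartOpen k τ) (t : CoordRing k σ.1 ⊗[k] B) :
    F.chartMap k B τ hV (Algebra.TensorProduct.map (coordMap k h) (AlgHom.id k B) t) =
      F.chartMap k B σ (hV.trans (F.chartOpen_mono k h)) t := by
  induction t using TensorProduct.induction_on with
  | zero => rw [map_zero, map_zero, map_zero]
  | add x y hx hy => rw [map_add, map_add, map_add, hx, hy]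
  | tmul a b =>
    rw [Algebra.TensorProduct.map_tmul, F.chartMap_tmul k, F.chartMap_tmul k,
      F.chartHom_coordMap k]
    rfl

lemma Fan.chartMap_eq_zero [Module.Finite k B] (σ : F.cones) {f : CoordRing k σ.1}
    {V : (F.variety k).Opens} (hV : V = F.chartBasic k σ f) (h : V ≤ F.chartOpen k σ)
    {t : CoordRing k σ.1 ⊗[k] B} (ht : F.chartMap k B σ h t = 0) : ∃ n : ℕ, f ^ n • t = 0 := by
  subst hV
  exact smul_eq_zero_of_tensorMap_eq_zero _ (fun a ha => F.chartHom_eq_zero k σ ha) ht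

lemma Fan.exists_chartMap_eq (σ : F.cones) (f : CoordRing k σ.1)
    {V : (F.variety k).Opens} (hV : V = F.chartBasic k σ f) (h : V ≤ F.chartOpen k σ)
    (s : Γ(F.variety k, V) ⊗[k] B) : ∃ (n : ℕ) (t : CoordRing k σ.1 ⊗[k] B),
      F.chartMap k B σ h t = F.chartHom k σ h f ^ n • s := by
  subst hV
  exact exists_tensorMap_eq _ (F.exists_chartHom_eq k σ f) s

/-- The chart of the face `σ ∩ m^⊥` is the locus in `A_σ` where `χ^m` does not vanish. -/
lemma Fan.chartι_mem_chartOpen {τ σ : F.cones} (h : τ ≤ σ) (m : dualMonoid σ.1)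
    (hm : ∀ x, x ∈ τ.1 ↔ x ∈ σ.1 ∧ pair m.1 x = 0) (y : PrimeSpectrum (CoordRing k σ.1)) :
    (F.chartι k σ) y ∈ F.chartOpen k τ ↔ chi k m ∉ y.asIdeal := by
  have hr := range_coordMap k (F.rational _ σ.2) h m hm
  constructor
  · rintro ⟨z, -, hz⟩
    have h1 : F.chartι k σ (Spec.map (CommRingCat.ofHom (coordMap k h).toRingHom) z) =
      F.chartι k σ y := (F.chartι_coordMap_apply k h z).trans hz
    have h2 := (F.chartι k σ).isOpenEmbedding.injective h1
    exact hr.le ⟨z, h2⟩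
  · intro hy
    obtain ⟨z, hz⟩ := hr.ge (show y ∈ PrimeSpectrum.basicOpen (chi k m) from hy)
    refine ⟨z, trivial, ?_⟩
    refine (F.chartι_coordMap_apply k h z).symm.trans ?_
    exact congrArg (F.chartι k σ) hz

end ChartMap

/-! ### Generic points of the boundary divisors -/

section GenericPoint

variable (k : Type u) [Field k] {N : Type u} [AddCommGroup N] (F : Fan N)

/-- The group `M` embeds in a product of copies of `ℤ`, hence has unique sums. As a consequence the
kernel of `rayHom` is prime. -/
instance : IsDomain (AddMonoidAlgebra k (Dual ℤ N)) := by
  have : TwoUniqueSums (Dual ℤ N) := TwoUniqueSums.of_injective_addHom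
    (⟨fun u v => u v, fun _ _ => rfl⟩ : Dual ℤ N →ₙ+ (N → ℤ)) DFunLike.coe_injective inferInstance
  have : NoZeroDivisors (AddMonoidAlgebra k (Dual ℤ N)) := inferInstance
  exact NoZeroDivisors.to_isDomain _

/-- The generic point of the closed subset of `A_σ` defined by the vanishing of all `χ^u` with
`u(v) ≠ 0`. -/
noncomputable def rayPoint {σ : Cone N} (v : N) (hv : pt v ∈ σ) :
    PrimeSpectrum (CoordRing k σ) :=
  ⟨RingHom.ker (rayHom k v hv), RingHom.ker_isPrime _⟩

lemma mem_rayPoint {σ : Cone N} (v : N) (hv : pt v ∈ σ) (a : CoordRing k σ) :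
    a ∈ (rayPoint k v hv).asIdeal ↔ rayHom k v hv a = 0 := Iff.rfl

lemma Fan.chartι_rayPoint {τ σ : F.cones} (h : τ ≤ σ) (v : N) (hv : pt v ∈ τ.1) :
    F.chartι k σ (rayPoint k v (h hv)) = F.chartι k τ (rayPoint k v hv) := by
  refine Eq.trans ?_ (F.chartι_coordMap_apply k h (rayPoint k v hv))
  refine congrArg (F.chartι k σ) (PrimeSpectrum.ext (Ideal.ext fun a => ?_))
  refine (mem_rayPoint k v (h hv) a).trans ?_
  rw [← rayHom_coordMap k h v hv]
  rfl

/-- If the point lies in `A_σ'`, the character cutting out `σ ∩ σ'` in `σ` does not vanish at it. By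
definition of the point this character is then orthogonal to `v`. -/
lemma Fan.pt_mem_of_rayPoint_mem {σ σ' : F.cones} (v : N) (hv : pt v ∈ σ.1)
    (h : F.chartι k σ (rayPoint k v hv) ∈ F.chartOpen k σ') : pt v ∈ σ'.1 := by
  have h1 := F.chartOpen_inf_le k σ σ' ⟨⟨_, trivial, rfl⟩, h⟩
  obtain ⟨m, hm, hmτ⟩ := (F.inter σ.1 σ.2 σ'.1 σ'.2).1
  have h2 := (F.chartι_mem_chartOpen k (τ := ⟨σ.1 ⊓ σ'.1, F.inf_mem σ.2 σ'.2⟩) (σ := σ)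
    (show σ.1 ⊓ σ'.1 ≤ σ.1 from inf_le_left) ⟨m, hm⟩ hmτ _).1 h1
  classical
  rw [mem_rayPoint, rayHom_chi] at h2
  have h3 : m v = 0 := by
    by_contra h0
    exact h2 (if_neg h0)
  exact ((hmτ (pt v)).2 ⟨hv, by rw [pair_pt, h3, Int.cast_zero]⟩).2

end GenericPoint

/-! ### Charts of the orbit closures -/

section StarCharts

variable (k : Type u) [Field k] {N : Type u} [AddCommGroup N] (F : Fan N) (τ : Cone N)
  (hτ : τ ∈ F.cones)

/-- The cone `[σ]_τ` as a member of `Σ_τ`. -/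
noncomputable def Fan.starPt (σ : F.cones) (h : τ ≤ σ.1) : (F.star τ hτ).cones :=
  ⟨starCone τ σ.1, σ.1, σ.2, h, rfl⟩

/-- The map `ι_τ^*` on the coordinate ring of `A_σ`. -/
noncomputable def Fan.starRing (σ : F.cones) (h : τ ≤ σ.1) :
    CoordRing k σ.1 →ₐ[k] CoordRing k (F.starPt τ hτ σ h).1 := starHom k h rfl

lemma Fan.starRing_of_mem (σ : F.cones) (h : τ ≤ σ.1) (u : dualMonoid σ.1)
    (hu : ∀ x ∈ τ, pair u.1 x = 0) : F.starRing k τ hτ σ h (chi k u) =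
      chi k (σ := (F.starPt τ hτ σ h).1) ⟨descend u.1 hu, descend_mem rfl u hu⟩ :=
  starHom_of_mem k h rfl u hu

lemma Fan.starRing_of_notMem (σ : F.cones) (h : τ ≤ σ.1) (u : dualMonoid σ.1)
    (hu : ¬ ∀ x ∈ τ, pair u.1 x = 0) : F.starRing k τ hτ σ h (chi k u) = 0 :=
  starHom_of_notMem k h rfl u hu

/-- A cone of the fan containing `τ` is determined by its image in `N_τ`, so the chosen lift is the
given cone. -/
lemma Fan.starLift_starPt (σ : F.cones) (h : τ ≤ σ.1) :
    F.starLift τ hτ (F.starPt τ hτ σ h) = σ := by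
  have h1 := F.starLift_eq τ hτ (F.starPt τ hτ σ h)
  have h2 := F.le_starLift τ hτ (F.starPt τ hτ σ h)
  exact Subtype.ext (le_antisymm (F.le_of_starCone_le hτ (Subtype.prop _) σ.2 h2 h h1.ge)
    (F.le_of_starCone_le hτ σ.2 (Subtype.prop _) h h2 h1.le))

lemma Fan.starPt_starLift (σ' : (F.star τ hτ).cones) :
    F.starPt τ hτ (F.starLift τ hτ σ') (F.le_starLift τ hτ σ') = σ' :=
  Subtype.ext (F.starLift_eq τ hτ σ').symm

lemma Fan.chartι_starPt (σ : F.cones) (h : τ ≤ σ.1) :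
    (F.star τ hτ).chartι k (F.starPt τ hτ σ h) ≫ F.starι k τ hτ =
      Spec.map (CommRingCat.ofHom (F.starRing k τ hτ σ h).toRingHom) ≫ F.chartι k σ := by
  rw [F.chartι_starι k τ hτ]
  -- The maps depend on the chosen lift; stating the equality for every cone equal to `σ` allows the
  -- lift to be replaced by substitution.
  have key : ∀ (σ₁ : F.cones) (h₁ : τ ≤ σ₁.1) (e₁ : (F.starPt τ hτ σ h).1 = starCone τ σ₁.1)
      (_ : σ₁ = σ), Spec.map (CommRingCat.ofHom (starHom k h₁ e₁).toRingHom) ≫ F.chartι k σ₁ =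
      Spec.map (CommRingCat.ofHom (F.starRing k τ hτ σ h).toRingHom) ≫ F.chartι k σ := by
    rintro _ _ _ rfl
    rfl
  exact key _ _ _ (F.starLift_starPt τ hτ σ h)

lemma Fan.starι_chartι_apply (σ : F.cones) (h : τ ≤ σ.1)
    (y : Spec (.of (CoordRing k (F.starPt τ hτ σ h).1))) :
    F.starι k τ hτ ((F.star τ hτ).chartι k (F.starPt τ hτ σ h) y) =
      F.chartι k σ (Spec.map (CommRingCat.ofHom (F.starRing k τ hτ σ h).toRingHom) y) := by
  rw [← Scheme.Hom.comp_apply, F.chartι_starPt k τ hτ, Scheme.Hom.comp_apply]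

/-- Let the point lie in the chart of `[σ₁]_τ`. Its image lies in the chart of `σ₁ ∩ σ`, where the
character `χ^m` cutting out this face is nonzero. As `ι_τ^*` kills the characters outside `τ^⊥`, it
follows that `m ∈ τ^⊥`, so `τ ⊂ σ`, and the descended character cuts out a smaller chart containing
the point. -/
lemma Fan.mem_chartOpen_of_starι_mem (σ : F.cones) {x : (F.star τ hτ).variety k}
    (hx : F.starι k τ hτ x ∈ F.chartOpen k σ) :
    ∃ h : τ ≤ σ.1, x ∈ (F.star τ hτ).chartOpen k (F.starPt τ hτ σ h) := by
  obtain ⟨σ', y, -, rfl⟩ := (F.star τ hτ).exists_mem_chartOpen k x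
  obtain ⟨σ₁, h₁, rfl⟩ : ∃ σ₁, ∃ h₁, F.starPt τ hτ σ₁ h₁ = σ' :=
    ⟨_, _, F.starPt_starLift τ hτ σ'⟩
  have e := F.starι_chartι_apply k τ hτ σ₁ h₁ y
  let z : PrimeSpectrum (CoordRing k σ₁.1) := Spec.map (CommRingCat.ofHom (F.starRing k τ hτ σ₁ h₁).toRingHom) y
  have hz : F.chartι k σ₁ z ∈ F.chartOpen k σ := e ▸ hx
  have h0 := F.chartOpen_inf_le k σ₁ σ ⟨⟨z, trivial, rfl⟩, hz⟩
  obtain ⟨m, hm, hmτ⟩ := (F.inter σ₁.1 σ₁.2 σ.1 σ.2).1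
  let σ₀ : F.cones := ⟨σ₁.1 ⊓ σ.1, F.inf_mem σ₁.2 σ.2⟩
  have hσ₀ : σ₀.1 ≤ σ₁.1 := inf_le_left
  have h2 := (F.chartι_mem_chartOpen k (τ := σ₀) (σ := σ₁) hσ₀ ⟨m, hm⟩ hmτ z).1 h0
  let y' : PrimeSpectrum (CoordRing k (F.starPt τ hτ σ₁ h₁).1) := y
  have h3 : F.starRing k τ hτ σ₁ h₁ (chi k ⟨m, hm⟩) ∉ y'.asIdeal := h2
  have hmz : ∀ x ∈ τ, pair m x = 0 := by
    by_contra hne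
    rw [F.starRing_of_notMem k τ hτ σ₁ h₁ ⟨m, hm⟩ hne] at h3
    exact h3 (Ideal.zero_mem _)
  rw [F.starRing_of_mem k τ hτ σ₁ h₁ ⟨m, hm⟩ hmz] at h3
  have hτ₀ : τ ≤ σ₀.1 := fun x hx => (hmτ x).2 ⟨h₁ hx, hmz x hx⟩
  have hτσ : τ ≤ σ.1 := hτ₀.trans inf_le_right
  refine ⟨hτσ, (F.star τ hτ).chartOpen_mono k (τ := F.starPt τ hτ σ₀ hτ₀)
    (starCone_mono τ inf_le_right) ?_⟩
  refine ((F.star τ hτ).chartι_mem_chartOpen k (τ := F.starPt τ hτ σ₀ hτ₀)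
    (σ := F.starPt τ hτ σ₁ h₁) (starCone_mono τ hσ₀) ⟨descend m hmz, _⟩ ?_ y).2 h3
  intro w
  constructor
  · rintro ⟨x, hx, rfl⟩
    exact ⟨⟨x, hσ₀ hx, rfl⟩, (pair_descend m hmz x).trans ((hmτ x).1 hx).2⟩
  · rintro ⟨⟨x, hx, rfl⟩, hw⟩
    exact ⟨x, (hmτ x).2 ⟨hx, (pair_descend m hmz x).symm.trans hw⟩, rfl⟩

lemma Fan.starι_preimage_le (σ : F.cones) (h : τ ≤ σ.1) {V : (F.variety k).Opens}
    (hV : V ≤ F.chartOpen k σ) :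
    F.starι k τ hτ ⁻¹ᵁ V ≤ (F.star τ hτ).chartOpen k (F.starPt τ hτ σ h) := fun _ hx =>
  (F.mem_chartOpen_of_starι_mem k τ hτ σ (hV hx)).2

lemma Fan.starι_preimage_eq_bot (σ : F.cones) (h : ¬ τ ≤ σ.1) {V : (F.variety k).Opens}
    (hV : V ≤ F.chartOpen k σ) : F.starι k τ hτ ⁻¹ᵁ V = ⊥ :=
  eq_bot_iff.2 fun _ hx => (h (F.mem_chartOpen_of_starι_mem k τ hτ σ (hV hx)).1).elim

lemma Fan.starι_preimage_chartBasic (σ : F.cones) (h : τ ≤ σ.1) (f : CoordRing k σ.1) :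
    F.starι k τ hτ ⁻¹ᵁ F.chartBasic k σ f =
      (F.star τ hτ).chartBasic k (F.starPt τ hτ σ h) (F.starRing k τ hτ σ h f) := by
  ext x
  have key : ∀ y, (F.star τ hτ).chartι k (F.starPt τ hτ σ h) y ∈
      F.starι k τ hτ ⁻¹ᵁ F.chartBasic k σ f ↔ (F.star τ hτ).chartι k (F.starPt τ hτ σ h) y ∈
      (F.star τ hτ).chartBasic k (F.starPt τ hτ σ h) (F.starRing k τ hτ σ h f) := by
    intro y
    refine Iff.trans ?_ ((F.star τ hτ).chartι_mem_chartBasic k (F.starPt τ hτ σ h) _ y).symm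
    have e := F.starι_chartι_apply k τ hτ σ h y
    change F.starι k τ hτ _ ∈ F.chartBasic k σ f ↔ _
    rw [e]
    exact F.chartι_mem_chartBasic k σ f _
  constructor
  · intro hx
    obtain ⟨y, -, rfl⟩ := F.starι_preimage_le k τ hτ σ h (F.chartBasic_le k σ f) hx
    exact (key y).1 hx
  · intro hx
    obtain ⟨y, -, rfl⟩ := (F.star τ hτ).chartBasic_le k _ _ hx
    exact (key y).2 hx

lemma Fan.pullHom_chartHom (σ : F.cones) (h : τ ≤ σ.1) {V : (F.variety k).Opens}
    (hV : V ≤ F.chartOpen k σ) (a : CoordRing k σ.1) :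
    pullHom k (F.starι k τ hτ) V (F.chartHom k σ hV a) =
      (F.star τ hτ).chartHom k (F.starPt τ hτ σ h) (F.starι_preimage_le k τ hτ σ h hV)
        (F.starRing k τ hτ σ h a) := by
  refine (F.star τ hτ).chartι_app_injective k (F.starPt τ hτ σ h)
    (F.starι_preimage_le k τ hτ σ h hV) ?_
  rw [(F.star τ hτ).chartHom_appLE k (F.starPt τ hτ σ h)
    (F.starι_preimage_le k τ hτ σ h hV) (𝟙 _) _ (by simp)]
  have h1 := F.chartHom_appLE k σ hV (CommRingCat.ofHom (F.starRing k τ hτ σ h).toRingHom) _ (F.chartι_starPt k τ hτ σ h)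
    ((F.star τ hτ).chartι k (F.starPt τ hτ σ h) ⁻¹ᵁ (F.starι k τ hτ ⁻¹ᵁ V)) le_rfl a
  refine Eq.trans ?_ h1
  rw [← Scheme.Hom.appLE_comp_appLE ((F.star τ hτ).chartι k (F.starPt τ hτ σ h))
    (F.starι k τ hτ) V (F.starι k τ hτ ⁻¹ᵁ V) _ le_rfl le_rfl, Scheme.Hom.appLE_eq_app,
    Scheme.Hom.appLE_eq_app]
  rfl

end StarCharts

end Toric

/-! ### Zariski forms on principal open subsets of charts -/

namespace Toric

open ExteriorAlgebra

section Generic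

variable {k : Type*} [Field k] {A R R' B : Type*} [CommRing A] [Algebra k A] [CommRing R]
  [Algebra k R] [CommRing R'] [Algebra k R'] [Ring B] [Algebra k B]

/-- The property of coming from `K` after multiplication by a power of `f` passes from generators to
their span, because the denominators of the coefficients can be cleared as well. -/
lemma exists_tensorMap_eq_of_mem_span (φ : A →ₐ[k] R) {f : A}
    (h : ∀ s, ∃ (n : ℕ) (a : A), φ a = φ f ^ n * s) (ψ : R' →ₐ[k] R) {S : Set (R' ⊗[k] B)}
    (K : Submodule A (A ⊗[k] B))
    (hS : ∀ s ∈ S, ∃ (n : ℕ), ∃ t ∈ K, Algebra.TensorProduct.map φ (AlgHom.id k B) t =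
      φ f ^ n • Algebra.TensorProduct.map ψ (AlgHom.id k B) s)
    {s : R' ⊗[k] B} (hs : s ∈ Submodule.span R' S) :
    ∃ (n : ℕ), ∃ t ∈ K, Algebra.TensorProduct.map φ (AlgHom.id k B) t =
      φ f ^ n • Algebra.TensorProduct.map ψ (AlgHom.id k B) s := by
  induction hs using Submodule.span_induction with
  | mem s hs => exact hS s hs
  | zero => exact ⟨0, 0, K.zero_mem, by rw [map_zero, map_zero, smul_zero]⟩
  | add s s' _ _ hs hs' =>
    obtain ⟨n, t, ht, hts⟩ := hs
    obtain ⟨n', t', ht', hts'⟩ := hs'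
    refine ⟨n + n', f ^ n' • t + f ^ n • t', K.add_mem (K.smul_mem _ ht) (K.smul_mem _ ht'), ?_⟩
    rw [map_add, tensorMap_smul, tensorMap_smul, hts, hts', map_pow, map_pow, map_add, smul_add,
      smul_smul, smul_smul, ← pow_add, ← pow_add, add_comm n']
  | smul a s _ hs =>
    obtain ⟨n, t, ht, hts⟩ := hs
    obtain ⟨n', a', ha⟩ := h (ψ a)
    refine ⟨n' + n, a' • t, K.smul_mem _ ht, ?_⟩
    rw [tensorMap_smul, tensorMap_smul, ha, hts, smul_smul, smul_smul, pow_add, mul_right_comm]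

lemma eq_zero_of_smul_eq_zero {C : Type*} [AddCommGroup C] [Module k C] [IsDomain A] {a : A}
    (ha : a ≠ 0) {t : A ⊗[k] C} (h : a • t = 0) : t = 0 :=
  (smul_eq_zero.1 h).resolve_left ha

end Generic

/-- The elements of `k[M ∩ σ^∨] ⊗ ⋀ M_{π,k}` without residue along the divisor of `v`. -/
noncomputable def rayResKer {k : Type u} [Field k] {N N' : Type u} [AddCommGroup N]
    [AddCommGroup N'] (π : N →ₗ[ℤ] N') {σ : Cone N} (v : LinearMap.ker π) (hv : pt v.1 ∈ σ) :
    Submodule (CoordRing k σ) (CoordRing k σ ⊗[k] Wedge k π) where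
  carrier := {t | rayRes π v hv t = 0}
  add_mem' hs ht := (map_add _ _ _).trans (by rw [hs, ht, add_zero])
  zero_mem' := map_zero _
  smul_mem' a t ht := (rayRes_smul k v hv a t).trans (by rw [ht, smul_zero])

/-- The residue takes values in a torsion-free module over the domain `k[M]`, where the nonzero
restriction of `g` to the divisor can be cancelled. -/
lemma rayRes_eq_zero_of_smul {k : Type u} [Field k] {N N' : Type u} [AddCommGroup N]
    [AddCommGroup N'] {π : N →ₗ[ℤ] N'} {ρ σ : Cone N} (h : ρ ≤ σ) (v : LinearMap.ker π)
    (hv : pt v.1 ∈ ρ) {g : CoordRing k ρ} (hg : rayHom k v.1 hv g ≠ 0) {m n : ℕ}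
    {t : CoordRing k σ ⊗[k] Wedge k π} {t' : CoordRing k ρ ⊗[k] Wedge k π}
    (ht' : t' ∈ rayResKer π v hv)
    (hm : g ^ m • (t' - g ^ n • Algebra.TensorProduct.map (coordMap k h) (AlgHom.id k _) t) = 0) :
    rayRes π v (h hv) t = 0 := by
  have h2 := congrArg (rayRes π v hv) hm
  rw [rayRes_smul, map_sub, rayRes_smul, rayRes_coordMap, show rayRes π v hv t' = 0 from ht',
    map_zero, zero_sub, smul_neg, neg_eq_zero, map_pow, map_pow] at h2
  exact eq_zero_of_smul_eq_zero (pow_ne_zero _ hg)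
    (eq_zero_of_smul_eq_zero (pow_ne_zero _ hg) h2)

section TildeCharts

variable {k : Type u} [Field k] {N N' : Type u} [AddCommGroup N] [AddCommGroup N']
  [Module.Free ℤ N] [Module.Finite ℤ N] {F : Fan N} {π : N →ₗ[ℤ] N'}

omit [Module.Free ℤ N] [Module.Finite ℤ N] in
lemma Fan.mem_regLocus {x : F.variety k} :
    x ∈ F.regLocus k ↔ ∃ σ : F.cones, IsNonsingular σ.1 ∧ x ∈ F.chartOpen k σ := by
  simp only [Fan.regLocus, Opens.mem_iSup, exists_prop]

omit [Module.Free ℤ N] in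
lemma Fan.chartMap_mem_omegaLog (σ : F.cones) {V : (F.variety k).Opens}
    (h : V ≤ F.chartOpen k σ) {q : ℕ} {t : CoordRing k σ.1 ⊗[k] Wedge k π}
    (ht : t ∈ gradedPart fun _ => ⋀[k]^q (RelM k π)) :
    F.chartMap k (Wedge k π) σ h t ∈ (F.omegaLog k π q).sec V := by
  refine gradedPart_induction
    (P := fun t => F.chartMap k (Wedge k π) σ h t ∈ (F.omegaLog k π q).sec V) ?_ ?_ ?_ ht
  · rw [map_zero]; exact Submodule.zero_mem _
  · intro s t hs ht
    rw [map_add]; exact Submodule.add_mem _ hs ht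
  · intro u m hm
    rw [F.chartMap_tmul k]
    exact Submodule.tmul_mem_baseChange_of_mem _ hm

omit [Module.Free ℤ N] in
-- Near a point of the regular locus one may pass to the common face with a nonsingular cone. This
-- face is nonsingular, and `Fan.tildePart_le` applies to it.
lemma Fan.chartMap_mem_omegaTilde (σ : F.cones) {V : (F.variety k).Opens}
    (h : V ≤ F.chartOpen k σ) {q : ℕ} {t : CoordRing k σ.1 ⊗[k] Wedge k π}
    (ht : t ∈ F.tildePart k π σ.1 q) :
    F.chartMap k (Wedge k π) σ h t ∈ (F.omegaTilde k π q).sec V := by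
  refine ⟨F.chartMap_mem_omegaLog σ h (gradedPart_mono (fun u m hm => (mem_killed.1 hm).1) ht), ?_⟩
  rintro x ⟨hxV, hxr⟩
  obtain ⟨σ₁, hσ₁, hx⟩ := Fan.mem_regLocus.1 hxr
  let τ : F.cones := ⟨σ.1 ⊓ σ₁.1, F.inf_mem σ.2 σ₁.2⟩
  have hτσ : τ ≤ σ := inf_le_left (a := σ.1)
  refine ⟨(V ⊓ F.regLocus k) ⊓ F.chartOpen k τ, inf_le_left,
    ⟨⟨hxV, hxr⟩, F.chartOpen_inf_le k σ σ₁ ⟨h hxV, hx⟩⟩, Submodule.subset_span ?_⟩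
  have hns : IsNonsingular τ.1 := hσ₁.of_isFace (F.inter σ.1 σ.2 σ₁.1 σ₁.2).2
  refine ⟨τ, hns, inf_le_right, _, F.tildePart_le τ.2 hns (F.coordMap_mem_tildePart π hτσ ht), ?_⟩
  rw [F.tensorRes_chartMap k, F.tensorRes_chartMap k]
  exact (F.chartMap_coordMap k hτσ inf_le_right t).symm

omit [Module.Free ℤ N] [Module.Finite ℤ N] in
lemma Fan.exists_chartMap_eq_of_mem_span {B : Type u} [Ring B] [Algebra k B] (σ : F.cones)
    {g : CoordRing k σ.1} {U : (F.variety k).Opens} (hU : F.chartBasic k σ g ≤ U)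
    {S : Set (Γ(F.variety k, U) ⊗[k] B)}
    (K : Submodule (CoordRing k σ.1) (CoordRing k σ.1 ⊗[k] B))
    (hS : ∀ s ∈ S, ∃ (n : ℕ), ∃ t ∈ K, F.chartMap k B σ (F.chartBasic_le k σ g) t =
      F.chartHom k σ (F.chartBasic_le k σ g) g ^ n • tensorRes B hU s)
    {s : Γ(F.variety k, U) ⊗[k] B} (hs : s ∈ Submodule.span Γ(F.variety k, U) S) :
    ∃ (n : ℕ), ∃ t ∈ K, F.chartMap k B σ (F.chartBasic_le k σ g) t =
      F.chartHom k σ (F.chartBasic_le k σ g) g ^ n • tensorRes B hU s :=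
  exists_tensorMap_eq_of_mem_span _ (F.exists_chartHom_eq k σ g) (resHom k hU) K hS hs

/-- The restriction of `f` to the divisor of `v` is nonzero, so `D(f)` contains the generic point of
this divisor, which also lies in the regular chart of the ray. Near that point the form is a
combination of wedge products of regular one-forms, and these have no residue. -/
lemma Fan.rayRes_eq_zero (σ : F.cones) {f : CoordRing k σ.1} {V : (F.variety k).Opens}
    (hV : V = F.chartBasic k σ f) (h : V ≤ F.chartOpen k σ) {v : LinearMap.ker π}
    (hv : v.1 ∈ F.rayGens σ.1) (hvσ : pt v.1 ∈ σ.1) (hf : rayHom k v.1 hvσ f ≠ 0) {q : ℕ}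
    {t : CoordRing k σ.1 ⊗[k] Wedge k π}
    (ht : F.chartMap k (Wedge k π) σ h t ∈ (F.omegaTilde k π q).sec V) :
    rayRes π v hvσ t = 0 := by
  subst hV
  obtain ⟨ρ', hρ, h1, hle, hvρ⟩ := hv
  let ρ : F.cones := ⟨ρ', hρ⟩
  have hρσ : ρ ≤ σ := hle
  have hmem : pt v.1 ∈ ρ.1 := hvρ.mem
  have hξ : F.chartι k σ (rayPoint k v.1 hvσ) ∈ F.chartBasic k σ f :=
    (F.chartι_mem_chartBasic k σ f _).2 hf
  have hns : IsNonsingular ρ.1 := isNonsingular_of_isPrimitiveGenerator hvρ (F.rational _ hρ) h1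
  have hξρ : F.chartι k σ (rayPoint k v.1 hvσ) ∈ F.chartOpen k ρ := by
    rw [F.chartι_rayPoint k hρσ v.1 hmem]
    exact ⟨_, trivial, rfl⟩
  obtain ⟨V', hV', hξ', hspan⟩ := ht.2 _ ⟨hξ, Fan.mem_regLocus.2 ⟨ρ, hns, hξρ⟩⟩
  obtain ⟨g, hξg, hgV⟩ := F.exists_mem_chartBasic k ρ hξρ hξ'
  have hg : rayHom k v.1 hmem g ≠ 0 := by
    rw [F.chartι_rayPoint k hρσ v.1 hmem] at hξg
    exact (F.chartι_mem_chartBasic k ρ g _).1 hξg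
  rw [tensorRes_tensorRes] at hspan
  obtain ⟨n, t', ht', htt'⟩ := F.exists_chartMap_eq_of_mem_span ρ hgV (rayResKer π v hmem)
    (by
      rintro s ⟨σ₁, -, h₁, t₁, ht₁, rfl⟩
      -- A nonsingular chart which contributes near the generic point contains `v`, so its forms can
      -- be restricted to the chart of the ray.
      have hmem₁ : pt v.1 ∈ σ₁.1 := F.pt_mem_of_rayPoint_mem k v.1 hvσ (h₁ hξ')
      have hρ₁ : ρ ≤ σ₁ := by
        change ρ' ≤ σ₁.1
        rw [hvρ.eq_hull (F.rational _ hρ)]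
        refine Submodule.span_le.2 ?_
        rintro _ rfl
        exact hmem₁
      refine ⟨0, Algebra.TensorProduct.map (coordMap k hρ₁) (AlgHom.id k _) t₁, ?_, ?_⟩
      · refine Eq.trans (b := rayRes π v hmem₁ t₁) (rayRes_coordMap k hρ₁ v hmem t₁) ?_
        exact rayRes_eq_zero_of_mem_relOmegaOne_pow σ₁.2 ⟨ρ', hρ, h1, hρ₁, hvρ⟩ hmem₁ ht₁
      · rw [F.chartMap_coordMap k, pow_zero, one_smul]
        exact (F.tensorRes_chartMap k σ₁ hgV h₁ t₁).symm) hspan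
  rw [tensorRes_tensorRes, F.tensorRes_chartMap k,
    ← F.chartMap_coordMap k hρσ (F.chartBasic_le k ρ g), ← map_pow, ← F.chartMap_smul k] at htt'
  obtain ⟨m, hm⟩ := F.chartMap_eq_zero k ρ rfl (F.chartBasic_le k ρ g)
    (show F.chartMap k (Wedge k π) ρ (F.chartBasic_le k ρ g) (t' - g ^ n • Algebra.TensorProduct.map (coordMap k hρσ)
        (AlgHom.id k (Wedge k π)) t) = 0 by
      rw [map_sub, htt', sub_self])
  exact rayRes_eq_zero_of_smul hρσ v hmem hg ht' hm

lemma Fan.exists_mem_tildePart (σ : F.cones) (f : CoordRing k σ.1) {V : (F.variety k).Opens}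
    (hV : V = F.chartBasic k σ f) (h : V ≤ F.chartOpen k σ) {q : ℕ}
    {w : Γ(F.variety k, V) ⊗[k] Wedge k π} (hw : w ∈ (F.omegaTilde k π q).sec V) :
    ∃ n : ℕ, ∃ t ∈ F.tildePart k π σ.1 q,
      F.chartMap k (Wedge k π) σ h t = F.chartHom k σ h f ^ n • w := by
  obtain ⟨n, t₀, ht₀⟩ := F.exists_chartMap_eq k σ f hV h w
  obtain ⟨e, he, he'⟩ := SubSheaf.exists_proj (⋀[k]^q (RelM k π))
  -- The lift is projected to `⋀^q`, which leaves its image unchanged, since `w` is already of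
  -- degree `q`.
  let t := TensorProduct.map LinearMap.id e t₀
  have ht : F.chartMap k (Wedge k π) σ h t = F.chartHom k σ h f ^ n • w := by
    rw [← (SubSheaf.mem_baseChange_iff he he').1 hw.1, ← map_smul, ← ht₀]
    clear ht₀
    induction t₀ using TensorProduct.induction_on with
    | zero => simp [t]
    | add x y hx hy => simp only [t, map_add] at hx hy ⊢; rw [hx, hy]
    | tmul a b => rfl
  -- If `f` vanishes on the divisor of `v`, the section over `D(f)` says nothing about the residue
  -- there; the additional factor `f` removes it.
  refine ⟨n + 1, f • t, mem_gradedPart.2 fun u => mem_killed.2 ⟨?_, fun v hv => ?_⟩, ?_⟩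
  · have ht' : f • t ∈ gradedPart fun _ => ⋀[k]^q (RelM k π) := by
      refine smul_mem_gradedPart (L := fun _ => ⋀[k]^q (RelM k π)) (fun _ _ => le_rfl) f
        (mem_gradedPart.2 fun u => ?_)
      rw [gradedComp_map (u := u) e (fun a => rfl)]
      exact he _
    exact mem_gradedPart.1 ht' u
  · have hvσ := F.pt_mem_of_mem_rayGens hv.1
    rw [← gradedComp_rayRes k v hvσ u hv.2, rayRes_smul]
    by_cases hf : rayHom k v.1 hvσ f = 0
    · rw [hf, zero_smul, map_zero]
    · rw [F.rayRes_eq_zero σ hV h hv.1 hvσ hf (q := q)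
        (by rw [ht]; exact Submodule.smul_mem _ _ hw), smul_zero, map_zero]
  · rw [F.chartMap_smul k, ht, smul_smul, ← pow_succ']

end TildeCharts

end Toric

/-! ### The weight filtration on charts -/

namespace Toric

open ExteriorAlgebra

section GradedMul

variable {k : Type*} [Field k] {G : Type*} [AddCommMonoid G] {B : Type*} [Ring B] [Algebra k B]

lemma one_tmul_mul_mem_gradedPart {L L' : G → Submodule k B} {b : B}
    (h : ∀ u, ∀ m ∈ L u, b * m ∈ L' u) {t : AddMonoidAlgebra k G ⊗[k] B} (ht : t ∈ gradedPart L) :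
    (1 ⊗ₜ b) * t ∈ gradedPart L' := by
  refine gradedPart_induction (P := fun t => (1 ⊗ₜ b) * t ∈ gradedPart L') ?_ ?_ ?_ ht
  · rw [mul_zero]; exact Submodule.zero_mem _
  · intro s t hs ht
    rw [mul_add]; exact Submodule.add_mem _ hs ht
  · intro u m hm
    rw [Algebra.TensorProduct.tmul_mul_tmul, one_mul]
    exact single_tmul_mem_gradedPart (h u m hm)

end GradedMul

section WeightCharts

variable {k : Type u} [Field k] {N N' : Type u} [AddCommGroup N] [AddCommGroup N']
  {F : Fan N} {π : N →ₗ[ℤ] N'}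

variable (F k π) in
/-- `F.weightPart k π σ r q` as a module over the coordinate ring. -/
noncomputable def Fan.weightModule (σ : Cone N) (r q : ℕ) :
    Submodule (CoordRing k σ) (CoordRing k σ ⊗[k] Wedge k π) where
  carrier := F.weightPart k π σ r q
  add_mem' hs ht := Submodule.add_mem _ hs ht
  zero_mem' := Submodule.zero_mem _
  smul_mem' a _ ht := F.smul_mem_weightPart π a ht

variable [Module.Free ℤ N] [Module.Finite ℤ N]

omit [Module.Free ℤ N] in
lemma Fan.mul_mem_weight {V : (F.variety k).Opens} {p r q : ℕ} (hp : r + q = p)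
    {η w : Γ(F.variety k, V) ⊗[k] Wedge k π} (hη : η ∈ (F.omegaLog k π r).sec V)
    (hw : w ∈ (F.omegaTilde k π q).sec V) : η * w ∈ (F.weight k π p r).sec V :=
  fun _ hx => ⟨V, le_rfl, hx, by
    rw [tensorRes_self]
    exact Submodule.subset_span ⟨r, q, rfl, hp, η, hη, w, hw, rfl⟩⟩

omit [Module.Free ℤ N] in
lemma Fan.chartMap_mem_weight (σ : F.cones) {V : (F.variety k).Opens}
    (h : V ≤ F.chartOpen k σ) {p r q : ℕ} (hp : r + q = p) {t : CoordRing k σ.1 ⊗[k] Wedge k π}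
    (ht : t ∈ F.weightPart k π σ.1 r q) :
    F.chartMap k (Wedge k π) σ h t ∈ (F.weight k π p r).sec V := by
  refine gradedPart_induction
    (P := fun t => F.chartMap k (Wedge k π) σ h t ∈ (F.weight k π p r).sec V) ?_ ?_ ?_ ht
  · rw [map_zero]; exact Submodule.zero_mem _
  · intro s t hs ht
    rw [map_add]; exact Submodule.add_mem _ hs ht
  · intro u m hm
    induction hm using Submodule.mul_induction_on' with
    | mem_mul_mem η hη w hw =>
      have h1 := F.mul_mem_weight hp (η := (1 : Γ(F.variety k, V)) ⊗ₜ[k] η)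
        (Submodule.tmul_mem_baseChange_of_mem _ hη)
        (F.chartMap_mem_omegaTilde σ h (t := AddMonoidAlgebra.single u 1 ⊗ₜ w)
          (single_tmul_mem_gradedPart hw))
      rwa [F.chartMap_tmul k, Algebra.TensorProduct.tmul_mul_tmul, one_mul,
        ← F.chartMap_tmul k] at h1
    | add x _ y _ hx hy =>
      rw [TensorProduct.tmul_add, map_add]
      exact Submodule.add_mem _ hx hy

lemma Fan.exists_mem_weightPart (σ : F.cones) {U : (F.variety k).Opens} {x : F.variety k}
    (hxU : x ∈ U) (hx : x ∈ F.chartOpen k σ) {p r q : ℕ} (hp : r + q = p)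
    {s : Γ(F.variety k, U) ⊗[k] Wedge k π} (hs : s ∈ (F.weight k π p r).sec U) :
    ∃ (f : CoordRing k σ.1) (_ : x ∈ F.chartBasic k σ f) (hf : F.chartBasic k σ f ≤ U) (n : ℕ),
      ∃ t ∈ F.weightPart k π σ.1 r q, F.chartMap k (Wedge k π) σ (F.chartBasic_le k σ f) t =
        F.chartHom k σ (F.chartBasic_le k σ f) f ^ n • tensorRes (Wedge k π) hf s := by
  obtain ⟨V, hVU, hxV, hsV⟩ := hs x hxU
  obtain ⟨f, hxf, hfV⟩ := F.exists_mem_chartBasic k σ hx hxV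
  refine ⟨f, hxf, hfV.trans hVU, ?_⟩
  have := F.exists_chartMap_eq_of_mem_span σ hfV (F.weightModule k π σ.1 r q) ?_ hsV
  · rwa [tensorRes_tensorRes] at this
  rintro _ ⟨a, b, ha, hab, η, hη, w, hw, rfl⟩
  obtain rfl : a = r := by exact_mod_cast ha
  obtain rfl : b = q := by omega
  obtain ⟨n, t, ht, htw⟩ := F.exists_mem_tildePart σ f rfl (F.chartBasic_le k σ f)
    ((F.omegaTilde k π b).res_mem hfV hw)
  -- Coefficients of `η` are moved out of the product, so that only constant forms `1 ⊗ η₀` need be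
  -- multiplied with `w`.
  have hηw : η * w ∈ Submodule.span Γ(F.variety k, V)
      ((fun η₀ : Wedge k π => ((1 : Γ(F.variety k, V)) ⊗ₜ[k] η₀) * w) ''
        (⋀[k]^a (RelM k π) : Set (Wedge k π))) := by
    have hη' : η ∈ Submodule.baseChange Γ(F.variety k, V) (⋀[k]^a (RelM k π)) := hη
    rw [Submodule.baseChange_eq_span] at hη'
    clear hη
    induction hη' using Submodule.span_induction with
    | mem η hη =>
      obtain ⟨η₀, hη₀, rfl⟩ := hη
      exact Submodule.subset_span ⟨η₀, hη₀, rfl⟩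
    | zero => rw [zero_mul]; exact Submodule.zero_mem _
    | add s t _ _ hs ht => rw [add_mul]; exact Submodule.add_mem _ hs ht
    | smul c s _ hs => rw [smul_mul_assoc]; exact Submodule.smul_mem _ _ hs
  refine F.exists_chartMap_eq_of_mem_span σ hfV (F.weightModule k π σ.1 a b) ?_ hηw
  rintro _ ⟨η₀, hη₀, rfl⟩
  refine ⟨n, (1 ⊗ₜ η₀) * t, one_tmul_mul_mem_gradedPart
    (fun u m hm => Submodule.mul_mem_mul hη₀ hm) ht, ?_⟩
  rw [map_mul, map_mul, htw, F.chartMap_tmul k, map_one, mul_smul_comm, tensorRes_tmul, map_one]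

omit [Module.Free ℤ N] [Module.Finite ℤ N] in
lemma Fan.mem_of_pow_smul_mem {B : Type u} [Ring B] [Algebra k B] (σ : F.cones)
    {f : CoordRing k σ.1} {V : (F.variety k).Opens} (hV : V ≤ F.chartBasic k σ f)
    (K : Submodule Γ(F.variety k, V) (Γ(F.variety k, V) ⊗[k] B)) {n : ℕ}
    {s : Γ(F.variety k, V) ⊗[k] B}
    (h : F.chartHom k σ (hV.trans (F.chartBasic_le k σ f)) f ^ n • s ∈ K) : s ∈ K :=
  (Submodule.smul_mem_iff_of_isUnit K ((F.isUnit_chartHom k σ hV).pow n)).1 h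

/-! ### The next smaller part of the weight filtration -/

variable (F k π) in
/-- The sections over `A_σ` of the part of the weight filtration just below the one given by
`F.weightPart k π σ r q`. -/
noncomputable def Fan.weightBelowPart (σ : Cone N) (r q : ℕ) :
    Submodule k (CoordRing k σ ⊗[k] Wedge k π) :=
  gradedPart fun u => weightBelow (rayForm k π) (F.relRays π σ u.1) r q

omit [Module.Free ℤ N] in
lemma Fan.chartMap_mem_weight_pred (σ : F.cones) {V : (F.variety k).Opens}
    (h : V ≤ F.chartOpen k σ) {p r q : ℕ} (hp : r + q = p) {t : CoordRing k σ.1 ⊗[k] Wedge k π}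
    (ht : t ∈ F.weightBelowPart k π σ.1 r q) :
    F.chartMap k (Wedge k π) σ h t ∈ (F.weight k π p ((r : ℤ) - 1)).sec V := by
  cases r with
  | zero =>
    have h0 : t = 0 := ext_gradedComp fun u => by
      rw [(Submodule.mem_bot k).1 (mem_gradedPart.1 ht u), map_zero]
    rw [h0, map_zero]
    exact Submodule.zero_mem _
  | succ r =>
    -- When `r` drops by one, the degree of the Zariski factor rises to `q + 1`, the total degree
    -- being fixed.
    have := F.chartMap_mem_weight σ h (p := p) (r := r) (q := q + 1) (by omega) ht
    push_cast
    rwa [add_sub_cancel_right]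

omit [Module.Free ℤ N] in
lemma Fan.weight_neg_eq_zero {p : ℕ} {r : ℤ} (hr : r < 0) {U : (F.variety k).Opens}
    {s : Γ(F.variety k, U) ⊗[k] Wedge k π} (hs : s ∈ (F.weight k π p r).sec U) : s = 0 := by
  refine tensorRes_ext fun x hx => ?_
  obtain ⟨V, hVU, hxV, hsV⟩ := hs x hx
  refine ⟨V, hVU, hxV, ?_⟩
  rw [map_zero, ← Submodule.mem_bot Γ(F.variety k, V), ← Submodule.span_empty]
  refine Submodule.span_mono ?_ hsV
  rintro _ ⟨a, b, ha, -⟩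
  omega

lemma Fan.exists_mem_weightBelowPart (σ : F.cones) {U : (F.variety k).Opens} {x : F.variety k}
    (hxU : x ∈ U) (hx : x ∈ F.chartOpen k σ) {p r q : ℕ} (hp : r + q = p)
    {s : Γ(F.variety k, U) ⊗[k] Wedge k π} (hs : s ∈ (F.weight k π p ((r : ℤ) - 1)).sec U) :
    ∃ (f : CoordRing k σ.1) (_ : x ∈ F.chartBasic k σ f) (hf : F.chartBasic k σ f ≤ U) (n : ℕ),
      ∃ t ∈ F.weightBelowPart k π σ.1 r q,
        F.chartMap k (Wedge k π) σ (F.chartBasic_le k σ f) t =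
          F.chartHom k σ (F.chartBasic_le k σ f) f ^ n • tensorRes (Wedge k π) hf s := by
  cases r with
  | zero =>
    obtain ⟨f, hxf, hfU⟩ := F.exists_mem_chartBasic k σ hx hxU
    refine ⟨f, hxf, hfU, 0, 0, Submodule.zero_mem _, ?_⟩
    rw [F.weight_neg_eq_zero (by simp) hs, map_zero, map_zero, smul_zero]
  | succ r =>
    push_cast at hs
    rw [add_sub_cancel_right] at hs
    exact F.exists_mem_weightPart σ hxU hx (q := q + 1) (by omega) hs

/-- The integral functionals of `Fan.exists_dual` are divided by `mult σ`, which is invertible in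
`k` by the assumption on `m(Σ)`. -/
lemma Fan.exists_dual_relClass (hF : F.IsSimplicial) (hm : (F.totalMult : k) ≠ 0) {σ : Cone N}
    (hσ : σ ∈ F.cones) (π : N →ₗ[ℤ] N') [DecidableEq (LinearMap.ker π)] :
    ∃ e : LinearMap.ker π → RelM k π,
      ∀ v w : LinearMap.ker π, v.1 ∈ F.rayGens σ → w.1 ∈ F.rayGens σ →
        rayForm k π v (e w) = if v = w then 1 else 0 := by
  classical
  have h0 := F.mult_ne_zero hm hσ
  have h1 : F.mult σ ≠ 0 := fun h => h0 (by rw [h, Nat.cast_zero])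
  obtain ⟨e, he⟩ := F.exists_dual hF hσ h1
  refine ⟨fun w => (F.mult σ : k)⁻¹ • relClass k π (e w.1), fun v w hv hw => ?_⟩
  rw [map_smul, rayForm_relClass, he _ hw _ hv]
  by_cases h : v = w
  · rw [if_pos (congrArg Subtype.val h.symm), if_pos h]
    simp [h0]
  · rw [if_neg fun h' => h (Subtype.ext h'.symm), if_neg h]
    simp

omit [Module.Finite ℤ N] in
lemma Fan.finite_relRays (hF : F.IsSimplicial) (hm : (F.totalMult : k) ≠ 0) {σ : Cone N}
    (hσ : σ ∈ F.cones) (π : N →ₗ[ℤ] N') (u : Dual ℤ N) : (F.relRays π σ u).Finite := by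
  have h0 := F.mult_ne_zero hm hσ
  have h1 : F.mult σ ≠ 0 := fun h => h0 (by rw [h, Nat.cast_zero])
  refine Set.Finite.of_finite_image (f := Subtype.val) ((F.rayGens_spec hF hσ h1).1.subset ?_)
    Subtype.val_injective.injOn
  rintro _ ⟨v, hv, rfl⟩
  exact hv.1

lemma Fan.weightBelowPart_le (hF : F.IsSimplicial) (hm : (F.totalMult : k) ≠ 0) {σ : Cone N}
    (hσ : σ ∈ F.cones) (π : N →ₗ[ℤ] N') (r q : ℕ) :
    F.weightBelowPart k π σ r q ≤ F.weightPart k π σ r q := by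
  classical
  refine gradedPart_mono fun u => ?_
  cases r with
  | zero => exact bot_le
  | succ r =>
    obtain ⟨e, he⟩ := F.exists_dual_relClass hF hm hσ π
    have hfin := F.finite_relRays hF hm hσ π u.1
    rw [← hfin.coe_toFinset]
    exact pow_mul_killed_succ_le (e := e)
      (fun v hv w hw => he v w (hfin.mem_toFinset.1 hv).1 (hfin.mem_toFinset.1 hw).1) r q

lemma Fan.weight_pred_le (hF : F.IsSimplicial) (hm : (F.totalMult : k) ≠ 0) (π : N →ₗ[ℤ] N')
    {p r : ℕ} (hr : r ≤ p) (U : (F.variety k).Opens) :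
    (F.weight k π p ((r : ℤ) - 1)).sec U ≤ (F.weight k π p r).sec U := by
  intro s hs
  refine (F.weight k π p r).local_mem fun x hx => ?_
  obtain ⟨σ, hσ⟩ := F.exists_mem_chartOpen k x
  obtain ⟨f, hxf, hf, n, t, ht, hts⟩ := F.exists_mem_weightBelowPart σ hx hσ
    (Nat.add_sub_of_le hr) hs
  refine ⟨_, hf, hxf, F.mem_of_pow_smul_mem σ le_rfl _ (n := n) ?_⟩
  rw [← hts]
  exact F.chartMap_mem_weight σ _ (Nat.add_sub_of_le hr) (F.weightBelowPart_le hF hm σ.2 π _ _ ht)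

end WeightCharts

end Toric

/-! ### Functoriality of contractions -/

namespace ExteriorAlgebra

variable {k V W : Type*} [Field k] [AddCommGroup V] [Module k V] [AddCommGroup W] [Module k W]

lemma contractLeft_map (d : Dual k W) (φ : V →ₗ[k] W) (m : ExteriorAlgebra k V) :
    CliffordAlgebra.contractLeft (Q := (0 : QuadraticForm k W)) d (map φ m) =
      map φ (CliffordAlgebra.contractLeft (Q := (0 : QuadraticForm k V)) (d ∘ₗ φ) m) := by
  induction m using CliffordAlgebra.left_induction with
  | algebraMap r =>
    rw [CliffordAlgebra.contractLeft_algebraMap, map_zero]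
    exact (congrArg _ ((map φ).commutes r)).trans (CliffordAlgebra.contractLeft_algebraMap _ d r)
  | add x y hx hy => rw [map_add, map_add, map_add, map_add, hx, hy]
  | ι_mul x m hx =>
    have h1 : map φ (CliffordAlgebra.ι 0 m * x) = ι k (φ m) * map φ x := by
      rw [map_mul]
      exact congrArg (· * map φ x) (map_apply_ι φ m)
    rw [h1, contractLeft_ι_mul', hx]
    refine Eq.trans ?_ (congrArg (map φ) (contractLeft_ι_mul' (d ∘ₗ φ) m x)).symm
    rw [map_sub, map_smul, map_mul, map_apply_ι]
    rfl

lemma map_mem_exteriorPower (φ : V →ₗ[k] W) {q : ℕ} {m : ExteriorAlgebra k V}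
    (hm : m ∈ ⋀[k]^q V) : map φ m ∈ ⋀[k]^q W := by
  have h : (LinearMap.range (ι k : V →ₗ[k] _)).map (map φ).toLinearMap ≤
      LinearMap.range (ι k : W →ₗ[k] _) := by
    rintro _ ⟨_, ⟨x, rfl⟩, rfl⟩
    exact ⟨φ x, (map_apply_ι φ x).symm⟩
  have h1 := Submodule.mem_map_of_mem (f := (map φ).toLinearMap) hm
  rw [exteriorPower, Submodule.map_pow] at h1
  exact pow_le_pow_left' (M := Submodule k (ExteriorAlgebra k W)) h q h1

lemma iterContract_mem_killed {I : Type*} {ℓ : I → Dual k V} {A : Set I} {r q : ℕ} {f : Fin r → I}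
    (hf : ∀ i, f i ∈ A) {x : ExteriorAlgebra k V} (hx : x ∈ ⋀[k]^r V * killed ℓ A q) :
    iterContract (ℓ ∘ f) x ∈ killed ℓ A q := by
  induction hx using Submodule.mul_induction_on' with
  | mem_mul_mem η hη m hm =>
    have h := iterContract_mul (ℓ ∘ f) ⟨η, hη⟩ fun i => (mem_killed.1 hm).2 _ (hf i)
    exact h ▸ Submodule.smul_mem _ _ hm
  | add x _ y _ hx hy => rw [map_add]; exact Submodule.add_mem _ hx hy

end ExteriorAlgebra

/-! ### The relative cotangent space of an orbit closure -/

namespace Toric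

open ExteriorAlgebra

section RelIncl

variable {k : Type u} [Field k] {N N' : Type u} [AddCommGroup N] [AddCommGroup N']
  [Module.Free ℤ N] [Module.Finite ℤ N] [Module.Free ℤ N']
  (F : Fan N) (π : N →ₗ[ℤ] N') {r : ℕ} (τ : F.relCones π r)

omit [Module.Free ℤ N] [Module.Finite ℤ N] in
lemma Fan.starMap_mkQ (v : N) : F.starMap π τ ((lat τ.1).mkQ v) = π v := rfl

omit [Module.Free ℤ N] [Module.Finite ℤ N] in
lemma Fan.relIncl_relClass (u : Dual ℤ (QuotLattice τ.1)) :
    F.relIncl k π τ (relClass k (F.starMap π τ) u) = relClass k π (u ∘ₗ (lat τ.1).mkQ) := by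
  change Submodule.mapQ _ _ _ _ (Submodule.Quotient.mk _) = _
  rw [Submodule.mapQ_apply]
  rfl

omit [Module.Free ℤ N] [Module.Finite ℤ N] [Module.Free ℤ N'] in
lemma relM_induction {P : RelM k π → Prop} (h0 : P 0) (hadd : ∀ x y, P x → P y → P (x + y))
    (hsmul : ∀ (c : k) u, P (c • relClass k π u)) (x : RelM k π) : P x := by
  obtain ⟨y, rfl⟩ := Submodule.Quotient.mk_surjective _ x
  induction y using TensorProduct.induction_on with
  | zero => exact h0
  | add y z hy hz => exact hadd _ _ hy hz
  | tmul c u =>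
    have : (Submodule.Quotient.mk (c ⊗ₜ u) : RelM k π) = c • relClass k π u := by
      rw [relClass, ← Submodule.Quotient.mk_smul, TensorProduct.smul_tmul', smul_eq_mul, mul_one]
    rw [this]
    exact hsmul c u

omit [Module.Free ℤ N] [Module.Finite ℤ N] [Module.Free ℤ N'] in
/-- The map of relative cotangent spaces defined by a map of lattices over `N'`. -/
noncomputable def relMap {N₁ N₂ : Type u} [AddCommGroup N₁] [AddCommGroup N₂] (k : Type u) [Field k]
    {π₁ : N₁ →ₗ[ℤ] N'} {π₂ : N₂ →ₗ[ℤ] N'} (s : N₂ →ₗ[ℤ] N₁) (hs : π₁ ∘ₗ s = π₂) :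
    RelM k π₁ →ₗ[k] RelM k π₂ :=
  Submodule.mapQ _ _ (LinearMap.baseChange k s.dualMap) (by
    rintro _ ⟨y, rfl⟩
    refine ⟨y, ?_⟩
    subst hs
    induction y using TensorProduct.induction_on with
    | zero => simp
    | tmul c u => rfl
    | add a b ha hb => rw [map_add, map_add, map_add, ha, hb])

omit [Module.Free ℤ N] [Module.Finite ℤ N] [Module.Free ℤ N'] in
lemma relMap_relClass {N₁ N₂ : Type u} [AddCommGroup N₁] [AddCommGroup N₂]
    {π₁ : N₁ →ₗ[ℤ] N'} {π₂ : N₂ →ₗ[ℤ] N'} (s : N₂ →ₗ[ℤ] N₁) (hs : π₁ ∘ₗ s = π₂)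
    (u : Dual ℤ N₁) : relMap k s hs (relClass k π₁ u) = relClass k π₂ (u ∘ₗ s) := by
  change Submodule.mapQ _ _ _ _ (Submodule.Quotient.mk _) = _
  rw [Submodule.mapQ_apply]
  rfl

variable {F π}

omit [Module.Free ℤ N] [Module.Finite ℤ N] [Module.Free ℤ N'] in
lemma relClass_add (u w : Dual ℤ N) : relClass k π (u + w) = relClass k π u + relClass k π w := by
  rw [relClass, TensorProduct.tmul_add]
  rfl

omit [Module.Free ℤ N] [Module.Finite ℤ N] [Module.Free ℤ N'] in
lemma relClass_smul (c : ℤ) (u : Dual ℤ N) : relClass k π (c • u) = (c : k) • relClass k π u := by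
  rw [relClass, TensorProduct.tmul_smul, ← Int.cast_smul_eq_zsmul k]
  rfl

omit [Module.Free ℤ N] [Module.Finite ℤ N] [Module.Free ℤ N'] in
lemma relClass_sum {ι : Type*} (s : Finset ι) (u : ι → Dual ℤ N) :
    relClass k π (∑ i ∈ s, u i) = ∑ i ∈ s, relClass k π (u i) := by
  rw [relClass, TensorProduct.tmul_sum]
  exact map_sum (Submodule.mkQ _) _ _

/-- A section of `N → N_τ` gives a retraction `g`. The difference between a class and its image
under `relIncl ∘ g` is a combination of dual classes whose coefficients are, up to `mult τ`, the
pairings with the rays of `τ`; it vanishes when these pairings do. -/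
lemma Fan.exists_relProj (hF : F.IsSimplicial) (hm : (F.totalMult : k) ≠ 0) :
    ∃ g : RelM k π →ₗ[k] RelM k (F.starMap π τ), (∀ x, g (F.relIncl k π τ x) = x) ∧
      ∀ x, (∀ v : LinearMap.ker π, v.1 ∈ F.rayGens τ.1 → rayForm k π v x = 0) →
        F.relIncl k π τ (g x) = x := by
  classical
  have h0 := F.mult_ne_zero hm τ.2.1
  have h1 : F.mult τ.1 ≠ 0 := fun h => h0 (by rw [h, Nat.cast_zero])
  obtain ⟨hfin, -, -⟩ := F.rayGens_spec hF τ.2.1 h1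
  obtain ⟨e, he⟩ := F.exists_dual hF τ.2.1 h1
  obtain ⟨s, hs⟩ := Module.projective_lifting_property (lat τ.1).mkQ
    (LinearMap.id : QuotLattice τ.1 →ₗ[ℤ] _) (Submodule.mkQ_surjective _)
  have hs' : ∀ x, (lat τ.1).mkQ (s x) = x := fun x => LinearMap.congr_fun hs x
  -- The section is compatible with the maps to `N'` because `π` factors through `N_τ`.
  have hπs : π ∘ₗ s = F.starMap π τ := by
    refine LinearMap.ext fun x => ?_
    rw [LinearMap.comp_apply, ← F.starMap_mkQ π τ, hs']
  have hker : ∀ v ∈ F.rayGens τ.1, π v = 0 := fun v hv =>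
    lat_le_ker_of_map_eq_zero τ.2.2.2 (mem_lat.2 (Submodule.subset_span (F.pt_mem_of_mem_rayGens hv)))
  refine ⟨relMap k s hπs, fun x => ?_, fun x hx => ?_⟩
  · induction x using relM_induction with
    | h0 => rw [map_zero, map_zero]
    | hadd x y hx hy => rw [map_add, map_add, hx, hy]
    | hsmul c u =>
      rw [map_smul, map_smul, F.relIncl_relClass, relMap_relClass, LinearMap.comp_assoc, hs]
      rfl
  · have key : ∀ x : RelM k π, (F.mult τ.1 : k) • x = (F.mult τ.1 : k) •
        F.relIncl k π τ (relMap k s hπs x) + ∑ v ∈ hfin.toFinset.attach,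
          rayForm k π ⟨v.1, hker v.1 (hfin.mem_toFinset.1 v.2)⟩ x •
            relClass k π (e v.1 ∘ₗ (LinearMap.id - s ∘ₗ (lat τ.1).mkQ)) := by
      intro x
      induction x using relM_induction with
      | h0 => simp
      | hadd x y hx hy =>
        simp only [map_add, smul_add, add_smul, Finset.sum_add_distrib]
        rw [hx, hy]; abel
      | hsmul c u =>
        simp only [map_smul, smul_comm _ c, smul_assoc, ← Finset.smul_sum, ← smul_add]
        congr 1
        rw [relMap_relClass, F.relIncl_relClass, LinearMap.comp_assoc]
        simp only [rayForm_relClass]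
        -- The coefficients of `mult τ • w` with respect to the rays are found by applying the dual
        -- functionals; `mult τ` then cancels.
        have hlat : ∀ w ∈ lat τ.1, (F.mult τ.1 : ℤ) • w = ∑ v ∈ hfin.toFinset, e v w • v := by
          intro w hw
          have hmem := F.mult_smul_mem hw
          rw [← hfin.coe_toFinset, Submodule.mem_span_finset] at hmem
          obtain ⟨a, -, ha⟩ := hmem
          have hav : ∀ v ∈ hfin.toFinset, a v = e v w := by
            intro v hv
            have h2 := congrArg (e v) ha
            rw [map_sum, Finset.sum_eq_single v] at h2
            · rw [map_smul, he v (hfin.mem_toFinset.1 hv) v (hfin.mem_toFinset.1 hv), if_pos rfl,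
                map_nsmul, smul_eq_mul, nsmul_eq_mul, mul_comm] at h2
              exact mul_left_cancel₀ (by exact_mod_cast h1) h2
            · intro w' hw' hne
              rw [map_smul, he v (hfin.mem_toFinset.1 hv) w' (hfin.mem_toFinset.1 hw'),
                if_neg hne.symm, smul_zero]
            · exact fun h => (h hv).elim
          rw [natCast_zsmul, ← ha]
          exact Finset.sum_congr rfl fun v hv => by rw [hav v hv]
        have hu : (F.mult τ.1 : ℤ) • u = (F.mult τ.1 : ℤ) • (u ∘ₗ s ∘ₗ (lat τ.1).mkQ) +
            ∑ v ∈ hfin.toFinset.attach, u v.1 • (e v.1 ∘ₗ (LinearMap.id - s ∘ₗ (lat τ.1).mkQ)) := by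
          ext y
          have hy : y - s ((lat τ.1).mkQ y) ∈ lat τ.1 := by
            rw [← Submodule.Quotient.mk_eq_zero, ← Submodule.mkQ_apply, map_sub, hs', sub_self]
          have h3 := congrArg u (hlat _ hy)
          rw [map_smul, map_sum, map_sub, ← Finset.sum_attach] at h3
          simp only [LinearMap.add_apply, LinearMap.smul_apply, LinearMap.sum_apply,
            LinearMap.comp_apply, LinearMap.sub_apply, LinearMap.id_apply]
          simp only [map_smul] at h3
          have h4 : ∀ v : hfin.toFinset, u v.1 • (e v.1) (y - s ((lat τ.1).mkQ y)) =
            (e v.1) (y - s ((lat τ.1).mkQ y)) • u v.1 := fun v => by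
              rw [smul_eq_mul, smul_eq_mul, mul_comm]
          simp only [h4]
          rw [← h3, smul_sub]; abel
        have h5 := congrArg (relClass k π) hu
        rw [relClass_add, relClass_smul, relClass_smul, relClass_sum] at h5
        simpa only [relClass_smul, Int.cast_natCast] using h5
    have h6 := key x
    rw [Finset.sum_eq_zero, add_zero] at h6
    · exact ((smul_right_injective _ h0) h6).symm
    · intro v _
      rw [hx _ (hfin.mem_toFinset.1 v.2), zero_smul]

omit [Module.Free ℤ N] [Module.Finite ℤ N] in
-- The case `c = 0`, `v' = 0` covers the rays of `τ`, whose functionals vanish on the image of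
-- `relIncl`.
lemma Fan.rayForm_relIncl {v : LinearMap.ker π} {v' : LinearMap.ker (F.starMap π τ)} {c : ℕ}
    (h : (lat τ.1).mkQ v.1 = c • v'.1) :
    rayForm k π v ∘ₗ F.relIncl k π τ = (c : k) • rayForm k (F.starMap π τ) v' := by
  refine LinearMap.ext fun x => ?_
  induction x using relM_induction with
  | h0 => rw [map_zero, map_zero]
  | hadd x y hx hy => rw [map_add, map_add, hx, hy]
  | hsmul a u =>
    rw [map_smul, map_smul, LinearMap.comp_apply, F.relIncl_relClass, rayForm_relClass,
      LinearMap.smul_apply, rayForm_relClass, LinearMap.comp_apply, h, map_nsmul]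
    simp

end RelIncl

end Toric

namespace ExteriorAlgebra

variable {k V W : Type*} [Field k] [AddCommGroup V] [Module k V] [AddCommGroup W] [Module k W]

lemma map_mem_killed {I J : Type*} {ℓ : I → Dual k W} {ℓ' : J → Dual k V} {A : Set I} {A' : Set J}
    {φ : V →ₗ[k] W} (h : ∀ i ∈ A, ℓ i ∘ₗ φ = 0 ∨ ∃ j ∈ A', ∃ c : k, ℓ i ∘ₗ φ = c • ℓ' j) {q : ℕ}
    {m : ExteriorAlgebra k V} (hm : m ∈ killed ℓ' A' q) : map φ m ∈ killed ℓ A q := by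
  obtain ⟨h1, h2⟩ := mem_killed.1 hm
  refine mem_killed.2 ⟨map_mem_exteriorPower _ h1, fun i hi => ?_⟩
  rw [contractLeft_map]
  obtain h3 | ⟨j, hj, c, h3⟩ := h i hi
  · rw [h3, map_zero, LinearMap.zero_apply, map_zero]
  · rw [h3, map_smul, LinearMap.smul_apply, h2 j hj, smul_zero, map_zero]

end ExteriorAlgebra

/-! ### The residue operator in a fixed degree -/

namespace Toric

open ExteriorAlgebra

section ResidueOperator

variable {k : Type u} [Field k] {N N' : Type u} [AddCommGroup N] [AddCommGroup N']
  [Module.Free ℤ N] [Module.Finite ℤ N] [Module.Free ℤ N']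
  {F : Fan N} {π : N →ₗ[ℤ] N'} {r : ℕ} {τ : F.relCones π r}

/-- The algebraic residue along `τ`: the iterated contraction with the generators `v_j` of the rays
of `τ`, followed by a retraction `g` of `(M_τ)_{π_τ,k} → M_{π,k}`. -/
noncomputable def Fan.resOp (v : Fin r → LinearMap.ker π)
    (g : RelM k π →ₗ[k] RelM k (F.starMap π τ)) : Wedge k π →ₗ[k] Wedge k (F.starMap π τ) :=
  (map g).toLinearMap ∘ₗ iterContract (rayForm k π ∘ v)

omit [Module.Free ℤ N] [Module.Finite ℤ N] in
lemma Fan.mult_ne_zero' (hm : (F.totalMult : k) ≠ 0) : ∀ σ ∈ F.cones, F.mult σ ≠ 0 :=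
  fun _ hσ h => F.mult_ne_zero hm hσ (by rw [h, Nat.cast_zero])

/-- An element killed by the contracted rays of `τ` is fixed by the projection to their common
kernel, and on this kernel `relIncl ∘ g` is the identity. -/
lemma Fan.map_relIncl_map (hF : F.IsSimplicial) (hm : (F.totalMult : k) ≠ 0)
    {g : RelM k π →ₗ[k] RelM k (F.starMap π τ)}
    (hg : ∀ x, (∀ v : LinearMap.ker π, v.1 ∈ F.rayGens τ.1 → rayForm k π v x = 0) →
        F.relIncl k π τ (g x) = x) {m : Wedge k π}
    (h : ∀ v : LinearMap.ker π, v.1 ∈ F.rayGens τ.1 →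
      CliffordAlgebra.contractLeft (Q := (0 : QuadraticForm k (RelM k π))) (rayForm k π v) m = 0) :
    map (F.relIncl k π τ) (map g m) = m := by
  classical
  obtain ⟨e, he⟩ := F.exists_dual_relClass hF hm τ.2.1 π
  -- In degree zero all contracted rays of `τ` are included.
  have hfin := F.finite_relRays hF hm τ.2.1 π 0
  have he' : ∀ v ∈ hfin.toFinset, ∀ w ∈ hfin.toFinset, rayForm k π v (e w) = if v = w then 1 else 0 :=
    fun v hv w hw => he v w (hfin.mem_toFinset.1 hv).1 (hfin.mem_toFinset.1 hw).1
  have h1 := map_dualProj he' (m := m) fun v hv => h v (hfin.mem_toFinset.1 hv).1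
  rw [← h1, ← AlgHom.comp_apply, ← AlgHom.comp_apply, map_comp_map, map_comp_map]
  congr 2
  refine LinearMap.ext fun x => ?_
  exact hg _ fun v hv => apply_dualProj he' (hfin.mem_toFinset.2 ⟨hv, rfl⟩) x

omit [Module.Free ℤ N] [Module.Finite ℤ N] in
lemma Fan.map_relIncl_injective {g : RelM k π →ₗ[k] RelM k (F.starMap π τ)}
    (hg : ∀ x, g (F.relIncl k π τ x) = x) : Function.Injective (map (F.relIncl k π τ)) := by
  refine Function.LeftInverse.injective (g := map g) fun m => ?_
  rw [← AlgHom.comp_apply, map_comp_map, show g ∘ₗ F.relIncl k π τ = LinearMap.id from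
    LinearMap.ext hg, map_id, AlgHom.id_apply]

omit [Module.Free ℤ N] [Module.Finite ℤ N] [Module.Free ℤ N'] in
lemma Fan.mkQ_eq_zero_of_mem_rayGens {τ : Cone N} {v : N} (hv : v ∈ F.rayGens τ) :
    (lat τ).mkQ v = 0 := by
  rw [Submodule.mkQ_apply, Submodule.Quotient.mk_eq_zero, mem_lat]
  exact Submodule.subset_span (F.pt_mem_of_mem_rayGens hv)

variable {σ : Cone N} (hτσ : τ.1 ≤ σ)

omit [Module.Free ℤ N] [Module.Finite ℤ N] [Module.Free ℤ N'] in
include hτσ in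
lemma Fan.mem_relRays_of_mem_rayGens {v : LinearMap.ker π} (hv : v.1 ∈ F.rayGens τ.1)
    (u' : Dual ℤ (QuotLattice τ.1)) : v ∈ F.relRays π σ (u' ∘ₗ (lat τ.1).mkQ) :=
  ⟨F.rayGens_mono hτσ hv, by
    rw [LinearMap.comp_apply, Fan.mkQ_eq_zero_of_mem_rayGens hv, map_zero]⟩

omit [Module.Free ℤ N] [Module.Finite ℤ N] [Module.Free ℤ N'] in
lemma Fan.IsRayOrdering.mem {τ : Cone N} {v : Fin r → LinearMap.ker π}
    (hv : F.IsRayOrdering τ v) (i : Fin r) : (v i).1 ∈ F.rayGens τ := hv.2 ▸ ⟨i, rfl⟩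

variable {v : Fin r → LinearMap.ker π} (hv : F.IsRayOrdering τ.1 v)
  {g : RelM k π →ₗ[k] RelM k (F.starMap π τ)} (hF : F.IsSimplicial) (hm : (F.totalMult : k) ≠ 0)

include hτσ hv hF hm in
-- The iterated contraction is killed by the rays of `τ`, so it comes from `(M_τ)_{π_τ,k}` and
-- applying `g` loses nothing.
lemma Fan.map_relIncl_resOp
    (hg : ∀ x, (∀ v : LinearMap.ker π, v.1 ∈ F.rayGens τ.1 → rayForm k π v x = 0) →
        F.relIncl k π τ (g x) = x) {u' : Dual ℤ (QuotLattice τ.1)} {q : ℕ} {x : Wedge k π}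
    (hx : x ∈ ⋀[k]^r (RelM k π) *
      killed (rayForm k π) (F.relRays π σ (u' ∘ₗ (lat τ.1).mkQ)) q) :
    map (F.relIncl k π τ) (F.resOp v g x) = iterContract (rayForm k π ∘ v) x :=
  F.map_relIncl_map hF hm hg fun _ hw => (mem_killed.1 (iterContract_mem_killed
    (fun i => F.mem_relRays_of_mem_rayGens hτσ (hv.mem i) u') hx)).2 _
      (F.mem_relRays_of_mem_rayGens hτσ hw u')

include hτσ hv hF hm in
-- A ray `v'` of the star satisfies `[w] = c v'` for a ray `w` of `σ`. The condition at `w` gives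
-- `c` times the condition at `v'`, and `c` is invertible in `k`.
lemma Fan.resOp_mem_killed (hσ : σ ∈ F.cones) (hg : ∀ x, g (F.relIncl k π τ x) = x)
    (hg' : ∀ x, (∀ v : LinearMap.ker π, v.1 ∈ F.rayGens τ.1 → rayForm k π v x = 0) →
        F.relIncl k π τ (g x) = x) {u' : Dual ℤ (QuotLattice τ.1)} {q : ℕ} {x : Wedge k π}
    (hx : x ∈ ⋀[k]^r (RelM k π) *
      killed (rayForm k π) (F.relRays π σ (u' ∘ₗ (lat τ.1).mkQ)) q) :
    F.resOp v g x ∈ killed (rayForm k (F.starMap π τ))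
      ((F.star τ.1 τ.2.1).relRays (F.starMap π τ) (starCone τ.1 σ) u') q := by
  have h1 := mem_killed.1 (iterContract_mem_killed
    (fun i => F.mem_relRays_of_mem_rayGens hτσ (hv.mem i) u') hx)
  refine mem_killed.2 ⟨map_mem_exteriorPower g h1.1, ?_⟩
  rintro v' ⟨hv', hu'⟩
  obtain ⟨w, hw, -, c, hc, hwv⟩ := Fan.exists_of_mem_rayGens_star k hF
    (fun σ hσ => F.mult_ne_zero hm hσ) τ.2.1 hσ hτσ hv'
  have hπw : π w = 0 := by
    rw [← F.starMap_mkQ π τ, hwv, map_nsmul, LinearMap.mem_ker.1 v'.2, smul_zero]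
  have hmem : (⟨w, hπw⟩ : LinearMap.ker π) ∈ F.relRays π σ (u' ∘ₗ (lat τ.1).mkQ) :=
    ⟨hw, by rw [LinearMap.comp_apply, hwv, map_nsmul, hu', smul_zero]⟩
  have h2 := h1.2 _ hmem
  rw [← F.map_relIncl_resOp hτσ hv hF hm hg' hx, contractLeft_map,
    F.rayForm_relIncl (v := ⟨w, hπw⟩) τ hwv] at h2
  have h3 := F.map_relIncl_injective hg (h2.trans (map_zero _).symm)
  rw [map_smul, LinearMap.smul_apply] at h3
  exact (smul_eq_zero.1 h3).resolve_left hc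

include hτσ hF hm in
-- The functional of each relevant ray of `σ` pulls back to zero or to a multiple of the functional
-- of a ray of the star; here the factor need not be invertible in `k`.
lemma Fan.map_relIncl_mem_killed (hσ : σ ∈ F.cones)
    {u' : Dual ℤ (QuotLattice τ.1)} {q : ℕ} {m : Wedge k (F.starMap π τ)}
    (h : m ∈ killed (rayForm k (F.starMap π τ))
      ((F.star τ.1 τ.2.1).relRays (F.starMap π τ) (starCone τ.1 σ) u') q) :
    map (F.relIncl k π τ) m ∈
      killed (rayForm k π) (F.relRays π σ (u' ∘ₗ (lat τ.1).mkQ)) q := by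
  refine map_mem_killed ?_ h
  rintro w ⟨hw, huw⟩
  by_cases hwτ : w.1 ∈ F.rayGens τ.1
  · left
    rw [F.rayForm_relIncl (v := w) (v' := 0) τ (c := 0)
      (by rw [Fan.mkQ_eq_zero_of_mem_rayGens hwτ, zero_smul]), Nat.cast_zero, zero_smul]
  · obtain ⟨v', hv', c, hc⟩ := Fan.exists_mem_rayGens_star hF (F.mult_ne_zero' hm) τ.2.1 hσ hτσ hw hwτ
    -- For `c ≠ 0` the factor cancels in `N'` and in `ℤ`, so that `v'` is contracted and orthogonal
    -- to `u'`.
    rcases eq_or_ne c 0 with rfl | hc0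
    · left
      rw [F.rayForm_relIncl (v := w) (v' := 0) τ (c := 0) (by rw [hc, zero_smul, zero_smul]),
        Nat.cast_zero, zero_smul]
    · have hπ : F.starMap π τ v' = 0 := by
        have h3 : F.starMap π τ ((lat τ.1).mkQ w.1) = 0 := w.2
        rw [hc, map_nsmul, ← natCast_zsmul] at h3
        exact (smul_eq_zero.1 h3).resolve_left (Nat.cast_ne_zero.2 hc0)
      have hu : u' v' = 0 := by
        rw [LinearMap.comp_apply, hc, map_nsmul] at huw
        exact (smul_eq_zero.1 huw).resolve_left hc0
      exact Or.inr ⟨⟨v', hπ⟩, ⟨hv', hu⟩, c, F.rayForm_relIncl (v := w) (v' := ⟨v', hπ⟩) τ hc⟩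

omit [Module.Free ℤ N] [Module.Finite ℤ N] [Module.Free ℤ N'] in
lemma comp_mkQ_mem_dualMonoid {τ σ : Cone N} {u' : Dual ℤ (QuotLattice τ)}
    (hu : u' ∈ dualMonoid (starCone τ σ)) : u' ∘ₗ (lat τ).mkQ ∈ dualMonoid σ := by
  intro x hx
  rw [← pair_projR]
  exact hu _ ⟨x, hx, rfl⟩

end ResidueOperator

/-! ### The residue on a chart -/

section ChartResidue

variable {k : Type u} [Field k] {N N' : Type u} [AddCommGroup N] [AddCommGroup N']
  [Module.Free ℤ N] [Module.Finite ℤ N] [Module.Free ℤ N']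
  {F : Fan N} {π : N →ₗ[ℤ] N'} {r : ℕ} {τ : F.relCones π r}

omit [Module.Free ℤ N] [Module.Finite ℤ N] [Module.Free ℤ N'] in
lemma Fan.pair_comp_mkQ {u' : Dual ℤ (QuotLattice τ.1)} {x : ℝ ⊗[ℤ] N} (hx : x ∈ τ.1) :
    pair (u' ∘ₗ (lat τ.1).mkQ) x = 0 := by
  rw [← pair_projR, (projR_eq_zero (F.rational _ τ.2.1)).2 (Submodule.subset_span hx), map_zero]

omit [Module.Free ℤ N] [Module.Finite ℤ N] [Module.Free ℤ N'] in
lemma comp_mkQ_injective {τ : Cone N} {u w : Dual ℤ (QuotLattice τ)}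
    (h : u ∘ₗ (lat τ).mkQ = w ∘ₗ (lat τ).mkQ) : u = w := Submodule.linearMap_qext _ h

/-- The algebraic residue along `τ` on the chart `A_σ`. -/
noncomputable def Fan.starRes (v : Fin r → LinearMap.ker π)
    (g : RelM k π →ₗ[k] RelM k (F.starMap π τ)) (σ : F.cones) (h : τ.1 ≤ σ.1) :
    CoordRing k σ.1 ⊗[k] Wedge k π →ₗ[k]
      CoordRing k (F.starPt τ.1 τ.2.1 σ h).1 ⊗[k] Wedge k (F.starMap π τ) :=
  TensorProduct.map (F.starRing k τ.1 τ.2.1 σ h).toLinearMap (F.resOp v g)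

variable {v : Fin r → LinearMap.ker π} {g : RelM k π →ₗ[k] RelM k (F.starMap π τ)}

omit [Module.Free ℤ N] [Module.Finite ℤ N] in
-- Degrees on the star correspond to the degrees `u ∈ τ^⊥` on `A_σ`; the other characters restrict
-- to zero.
lemma Fan.gradedComp_starRes (σ : F.cones) (h : τ.1 ≤ σ.1)
    (u' : dualMonoid (F.starPt τ.1 τ.2.1 σ h).1) (t : CoordRing k σ.1 ⊗[k] Wedge k π) :
    gradedComp u' (F.starRes v g σ h t) =
      F.resOp v g (gradedComp (⟨u'.1 ∘ₗ (lat τ.1).mkQ,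
        comp_mkQ_mem_dualMonoid u'.2⟩ : dualMonoid σ.1) t) := by
  classical
  refine gradedComp_map _ (fun a => ?_) t
  induction a using coordRing_induction with
  | h0 => simp only [map_zero]
  | hadd x y hx hy => simp only [map_add, hx, hy]
  | hsmul c w =>
    rw [map_smul, map_smul, map_smul, AlgHom.toLinearMap_apply]
    congr 1
    by_cases hw : ∀ x ∈ τ.1, pair w.1 x = 0
    · rw [F.starRing_of_mem k τ.1 τ.2.1 σ h w hw, chi, chi, coeffAt_single, coeffAt_single]
      congr 1
      rw [eq_iff_iff, Subtype.ext_iff, Subtype.ext_iff]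
      constructor
      · intro e
        change w.1 = u'.1 ∘ₗ _
        rw [← e, descend_comp]
      · intro e
        exact comp_mkQ_injective ((descend_comp w.1 hw).trans e)
    · rw [F.starRing_of_notMem k τ.1 τ.2.1 σ h w hw, map_zero, chi, coeffAt_single, if_neg]
      rintro rfl
      exact hw fun x hx => Fan.pair_comp_mkQ hx

variable (hv : F.IsRayOrdering τ.1 v) (hF : F.IsSimplicial) (hm : (F.totalMult : k) ≠ 0)

include hv hF hm in
lemma Fan.starRes_mem_tildePart (hg : ∀ x, g (F.relIncl k π τ x) = x)
    (hg' : ∀ x, (∀ v : LinearMap.ker π, v.1 ∈ F.rayGens τ.1 → rayForm k π v x = 0) →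
        F.relIncl k π τ (g x) = x) (σ : F.cones) (h : τ.1 ≤ σ.1) {q : ℕ}
    {t : CoordRing k σ.1 ⊗[k] Wedge k π} (ht : t ∈ F.weightPart k π σ.1 r q) :
    F.starRes v g σ h t ∈ (F.star τ.1 τ.2.1).tildePart k (F.starMap π τ)
      (F.starPt τ.1 τ.2.1 σ h).1 q :=
  mem_gradedPart.2 fun u' => by
    have h1 := mem_gradedPart.1 ht ⟨u'.1 ∘ₗ (lat τ.1).mkQ, comp_mkQ_mem_dualMonoid u'.2⟩
    have h2 := F.resOp_mem_killed (u' := u'.1) h hv hF hm σ.2 hg hg' h1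
    exact (F.gradedComp_starRes σ h u' t).symm ▸ h2

end ChartResidue

end Toric

namespace ExteriorAlgebra

variable {k V W : Type*} [Field k] [AddCommGroup V] [Module k V] [AddCommGroup W] [Module k W]

lemma map_map_of_leftInverse {f : V →ₗ[k] W} {g : W →ₗ[k] V} (h : ∀ x, g (f x) = x)
    (m : ExteriorAlgebra k V) : map g (map f m) = m := by
  rw [← AlgHom.comp_apply, map_comp_map, show g ∘ₗ f = LinearMap.id from LinearMap.ext h, map_id,
    AlgHom.id_apply]

end ExteriorAlgebra

section

variable {R A B : Type*} [CommRing R] [AddCommGroup A] [Module R A] [AddCommGroup B] [Module R B]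

lemma tmul_congr {a a' : A} {b b' : B} (ha : a = a') (hb : b = b') : a ⊗ₜ[R] b = a' ⊗ₜ[R] b' := by
  rw [ha, hb]

lemma tmul_eq_zero {a : A} {b : B} (hb : b = 0) : a ⊗ₜ[R] b = 0 := by
  rw [hb, TensorProduct.tmul_zero]

lemma map_add_eq_zero_of_eq_zero {f : A →ₗ[R] B} {a a' : A} (h : f a = 0) (h' : f a' = 0) :
    f (a + a') = 0 := by
  rw [map_add, h, h', add_zero]

lemma map_sum_eq_single (f : A →ₗ[R] B) {ι : Type*} [Fintype ι] {a : ι → A} (i : ι)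
    (h : ∀ j, j ≠ i → f (a j) = 0) : f (∑ j, a j) = f (a i) := by
  rw [map_sum, Finset.sum_eq_single i (fun j _ => h j) fun h => (h (Finset.mem_univ _)).elim]

end

/-! ### Exactness on a chart -/

namespace Toric

open ExteriorAlgebra

section ChartExactness

variable {k : Type u} [Field k] {N N' : Type u} [AddCommGroup N] [AddCommGroup N']
  [Module.Free ℤ N] [Module.Finite ℤ N] [Module.Free ℤ N']
  {F : Fan N} {π : N →ₗ[ℤ] N'} {r q : ℕ}

/-- `g` is a retraction of `(M_τ)_{π_τ,k} → M_{π,k}`, and the image of this map is the common kernel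
of the functionals `⟨·, v_ρ⟩` for the rays `ρ` of `τ`. -/
def Fan.IsRelProj (τ : F.relCones π r) (g : RelM k π →ₗ[k] RelM k (F.starMap π τ)) : Prop :=
  (∀ x, g (F.relIncl k π τ x) = x) ∧
    ∀ x, (∀ v : LinearMap.ker π, v.1 ∈ F.rayGens τ.1 → rayForm k π v x = 0) →
      F.relIncl k π τ (g x) = x

omit [Module.Free ℤ N] [Module.Finite ℤ N] [Module.Free ℤ N'] in
lemma Fan.IsRayOrdering.image_range {τ : Cone N} {v : Fin r → LinearMap.ker π}
    (hv : F.IsRayOrdering τ v) : Subtype.val '' Set.range v = F.rayGens τ := by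
  rw [← Set.range_comp]
  exact hv.2

lemma gradedComp_eq_zero {G B : Type*} [AddCommGroup B] [Module k B] {u : G}
    {t : AddMonoidAlgebra k G ⊗[k] B} (h : t = 0) : gradedComp u t = 0 := by
  rw [h, map_zero]

omit [Module.Free ℤ N] [Module.Finite ℤ N] in
lemma Fan.starRes_chi_tmul {τ : F.relCones π r} {v : Fin r → LinearMap.ker π}
    {g : RelM k π →ₗ[k] RelM k (F.starMap π τ)} (σ : F.cones) (h : τ.1 ≤ σ.1) (u : dualMonoid σ.1)
    (hu : ∀ x ∈ τ.1, pair u.1 x = 0) (b : Wedge k π) :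
    F.starRes v g σ h (chi k u ⊗ₜ b) =
      chi k (σ := (F.starPt τ.1 τ.2.1 σ h).1) ⟨descend u.1 hu, descend_mem rfl u hu⟩ ⊗ₜ
        F.resOp v g b :=
  tmul_congr (F.starRing_of_mem k τ.1 τ.2.1 σ h u hu) rfl

omit [Module.Free ℤ N] [Module.Finite ℤ N] in
lemma Fan.starRes_chi_tmul_eq_zero {τ : F.relCones π r} {v : Fin r → LinearMap.ker π}
    {g : RelM k π →ₗ[k] RelM k (F.starMap π τ)} (σ : F.cones) (h : τ.1 ≤ σ.1) (u : dualMonoid σ.1)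
    (hu : ¬ ∀ x ∈ τ.1, pair u.1 x = 0) (b : Wedge k π) :
    F.starRes v g σ h (chi k u ⊗ₜ b) = 0 :=
  (tmul_congr (F.starRing_of_notMem k τ.1 τ.2.1 σ h u hu) rfl).trans (TensorProduct.zero_tmul _ _)

variable (hF : F.IsSimplicial) (hm : (F.totalMult : k) ≠ 0)

omit [Module.Finite ℤ N] [Module.Free ℤ N'] in
include hF hm in
lemma Fan.relCones_ext {τ τ' : F.relCones π r} (h : F.rayGens τ.1 = F.rayGens τ'.1) : τ = τ' := by
  refine Subtype.ext ?_
  rw [(F.rayGens_spec hF τ.2.1 (F.mult_ne_zero' hm _ τ.2.1)).2.2, h,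
    ← (F.rayGens_spec hF τ'.2.1 (F.mult_ne_zero' hm _ τ'.2.1)).2.2]

omit [Module.Free ℤ N'] in
include hF hm in
/-- Distinct rays of a cone which are contracted by `π` span a cone of `Σ_π(r)`. -/
lemma Fan.exists_relCone {σ : Cone N} (hσ : σ ∈ F.cones) {f : Fin r → LinearMap.ker π}
    (hf : Function.Injective f) (hfσ : ∀ i, (f i).1 ∈ F.rayGens σ) :
    ∃ τ : F.relCones π r, τ.1 ≤ σ ∧ F.rayGens τ.1 = Subtype.val '' Set.range f ∧
      τ.1 = PointedCone.hull ℝ (pt '' (Subtype.val '' Set.range f)) := by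
  have hmσ := F.mult_ne_zero' hm _ hσ
  have hJ : Subtype.val '' Set.range f ⊆ F.rayGens σ := by
    rintro _ ⟨_, ⟨i, rfl⟩, rfl⟩
    exact hfσ i
  have hmem := F.hull_mem hF hσ hmσ hJ
  have hray := F.rayGens_hull hF hσ hmσ hJ
  refine ⟨⟨_, hmem, ?_, ?_⟩, F.hull_le hJ, hray, rfl⟩
  · rw [F.coneDim_eq hF hmem (F.mult_ne_zero' hm _ hmem), hray,
      Set.ncard_image_of_injective _ Subtype.val_injective, ← Set.image_univ,
      Set.ncard_image_of_injective _ hf, Set.ncard_univ, Nat.card_fin]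
  · have hle : PointedCone.hull ℝ (pt '' (Subtype.val '' Set.range f)) ≤
        PointedCone.ofSubmodule (LinearMap.ker (π.baseChange ℝ)) := by
      refine Submodule.span_le.2 ?_
      rintro _ ⟨_, ⟨v, -, rfl⟩, rfl⟩
      change π.baseChange ℝ (pt v.1) = 0
      rw [pt, LinearMap.baseChange_tmul, LinearMap.mem_ker.1 v.2, TensorProduct.tmul_zero]
    exact fun x hx => hle hx

variable {v : F.relCones π r → Fin r → LinearMap.ker π} (hv : ∀ τ, F.IsRayOrdering τ.1 (v τ))
  {g : ∀ τ : F.relCones π r, RelM k π →ₗ[k] RelM k (F.starMap π τ)} (hg : ∀ τ, F.IsRelProj τ (g τ))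

include hF hm hv hg in
/-- On a chart, the sections of `W_r` with zero residues are sections of `W_{r-1}`. -/
lemma Fan.mem_weightBelowPart_of_starRes (σ : F.cones) {t : CoordRing k σ.1 ⊗[k] Wedge k π}
    (ht : t ∈ F.weightPart k π σ.1 r q)
    (h0 : ∀ τ (h : τ.1 ≤ σ.1), F.starRes (v τ) (g τ) σ h t = 0) :
    t ∈ F.weightBelowPart k π σ.1 r q := by
  classical
  refine mem_gradedPart.2 fun u => ?_
  have ht' := mem_gradedPart.1 ht u
  obtain ⟨e, he⟩ := F.exists_dual_relClass hF hm σ.2 π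
  have hfin := F.finite_relRays hF hm σ.2 π u.1
  have hcoe := hfin.coe_toFinset
  -- These are the cones along which the degree `u` component can have a residue.
  let T := {τ : F.relCones π r // τ.1 ≤ σ.1 ∧ ∀ x ∈ τ.1, pair u.1 x = 0}
  have : Fintype T := Fintype.ofFinite T
  rw [← hcoe] at ht' ⊢
  refine mem_weightBelow (e := e) (fun τ : T => v τ.1) (fun τ => (hv τ.1).1) (fun τ i => ?_)
    (fun f hf hfA => ?_) (fun τ τ' h => ?_)
    (fun v hv w hw => he v w (hfin.mem_toFinset.1 hv).1 (hfin.mem_toFinset.1 hw).1) ht' fun τ => ?_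
  · have h1 := (hv τ.1).mem i
    have h2 := τ.2.2 _ (F.pt_mem_of_mem_rayGens h1)
    rw [pair_pt] at h2
    exact hfin.mem_toFinset.2 ⟨F.rayGens_mono τ.2.1 h1, by exact_mod_cast h2⟩
  · have hfA' := fun i => hfin.mem_toFinset.1 (hfA i)
    -- By simpliciality, any `r` contracted rays in `σ ∩ u^⊥` span such a cone.
    obtain ⟨τ, hτ, hray, hτe⟩ := F.exists_relCone hF hm σ.2 hf fun i => (hfA' i).1
    refine ⟨⟨τ, hτ, fun x hx => ?_⟩, ?_⟩
    · have hle : τ.1 ≤ PointedCone.ofSubmodule (LinearMap.ker (pair u.1)) := by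
        rw [hτe]
        refine Submodule.span_le.2 ?_
        rintro _ ⟨_, ⟨_, ⟨i, rfl⟩, rfl⟩, rfl⟩
        change pair u.1 (pt (f i).1) = 0
        rw [pair_pt, (hfA' i).2, Int.cast_zero]
      exact hle hx
    · refine Subtype.val_injective.image_injective ?_
      rw [(hv τ).image_range, hray]
  · refine Subtype.ext (F.relCones_ext hF hm ?_)
    rw [← (hv τ.1).image_range, ← (hv τ'.1).image_range, h]
  · have h1 : (descend u.1 τ.2.2) ∘ₗ (lat τ.1.1).mkQ = u.1 := descend_comp _ _
    have h2 := F.gradedComp_starRes (v := v τ.1) (g := g τ.1) σ τ.2.1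
      ⟨descend u.1 τ.2.2, descend_mem rfl u τ.2.2⟩ t
    have h5 := h2.symm.trans (gradedComp_eq_zero (h0 τ.1 τ.2.1))
    have h3 : (⟨descend u.1 τ.2.2 ∘ₗ (lat τ.1.1).mkQ,
        comp_mkQ_mem_dualMonoid (descend_mem rfl u τ.2.2)⟩ : dualMonoid σ.1) = u := Subtype.ext h1
    -- Vanishing of the residue in `⋀ (M_τ)_{π_τ,k}` gives vanishing of the iterated contraction in
    -- `⋀ M_{π,k}`.
    have h4 := F.map_relIncl_resOp (u' := descend u.1 τ.2.2) (x := gradedComp u t) (q := q) τ.2.1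
      (hv τ.1) hF hm (hg τ.1).2 (by rw [h1, ← hcoe]; exact ht')
    rw [h3] at h5
    rw [← h4]
    exact (congrArg _ h5).trans (map_zero _)

include hF hm hv hg in
-- In one degree, the image of `b` is multiplied by the product of the dual vectors of the rays of
-- `τ`. Its residue is `b` along `τ` and zero along every other cone of the same dimension.
lemma Fan.exists_starRes_eq_single (σ : F.cones) (τ : F.relCones π r) (h : τ.1 ≤ σ.1)
    {t' : CoordRing k (F.starPt τ.1 τ.2.1 σ h).1 ⊗[k] Wedge k (F.starMap π τ)}
    (ht' : t' ∈ (F.star τ.1 τ.2.1).tildePart k (F.starMap π τ) (F.starPt τ.1 τ.2.1 σ h).1 q) :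
    ∃ t ∈ F.weightPart k π σ.1 r q, F.starRes (v τ) (g τ) σ h t = t' ∧
      ∀ τ' (h' : τ'.1 ≤ σ.1), τ' ≠ τ → F.starRes (v τ') (g τ') σ h' t = 0 := by
  classical
  refine gradedPart_induction (P := fun t' => ∃ t ∈ F.weightPart k π σ.1 r q,
    F.starRes (v τ) (g τ) σ h t = t' ∧
      ∀ τ' (h' : τ'.1 ≤ σ.1), τ' ≠ τ → F.starRes (v τ') (g τ') σ h' t = 0) ?_ ?_ ?_ ht'
  · exact ⟨0, Submodule.zero_mem _, LinearMap.map_zero _, fun _ _ _ => LinearMap.map_zero _⟩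
  · rintro _ _ ⟨s, hs, rfl, hs'⟩ ⟨t, ht, rfl, ht'⟩
    exact ⟨s + t, Submodule.add_mem _ hs ht, LinearMap.map_add _ _ _, fun τ' h' hne =>
      map_add_eq_zero_of_eq_zero (hs' τ' h' hne) (ht' τ' h' hne)⟩
  · intro u' b hb
    obtain ⟨e, he⟩ := F.exists_dual_relClass hF hm σ.2 π
    let u : dualMonoid σ.1 := ⟨u'.1 ∘ₗ (lat τ.1).mkQ, comp_mkQ_mem_dualMonoid u'.2⟩
    have hu : ∀ x ∈ τ.1, pair u.1 x = 0 := fun x hx => Fan.pair_comp_mkQ hx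
    have hfin := F.finite_relRays hF hm σ.2 π u.1
    have he' : ∀ v ∈ hfin.toFinset, ∀ w ∈ hfin.toFinset,
        rayForm k π v (e w) = if v = w then 1 else 0 :=
      fun v hv w hw => he v w (hfin.mem_toFinset.1 hv).1 (hfin.mem_toFinset.1 hw).1
    have hmem : ∀ τ' : F.relCones π r, τ'.1 ≤ σ.1 → (∀ x ∈ τ'.1, pair u.1 x = 0) →
        ∀ i, v τ' i ∈ hfin.toFinset := by
      intro τ' h' hu' i
      have h1 := (hv τ').mem i
      have h2 := hu' _ (F.pt_mem_of_mem_rayGens h1)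
      rw [pair_pt] at h2
      exact hfin.mem_toFinset.2 ⟨F.rayGens_mono h' h1, by exact_mod_cast h2⟩
    have hm' := F.map_relIncl_mem_killed h hF hm σ.2 hb
    have hm0 : ∀ v ∈ hfin.toFinset, CliffordAlgebra.contractLeft
        (Q := (0 : QuadraticForm k (RelM k π))) (rayForm k π v) (map (F.relIncl k π τ) b) = 0 :=
      fun v hv => (mem_killed.1 hm').2 v (hfin.mem_toFinset.1 hv)
    refine ⟨chi k u ⊗ₜ (ιMulti k r (e ∘ v τ) * map (F.relIncl k π τ) b),
      single_tmul_mem_gradedPart (Submodule.mul_mem_mul ?_ hm'), ?_, fun τ' h' hne => ?_⟩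
    · exact (exteriorPower.ιMulti k r (e ∘ v τ)).2
    · refine (F.starRes_chi_tmul σ h u hu _).trans (tmul_congr ?_ ?_)
      · exact congrArg (chi k) (Subtype.ext (comp_mkQ_injective (descend_comp _ hu)))
      · refine (congrArg (map (g τ))
          (iterContract_ιMulti_dual (hv τ).1 (hmem τ h hu) he' hm0)).trans ?_
        exact map_map_of_leftInverse (hg τ).1 b
    · by_cases hu' : ∀ x ∈ τ'.1, pair u.1 x = 0
      · refine (F.starRes_chi_tmul σ h' u hu' _).trans (tmul_eq_zero ?_)
        refine (congrArg (map (g τ')) (iterContract_ιMulti_dual_eq_zero (hmem τ h hu)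
          (hmem τ' h' hu') (fun hs => hne ?_) he' hm0)).trans (map_zero _)
        -- Both cones have `r` rays, so an inclusion of their sets of rays is an equality.
        refine F.relCones_ext hF hm (Set.eq_of_subset_of_ncard_le ?_ ?_
          (F.rayGens_spec hF τ'.2.1 (F.mult_ne_zero' hm _ τ'.2.1)).1).symm
        · rw [← (hv τ).image_range, ← (hv τ').image_range]
          exact Set.image_mono hs
        · rw [← F.coneDim_eq hF τ'.2.1 (F.mult_ne_zero' hm _ τ'.2.1),
            ← F.coneDim_eq hF τ.2.1 (F.mult_ne_zero' hm _ τ.2.1), τ.2.2.1, τ'.2.2.1]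
      · exact F.starRes_chi_tmul_eq_zero σ h' u hu' _

include hF hm hv hg in
/-- On a chart, the sections of `W_r` have arbitrary residues. -/
lemma Fan.exists_starRes_eq (σ : F.cones)
    (t' : ∀ (τ : F.relCones π r) (h : τ.1 ≤ σ.1),
      CoordRing k (F.starPt τ.1 τ.2.1 σ h).1 ⊗[k] Wedge k (F.starMap π τ))
    (ht' : ∀ (τ : F.relCones π r) (h : τ.1 ≤ σ.1), t' τ h ∈ (F.star τ.1 τ.2.1).tildePart k (F.starMap π τ)
      (F.starPt τ.1 τ.2.1 σ h).1 q) :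
    ∃ t ∈ F.weightPart k π σ.1 r q, ∀ (τ : F.relCones π r) (h : τ.1 ≤ σ.1), F.starRes (v τ) (g τ) σ h t = t' τ h := by
  classical
  have : Fintype {τ : F.relCones π r // τ.1 ≤ σ.1} := Fintype.ofFinite _
  choose t ht h1 h2 using fun τ : {τ : F.relCones π r // τ.1 ≤ σ.1} =>
    F.exists_starRes_eq_single hF hm hv hg σ τ.1 τ.2 (ht' τ.1 τ.2)
  refine ⟨∑ τ, t τ, Submodule.sum_mem _ fun τ _ => ht τ, fun τ h => ?_⟩
  exact (map_sum_eq_single _ (⟨τ, h⟩ : {τ : F.relCones π r // τ.1 ≤ σ.1}) fun τ' hne =>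
    h2 τ' τ h fun e => hne (Subtype.ext e.symm)).trans (h1 ⟨τ, h⟩)

include hF hm hv hg in
/-- The residue of `η ∧ w` on a chart. -/
lemma Fan.starRes_mul (σ : F.cones) (τ : F.relCones π r) (h : τ.1 ≤ σ.1) (η : ⋀[k]^r (RelM k π))
    {t : CoordRing k σ.1 ⊗[k] Wedge k π} (ht : t ∈ F.tildePart k π σ.1 q) :
    Algebra.TensorProduct.map (AlgHom.id k _) (map (F.relIncl k π τ))
        (F.starRes (v τ) (g τ) σ h ((1 ⊗ₜ (η : Wedge k π)) * t)) =
      residueForm k π (v τ) η • Algebra.TensorProduct.map (F.starRing k τ.1 τ.2.1 σ h)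
        (AlgHom.id k (Wedge k π)) t := by
  refine gradedPart_induction (P := fun t =>
    Algebra.TensorProduct.map (AlgHom.id k _) (map (F.relIncl k π τ))
        (F.starRes (v τ) (g τ) σ h ((1 ⊗ₜ (η : Wedge k π)) * t)) =
      residueForm k π (v τ) η • Algebra.TensorProduct.map (F.starRing k τ.1 τ.2.1 σ h)
        (AlgHom.id k (Wedge k π)) t) ?_ ?_ ?_ ht
  · rw [mul_zero]
    exact ((congrArg _ (LinearMap.map_zero _)).trans (map_zero _)).trans
      ((congrArg _ (map_zero _)).trans (smul_zero _)).symm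
  · intro s t hs ht
    rw [mul_add]
    exact ((congrArg _ (LinearMap.map_add _ _ _)).trans (map_add _ _ _)).trans
      ((congrArg₂ _ hs ht).trans ((congrArg _ (map_add _ _ _)).trans (smul_add _ _ _)).symm)
  · intro u b hb
    rw [Algebra.TensorProduct.tmul_mul_tmul, one_mul]
    change _ = residueForm k π (v τ) η • (F.starRing k τ.1 τ.2.1 σ h (chi k u) ⊗ₜ[k] b)
    by_cases hu : ∀ x ∈ τ.1, pair u.1 x = 0
    · have h1 : descend u.1 hu ∘ₗ (lat τ.1).mkQ = u.1 := descend_comp _ _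
      have hb' : b ∈ killed (rayForm k π) (F.relRays π σ.1 (descend u.1 hu ∘ₗ (lat τ.1).mkQ)) q := by
        rw [h1]; exact hb
      have h2 := F.map_relIncl_resOp (u' := descend u.1 hu) h (hv τ) hF hm (hg τ).2
        (Submodule.mul_mem_mul η.2 hb')
      have h3 := iterContract_mul (rayForm k π ∘ v τ) η fun i => (mem_killed.1 hb').2 _
          (F.mem_relRays_of_mem_rayGens h ((hv τ).mem i) _)
      refine (congrArg _ (F.starRes_chi_tmul σ h u hu _)).trans ?_
      refine (tmul_congr rfl (h2.trans h3)).trans ((TensorProduct.tmul_smul _ _ _).trans ?_)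
      exact congrArg _ (tmul_congr (F.starRing_of_mem k τ.1 τ.2.1 σ h u hu).symm rfl)
    · refine (congrArg _ (F.starRes_chi_tmul_eq_zero σ h u hu _)).trans ((map_zero _).trans ?_)
      rw [F.starRing_of_notMem k τ.1 τ.2.1 σ h u hu]
      exact ((congrArg _ (TensorProduct.zero_tmul _ _)).trans (smul_zero _)).symm

end ChartExactness

end Toric

/-! ### Pullback of sections combined with a linear map -/

namespace Toric

section PullMap

variable {k : Type u} [Field k] {X Y : Scheme.{u}} [X.Over (Spec (.of k))] [Y.Over (Spec (.of k))]
  (f : Y ⟶ X) [f.IsOver (Spec (.of k))] {B B' : Type u} [Ring B] [Algebra k B] [Ring B']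
  [Algebra k B']

/-- The pullback of sections of `𝒪_X ⊗ B` along `f : Y ⟶ X`, combined with a linear map
`B → B'`. -/
noncomputable def pullMap (ℓ : B →ₗ[k] B') (U : X.Opens) :
    Γ(X, U) ⊗[k] B →ₗ[k] Γ(Y, f ⁻¹ᵁ U) ⊗[k] B' :=
  TensorProduct.map (pullHom k f U).toLinearMap ℓ

lemma preimage_opens_mono {U V : X.Opens} (h : V ≤ U) : f ⁻¹ᵁ V ≤ f ⁻¹ᵁ U := fun _ hx => h hx

lemma resHom_pullHom {U V : X.Opens} (h : V ≤ U) (a : Γ(X, U)) :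
    resHom k (preimage_opens_mono f h) (pullHom k f U a) = pullHom k f V (resHom k h a) :=
  (congrArg (fun g => g.hom a) (f.naturality (homOfLE h).op)).symm

lemma pullMap_tensorRes (ℓ : B →ₗ[k] B') {U V : X.Opens} (h : V ≤ U) (s : Γ(X, U) ⊗[k] B) :
    tensorRes B' (preimage_opens_mono f h) (pullMap f ℓ U s) = pullMap f ℓ V (tensorRes B h s) := by
  induction s using TensorProduct.induction_on with
  | zero => simp
  | add x y hx hy => simp only [map_add, hx, hy]
  | tmul a b =>
    rw [pullMap, TensorProduct.map_tmul, tensorRes_tmul, tensorRes_tmul, pullMap,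
      TensorProduct.map_tmul, AlgHom.toLinearMap_apply, AlgHom.toLinearMap_apply, resHom_pullHom]

lemma pullMap_smul (ℓ : B →ₗ[k] B') (U : X.Opens) (a : Γ(X, U)) (s : Γ(X, U) ⊗[k] B) :
    pullMap f ℓ U (a • s) = pullHom k f U a • pullMap f ℓ U s :=
  tensorMap_linear_smul _ _ _ _

lemma tensor_eq_of_eq_bot [Module.Finite k B] {U : X.Opens} (h : U = ⊥) (s t : Γ(X, U) ⊗[k] B) :
    s = t := by
  subst h
  exact tensorRes_ext fun x hx => hx.elim

end PullMap

/-! ### From charts to sheaves -/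

section OrbitMap

/-- A morphism of toric varieties which on the charts is given by maps of coordinate rings, and
whose image is disjoint from the remaining charts. -/
structure OrbitMap (k : Type u) [Field k] {N₁ N : Type u} [AddCommGroup N₁] [AddCommGroup N]
    (F₁ : Fan N₁) (F : Fan N) where
  hom : F₁.variety k ⟶ F.variety k
  isOver : hom.IsOver (Spec (.of k))
  meets : F.cones → Prop
  cone : ∀ σ, meets σ → F₁.cones
  ring : ∀ σ (h : meets σ), CoordRing k σ.1 →ₐ[k] CoordRing k (cone σ h).1
  preimage_le : ∀ σ (h : meets σ) {V}, V ≤ F.chartOpen k σ →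
    hom ⁻¹ᵁ V ≤ F₁.chartOpen k (cone σ h)
  preimage_eq_bot : ∀ σ, ¬ meets σ → ∀ {V}, V ≤ F.chartOpen k σ → hom ⁻¹ᵁ V = ⊥
  preimage_chartBasic : ∀ σ (h : meets σ) f,
    hom ⁻¹ᵁ F.chartBasic k σ f = F₁.chartBasic k (cone σ h) (ring σ h f)
  pullHom_chartHom : ∀ σ (h : meets σ) {V} (hV : V ≤ F.chartOpen k σ) a,
    pullHom k hom V (F.chartHom k σ hV a) =
      F₁.chartHom k (cone σ h) (preimage_le σ h hV) (ring σ h a)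

attribute [instance] OrbitMap.isOver

namespace OrbitMap

variable {k : Type u} [Field k] {N₁ N : Type u} [AddCommGroup N₁] [AddCommGroup N]
  {F₁ : Fan N₁} {F : Fan N} (D : OrbitMap k F₁ F) {B B' : Type u} [Ring B] [Algebra k B] [Ring B']
  [Algebra k B']

/-- The map `k[M ∩ σ^∨] ⊗ B → k[M₁ ∩ σ₁^∨] ⊗ B'` on a chart. -/
noncomputable def chartRes (ℓ : B →ₗ[k] B') (σ : F.cones) (h : D.meets σ) :
    CoordRing k σ.1 ⊗[k] B →ₗ[k] CoordRing k (D.cone σ h).1 ⊗[k] B' :=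
  TensorProduct.map (D.ring σ h).toLinearMap ℓ

lemma chartRes_smul (ℓ : B →ₗ[k] B') (σ : F.cones) (h : D.meets σ) (a : CoordRing k σ.1)
    (t : CoordRing k σ.1 ⊗[k] B) :
    D.chartRes ℓ σ h (a • t) = D.ring σ h a • D.chartRes ℓ σ h t :=
  tensorMap_linear_smul _ _ _ _

lemma pullMap_chartMap (ℓ : B →ₗ[k] B') (σ : F.cones) (h : D.meets σ) {V : (F.variety k).Opens}
    (hV : V ≤ F.chartOpen k σ) (t : CoordRing k σ.1 ⊗[k] B) :
    pullMap D.hom ℓ V (F.chartMap k B σ hV t) =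
      F₁.chartMap k B' (D.cone σ h) (D.preimage_le σ h hV) (D.chartRes ℓ σ h t) := by
  induction t using TensorProduct.induction_on with
  | zero => simp only [map_zero]
  | add x y hx hy => simp only [map_add, hx, hy]
  | tmul a b =>
    rw [F.chartMap_tmul k, pullMap, TensorProduct.map_tmul, AlgHom.toLinearMap_apply,
      D.pullHom_chartHom σ h]
    rfl

lemma isUnit_pullHom (σ : F.cones) {f : CoordRing k σ.1} {V : (F.variety k).Opens}
    (hV : V ≤ F.chartBasic k σ f) :
    IsUnit (pullHom k D.hom V (F.chartHom k σ (hV.trans (F.chartBasic_le k σ f)) f)) :=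
  (F.isUnit_chartHom k σ hV).map _

variable {N' : Type u} [AddCommGroup N'] [Module.Free ℤ N] [Module.Finite ℤ N]
  [Module.Free ℤ N₁] [Module.Finite ℤ N₁] {π : N →ₗ[ℤ] N'} {π₁ : N₁ →ₗ[ℤ] N'} {p r q : ℕ}

omit [Module.Free ℤ N₁] in
-- Locally a section of `W_r` is, up to the unit `f ^ n`, given by an element of the graded module
-- of a chart, and the claim is known there.
lemma pullMap_mem_omegaTilde {ℓ : Wedge k π →ₗ[k] Wedge k π₁}
    (hℓ : ∀ (σ : F.cones) (h : D.meets σ), ∀ t ∈ F.weightPart k π σ.1 r q,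
      D.chartRes ℓ σ h t ∈ F₁.tildePart k π₁ (D.cone σ h).1 q) (hp : r + q = p)
    {U : (F.variety k).Opens} {s : Γ(F.variety k, U) ⊗[k] Wedge k π}
    (hs : s ∈ (F.weight k π p r).sec U) :
    pullMap D.hom ℓ U s ∈ (F₁.omegaTilde k π₁ q).sec (D.hom ⁻¹ᵁ U) := by
  refine (F₁.omegaTilde k π₁ q).local_mem fun y hy => ?_
  obtain ⟨σ, hσ⟩ := F.exists_mem_chartOpen k (D.hom y)
  have h : D.meets σ := by
    by_contra h
    exact (D.preimage_eq_bot σ h (le_refl (F.chartOpen k σ))).le (show y ∈ D.hom ⁻¹ᵁ _ from hσ)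
  obtain ⟨f, hf, hfU, n, t, ht, hts⟩ := F.exists_mem_weightPart σ hy hσ hp hs
  refine ⟨_, preimage_opens_mono D.hom hfU, hf, ?_⟩
  rw [pullMap_tensorRes D.hom ℓ hfU]
  refine (Submodule.smul_mem_iff_of_isUnit _ ((D.isUnit_pullHom σ le_rfl).pow n)).1 ?_
  rw [← map_pow, ← pullMap_smul, ← hts, D.pullMap_chartMap ℓ σ h]
  exact F₁.chartMap_mem_omegaTilde _ _ (hℓ σ h t ht)

omit [Module.Free ℤ N₁] [Module.Finite ℤ N₁] in
lemma pullMap_mul [Module.Finite k B'] {ℓ ℓ' : Wedge k π →ₗ[k] B'} (c : k) (η : Wedge k π)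
    (hℓ : ∀ (σ : F.cones) (h : D.meets σ), ∀ t ∈ F.tildePart k π σ.1 q,
      D.chartRes ℓ σ h ((1 ⊗ₜ η) * t) = c • D.chartRes ℓ' σ h t)
    {U : (F.variety k).Opens} {w : Γ(F.variety k, U) ⊗[k] Wedge k π}
    (hw : w ∈ (F.omegaTilde k π q).sec U) :
    pullMap D.hom ℓ U ((1 ⊗ₜ η) * w) = c • pullMap D.hom ℓ' U w := by
  refine tensorRes_ext fun y hy => ?_
  obtain ⟨σ, hσ⟩ := F.exists_mem_chartOpen k (D.hom y)
  have h : D.meets σ := by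
    by_contra h
    exact (D.preimage_eq_bot σ h (le_refl (F.chartOpen k σ))).le (show y ∈ D.hom ⁻¹ᵁ _ from hσ)
  obtain ⟨f, hf, hfU⟩ := F.exists_mem_chartBasic k σ hσ hy
  obtain ⟨n, t, ht, hts⟩ := F.exists_mem_tildePart σ f rfl (F.chartBasic_le k σ f)
    ((F.omegaTilde k π q).res_mem hfU hw)
  refine ⟨_, preimage_opens_mono D.hom hfU, hf, ?_⟩
  rw [map_smul, pullMap_tensorRes D.hom ℓ hfU, pullMap_tensorRes D.hom ℓ' hfU, map_mul, tensorRes_tmul, map_one]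
  have hu := (D.isUnit_pullHom σ (le_refl (F.chartBasic k σ f))).pow n
  refine hu.smul_left_cancel.1 ?_
  rw [smul_comm _ c, ← map_pow, ← pullMap_smul, ← pullMap_smul, ← mul_smul_comm, ← hts,
    D.pullMap_chartMap ℓ' σ h, ← map_smul, ← hℓ σ h t ht, ← D.pullMap_chartMap ℓ σ h (F.chartBasic_le k σ f),
    map_mul (F.chartMap k (Wedge k π) σ (F.chartBasic_le k σ f)), F.chartMap_tmul k, map_one]

end OrbitMap

section Family

variable {k : Type u} [Field k] {N N' : Type u} [AddCommGroup N] [AddCommGroup N']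
  [Module.Free ℤ N] [Module.Finite ℤ N] {F : Fan N} {π : N →ₗ[ℤ] N'}
  {ι : Type*} [Finite ι] {N₁ : ι → Type u} [∀ i, AddCommGroup (N₁ i)]
  {F₁ : ∀ i, Fan (N₁ i)} (D : ∀ i, OrbitMap k (F₁ i) F) {p r q : ℕ}

lemma smul_smul_of_mul_eq_one {R C : Type*} [Monoid R] [MulAction R C] {a b : R} (h : a * b = 1)
    (x : C) : a • b • x = x := by
  rw [smul_smul, h, one_smul]

lemma exists_uniform {ι : Type*} [Finite ι] {P : ι → ℕ → Prop} (h : ∀ i, ∃ n, P i n)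
    (hP : ∀ i m n, P i n → P i (m + n)) : ∃ n, ∀ i, P i n := by
  cases nonempty_fintype ι
  choose n hn using h
  refine ⟨∑ i, n i, fun i => ?_⟩
  classical
  rw [← Finset.sum_erase_add _ _ (Finset.mem_univ i)]
  exact hP _ _ _ (hn i)

lemma mem_weight_pred_of_pullMap_eq_zero {B' : ι → Type u} [∀ i, Ring (B' i)]
    [∀ i, Algebra k (B' i)] [∀ i, Module.Finite k (B' i)] {ℓ : ∀ i, Wedge k π →ₗ[k] B' i}
    (hℓ : ∀ σ : F.cones, ∀ t ∈ F.weightPart k π σ.1 r q, (∀ i h, (D i).chartRes (ℓ i) σ h t = 0) →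
      t ∈ F.weightBelowPart k π σ.1 r q) (hp : r + q = p)
    {U : (F.variety k).Opens} {s : Γ(F.variety k, U) ⊗[k] Wedge k π}
    (hs : s ∈ (F.weight k π p r).sec U) (h0 : ∀ i, pullMap (D i).hom (ℓ i) U s = 0) :
    s ∈ (F.weight k π p ((r : ℤ) - 1)).sec U := by
  refine (F.weight k π p ((r : ℤ) - 1)).local_mem fun x hx => ?_
  obtain ⟨σ, hσ⟩ := F.exists_mem_chartOpen k x
  obtain ⟨f, hf, hfU, n, t, ht, hts⟩ := F.exists_mem_weightPart σ hx hσ hp hs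
  -- Vanishing over `D(f)` means vanishing on the chart after multiplication by a power of `f`; one
  -- power works for the finitely many orbit closures.
  obtain ⟨m, hm⟩ : ∃ m, ∀ i h, (D i).chartRes (ℓ i) σ h (f ^ m • t) = 0 := by
    refine exists_uniform (P := fun i m => ∀ h, (D i).chartRes (ℓ i) σ h (f ^ m • t) = 0)
      (fun i => ?_) fun i m n hn h => ?_
    · by_cases h : (D i).meets σ
      · have h1 : (F₁ i).chartMap k (B' i) ((D i).cone σ h)
            ((D i).preimage_le σ h (F.chartBasic_le k σ f)) ((D i).chartRes (ℓ i) σ h t) = 0 := by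
          rw [← (D i).pullMap_chartMap (ℓ i) σ h (F.chartBasic_le k σ f), hts, pullMap_smul,
            ← pullMap_tensorRes (D i).hom (ℓ i) hfU, h0, map_zero,
            smul_zero]
        obtain ⟨m, hm⟩ := (F₁ i).chartMap_eq_zero k _ ((D i).preimage_chartBasic σ h f) _ h1
        refine ⟨m, fun h' => ?_⟩
        rw [(D i).chartRes_smul, map_pow]
        exact hm
      · exact ⟨0, fun h' => (h h').elim⟩
    · rw [pow_add, mul_smul, (D i).chartRes_smul, hn, smul_zero]
  refine ⟨_, hfU, hf, F.mem_of_pow_smul_mem σ le_rfl _ (n := m + n) ?_⟩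
  rw [pow_add, mul_smul, ← hts, ← map_pow, ← F.chartMap_smul k]
  exact F.chartMap_mem_weight_pred σ _ hp (hℓ σ _ (F.smul_mem_weightPart π _ ht) hm)

variable [∀ i, Module.Free ℤ (N₁ i)] [∀ i, Module.Finite ℤ (N₁ i)]
  {π₁ : ∀ i, N₁ i →ₗ[ℤ] N'}

omit [Module.Free ℤ N] in
lemma exists_pullMap_eq {ℓ : ∀ i, Wedge k π →ₗ[k] Wedge k (π₁ i)}
    (hℓ : ∀ (σ : F.cones) (t' : ∀ i h, CoordRing k ((D i).cone σ h).1 ⊗[k] Wedge k (π₁ i)),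
      (∀ i h, t' i h ∈ (F₁ i).tildePart k (π₁ i) ((D i).cone σ h).1 q) →
      ∃ t ∈ F.weightPart k π σ.1 r q, ∀ i h, (D i).chartRes (ℓ i) σ h t = t' i h) (hp : r + q = p)
    {U : (F.variety k).Opens} {w : ∀ i, Γ((F₁ i).variety k, (D i).hom ⁻¹ᵁ U) ⊗[k] Wedge k (π₁ i)}
    (hw : ∀ i, w i ∈ ((F₁ i).omegaTilde k (π₁ i) q).sec ((D i).hom ⁻¹ᵁ U)) {x : F.variety k}
    (hx : x ∈ U) : ∃ (V : (F.variety k).Opens) (hV : V ≤ U) (_ : x ∈ V),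
      ∃ s ∈ (F.weight k π p r).sec V, ∀ i, pullMap (D i).hom (ℓ i) V s =
        tensorRes (Wedge k (π₁ i)) (preimage_opens_mono (D i).hom hV) (w i) := by
  obtain ⟨σ, hσ⟩ := F.exists_mem_chartOpen k x
  obtain ⟨f, hf, hfU⟩ := F.exists_mem_chartBasic k σ hσ hx
  have hfσ := F.chartBasic_le k σ f
  -- The local targets are lifted to the charts of all orbit closures with a common power of `f`.
  obtain ⟨n, hn⟩ : ∃ n : ℕ, ∀ i, ∃ t' : ∀ h, CoordRing k ((D i).cone σ h).1 ⊗[k] Wedge k (π₁ i),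
      ∀ h, t' h ∈ (F₁ i).tildePart k (π₁ i) ((D i).cone σ h).1 q ∧
        (F₁ i).chartMap k _ ((D i).cone σ h) ((D i).preimage_le σ h hfσ) (t' h) =
          pullHom k (D i).hom _ (F.chartHom k σ hfσ f) ^ n •
            tensorRes (Wedge k (π₁ i)) (preimage_opens_mono (D i).hom hfU) (w i) := by
    refine exists_uniform (fun i => ?_) fun i m n ⟨t', ht'⟩ => ?_
    · by_cases h : (D i).meets σ
      · obtain ⟨n, t, ht, hts⟩ := (F₁ i).exists_mem_tildePart ((D i).cone σ h) ((D i).ring σ h f)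
          ((D i).preimage_chartBasic σ h f) ((D i).preimage_le σ h hfσ)
          (((F₁ i).omegaTilde k (π₁ i) q).res_mem (preimage_opens_mono (D i).hom hfU) (hw i))
        refine ⟨n, fun _ => t, fun _ => ⟨ht, ?_⟩⟩
        rw [(D i).pullHom_chartHom σ h]
        exact hts
      · exact ⟨0, fun h' => (h h').elim, fun h' => (h h').elim⟩
    · refine ⟨fun h => (D i).ring σ h f ^ m • t' h, fun h =>
        ⟨(F₁ i).smul_mem_tildePart (π₁ i) _ (ht' h).1, ?_⟩⟩
      rw [(F₁ i).chartMap_smul k, (ht' h).2, pow_add, mul_smul, map_pow,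
        (D i).pullHom_chartHom σ h]
  choose t' ht' using hn
  obtain ⟨t, ht, htt'⟩ := hℓ σ t' fun i h => (ht' i h).1
  -- The power of `f` introduced by the lifts is inverted on `D(f)`.
  obtain ⟨a, ha⟩ := ((F.isUnit_chartHom k σ (le_refl (F.chartBasic k σ f))).pow n).exists_left_inv
  refine ⟨_, hfU, hf, a • F.chartMap k _ σ hfσ t,
    Submodule.smul_mem _ _ (F.chartMap_mem_weight σ hfσ hp ht), fun i => ?_⟩
  by_cases h : (D i).meets σ
  · have key : pullHom k (D i).hom (F.chartBasic k σ f) a *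
        pullHom k (D i).hom (F.chartBasic k σ f) (F.chartHom k σ hfσ f) ^ n = 1 := by
      rw [← map_pow, ← map_mul, ha, map_one]
    rw [pullMap_smul, (D i).pullMap_chartMap (ℓ i) σ h, htt', (ht' i h).2]
    exact smul_smul_of_mul_eq_one key _
  · exact tensor_eq_of_eq_bot ((D i).preimage_eq_bot σ h hfσ) _ _

end Family

end OrbitMap

end Toric

/-! ### Morphisms of sheaves of modules -/

namespace AlgebraicGeometry.Scheme.Modules

variable {X : Scheme.{u}} {M N : X.Modules}

lemma mono_of_injective (φ : M ⟶ N) (h : ∀ U, Function.Injective (φ.app U)) : Mono φ where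
  right_cancellation f g hfg := by
    ext U s
    refine h U ?_
    exact congrArg (fun ψ => Hom.app ψ U s) hfg

lemma epi_of_locally_surjective (φ : M ⟶ N)
    (h : ∀ (U : X.Opens) (t : Γ(N, U)), ∀ x ∈ U, ∃ (V : X.Opens) (i : V ⟶ U) (_ : x ∈ V)
      (s : Γ(M, V)), φ.app V s = N.presheaf.map i.op t) : Epi φ where
  left_cancellation {K} f g hfg := by
    ext U t
    choose V i hx s hs using h U t
    refine TopCat.Sheaf.eq_of_locally_eq' ⟨K.presheaf, K.isSheaf⟩ (fun x : U => V x.1 x.2) U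
      (fun x => i x.1 x.2) (fun x hxU => Opens.mem_iSup.2 ⟨⟨x, hxU⟩, hx x hxU⟩) _ _ fun x => ?_
    have hf : K.presheaf.map (i x.1 x.2).op (f.app U t) = f.app _ (N.presheaf.map (i x.1 x.2).op t) :=
      (CategoryTheory.congr_fun (f.mapPresheaf.naturality (i x.1 x.2).op) t).symm
    have hg : K.presheaf.map (i x.1 x.2).op (g.app U t) = g.app _ (N.presheaf.map (i x.1 x.2).op t) :=
      (CategoryTheory.congr_fun (g.mapPresheaf.naturality (i x.1 x.2).op) t).symm
    change K.presheaf.map (i x.1 x.2).op (f.app U t) = K.presheaf.map (i x.1 x.2).op (g.app U t)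
    rw [hf, hg, ← hs]
    exact congrArg (fun ψ => Hom.app ψ _ (s x.1 x.2)) hfg

/-- The value of morphisms of sheaves of modules on a fixed section. -/
noncomputable def evalHom {U : X.Opens} (s : Γ(M, U)) : (M ⟶ N) →+ Γ(N, U) where
  toFun φ := φ.app U s
  map_zero' := rfl
  map_add' _ _ := rfl

/-- The identity of a finite biproduct is the sum of the composites of projections and inclusions,
and this can be evaluated on sections. -/
lemma biproduct_section_ext [HasFiniteBiproducts X.Modules] {J : Type u} [Finite J] {G : J → X.Modules}
    {U : X.Opens} {s t : Γ(⨁ G, U)}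
    (h : ∀ j, (biproduct.π G j).app U s = (biproduct.π G j).app U t) : s = t := by
  cases nonempty_fintype J
  have key : ∀ s : Γ(⨁ G, U), s = ∑ j, (biproduct.ι G j).app U ((biproduct.π G j).app U s) := by
    intro s
    have h0 : ∑ j, biproduct.π G j ≫ biproduct.ι G j = 𝟙 (⨁ G) := by
      refine biproduct.hom_ext _ _ fun i => ?_
      rw [Preadditive.sum_comp, Finset.sum_eq_single i, Category.assoc, biproduct.ι_π_self,
        Category.comp_id, Category.id_comp]
      · intro j _ hj
        rw [Category.assoc, biproduct.ι_π_ne _ hj, comp_zero]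
      · exact fun h => (h (Finset.mem_univ i)).elim
    have h1 := congrArg (evalHom s) h0
    rw [map_sum] at h1
    exact h1.symm
  rw [key s, key t]
  exact Finset.sum_congr rfl fun j _ => by rw [h j]

end AlgebraicGeometry.Scheme.Modules

/-! ### Morphisms of subsheaves of `𝒪 ⊗ B` -/

namespace Toric.SubSheaf

variable {k : Type u} [Field k] {X Y : Scheme.{u}} [X.Over (Spec (.of k))] [Y.Over (Spec (.of k))]
  {B B' : Type u} [Ring B] [Algebra k B] [Module.Finite k B] [Ring B'] [Algebra k B']
  [Module.Finite k B']

/-- The morphism to the direct image of a subsheaf of `𝒪_Y ⊗ B'` defined by the pullback of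
sections. -/
noncomputable def pullMor (f : Y ⟶ X) [f.IsOver (Spec (.of k))] (ℓ : B →ₗ[k] B')
    {F : SubSheaf k X B} {G : SubSheaf k Y B'}
    (h : ∀ U, ∀ s ∈ F.sec U, pullMap f ℓ U s ∈ G.sec (f ⁻¹ᵁ U)) :
    F.toModules ⟶ (Scheme.Modules.pushforward f).obj G.toModules where
  val := PresheafOfModules.homMk
    { app := fun U => AddCommGrpCat.ofHom
        { toFun := fun s => (⟨pullMap f ℓ U.unop s.1, h _ _ s.2⟩ : G.sec (f ⁻¹ᵁ U.unop))
          map_zero' := Subtype.ext (map_zero _)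
          map_add' := fun s t => Subtype.ext (map_add _ _ _) }
      naturality := fun U V i => by
        ext s
        exact Subtype.ext (pullMap_tensorRes f ℓ (leOfHom i.unop) s.1).symm }
    (fun U a s => Subtype.ext (pullMap_smul f ℓ U.unop a s.1))

omit [Y.Over (Spec (.of k))] [Module.Finite k B'] in
lemma val_injective (F : SubSheaf k X B) {U : X.Opens} :
    Function.Injective (F.val : Γ(F.toModules, U) → _) := Subtype.val_injective

lemma incl_pullMor_eq_zero (f : Y ⟶ X) [f.IsOver (Spec (.of k))] (ℓ : B →ₗ[k] B')
    {F F' : SubSheaf k X B} {G : SubSheaf k Y B'} (hF : ∀ U, F'.sec U ≤ F.sec U)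
    (h : ∀ U, ∀ s ∈ F.sec U, pullMap f ℓ U s ∈ G.sec (f ⁻¹ᵁ U))
    (h0 : ∀ U, ∀ s ∈ F'.sec U, pullMap f ℓ U s = 0) : incl hF ≫ pullMor f ℓ h = 0 := by
  ext U s
  exact G.val_injective (U := f ⁻¹ᵁ U) (h0 U _ s.2)

/-- A morphism to `G` whose values belong to a smaller subsheaf `F`, as a morphism to `F`. -/
noncomputable def lift {F G : SubSheaf k X B} {K : X.Modules} (φ : K ⟶ G.toModules)
    (h : ∀ U (s : Γ(K, U)), G.val (φ.app U s) ∈ F.sec U) : K ⟶ F.toModules where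
  val := PresheafOfModules.homMk
    { app := fun U => AddCommGrpCat.ofHom
        { toFun := fun s => (⟨G.val (φ.app U.unop s), h _ _⟩ : F.sec U.unop)
          map_zero' := Subtype.ext (congrArg G.val (map_zero (φ.app U.unop).hom))
          map_add' := fun s t => Subtype.ext (congrArg G.val (map_add (φ.app U.unop).hom s t)) }
      naturality := fun U V i => by
        ext s
        exact Subtype.ext (congrArg G.val
          (CategoryTheory.congr_fun (φ.mapPresheaf.naturality i) s)) }
    (fun U a s => Subtype.ext (congrArg G.val (φ.app_smul (U := U.unop) a s)))

lemma lift_incl {F G : SubSheaf k X B} (hFG : ∀ U, F.sec U ≤ G.sec U) {K : X.Modules}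
    (φ : K ⟶ G.toModules) (h : ∀ U (s : Γ(K, U)), G.val (φ.app U s) ∈ F.sec U) :
    lift φ h ≫ incl hFG = φ := rfl

instance {F G : SubSheaf k X B} (h : ∀ U, F.sec U ≤ G.sec U) : Mono (incl h) :=
  Scheme.Modules.mono_of_injective _ fun _ _ _ hst =>
    F.val_injective (congrArg G.val hst)

/-- A morphism to `G` that is killed by `φ` has all its values in `F`, hence factors through `F`; so
the inclusion is a kernel of `φ`. -/
lemma exact_incl {F G : SubSheaf k X B} (h : ∀ U, F.sec U ≤ G.sec U) {K : X.Modules}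
    (φ : G.toModules ⟶ K) (h0 : incl h ≫ φ = 0)
    (hφ : ∀ U (s : Γ(G.toModules, U)), φ.app U s = 0 → G.val s ∈ F.sec U) :
    (ShortComplex.mk (incl h) φ h0).Exact :=
  ShortComplex.exact_of_f_is_kernel _ (KernelFork.IsLimit.ofι' _ _ fun ψ hψ =>
    ⟨lift ψ fun U s => hφ U _ (congrArg (fun α => Scheme.Modules.Hom.app α U s) hψ),
      lift_incl h _ _⟩)

end Toric.SubSheaf

namespace ExteriorAlgebra

variable {k V : Type*} [Field k] [AddCommGroup V] [Module k V]

lemma iterContract_eq_zero_of_mem_weightBelow {I : Type*} {ℓ : I → Dual k V} {A : Set I} {r q : ℕ}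
    {f : Fin r → I} (hf : ∀ i, f i ∈ A) {x : ExteriorAlgebra k V} (hx : x ∈ weightBelow ℓ A r q) :
    iterContract (ℓ ∘ f) x = 0 := by
  cases r with
  | zero => rw [(Submodule.mem_bot k).1 hx, map_zero]
  | succ r =>
    exact iterContract_eq_zero_of_mem r.lt_succ_self
      (fun i _ hm => (mem_killed.1 hm).2 _ (hf i)) hx

end ExteriorAlgebra

namespace Toric

open ExteriorAlgebra

lemma OrbitMap.pullMap_eq_zero {k : Type u} [Field k] {N₁ N N' : Type u} [AddCommGroup N₁]
    [AddCommGroup N] [AddCommGroup N'] [Module.Finite ℤ N] [Module.Free ℤ N]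
    {F₁ : Fan N₁} {F : Fan N} (D : OrbitMap k F₁ F) {B' : Type u} [Ring B'] [Algebra k B']
    [Module.Finite k B'] {π : N →ₗ[ℤ] N'} {p r q : ℕ} {ℓ : Wedge k π →ₗ[k] B'}
    (hℓ : ∀ (σ : F.cones) (h : D.meets σ), ∀ t ∈ F.weightBelowPart k π σ.1 r q,
      D.chartRes ℓ σ h t = 0) (hp : r + q = p)
    {U : (F.variety k).Opens} {s : Γ(F.variety k, U) ⊗[k] Wedge k π}
    (hs : s ∈ (F.weight k π p ((r : ℤ) - 1)).sec U) : pullMap D.hom ℓ U s = 0 := by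
  refine tensorRes_ext fun y hy => ?_
  obtain ⟨σ, hσ⟩ := F.exists_mem_chartOpen k (D.hom y)
  have h : D.meets σ := by
    by_contra h
    exact (D.preimage_eq_bot σ h (le_refl (F.chartOpen k σ))).le (show y ∈ D.hom ⁻¹ᵁ _ from hσ)
  obtain ⟨f, hf, hfU, n, t, ht, hts⟩ := F.exists_mem_weightBelowPart σ hy hσ hp hs
  refine ⟨_, preimage_opens_mono D.hom hfU, hf, ?_⟩
  rw [pullMap_tensorRes D.hom ℓ hfU, map_zero]
  have hu := (D.isUnit_pullHom σ (le_refl (F.chartBasic k σ f))).pow n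
  refine hu.smul_eq_zero.1 ?_
  rw [← map_pow, ← pullMap_smul, ← hts, D.pullMap_chartMap ℓ σ h, hℓ σ h t ht, map_zero]

lemma tensorMap_comp {k A R B B' B'' : Type*} [Field k] [CommRing A] [Algebra k A] [CommRing R]
    [Algebra k R] [Ring B] [Algebra k B] [Ring B'] [Algebra k B'] [Ring B''] [Algebra k B'']
    (φ : A →ₐ[k] R) (ℓ : B →ₗ[k] B') (m : B' →ₐ[k] B'') (t : A ⊗[k] B) :
    TensorProduct.map φ.toLinearMap (m.toLinearMap ∘ₗ ℓ) t =
      Algebra.TensorProduct.map (AlgHom.id k R) m (TensorProduct.map φ.toLinearMap ℓ t) := by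
  induction t using TensorProduct.induction_on with
  | zero => simp
  | add x y hx hy => simp only [map_add, hx, hy]
  | tmul a b => rfl

/-! ### The Poincaré residue and its exact sequence -/

section Main

variable {k : Type u} [Field k] {N N' : Type u} [AddCommGroup N] [AddCommGroup N']
  [Module.Free ℤ N] [Module.Finite ℤ N] [Module.Free ℤ N']
  {F : Fan N} {π : N →ₗ[ℤ] N'} {r : ℕ}

variable (k) in
/-- The closed immersion of an orbit closure, with its maps of coordinate rings. -/
noncomputable def Fan.orbitMap (τ : F.relCones π r) : OrbitMap k (F.star τ.1 τ.2.1) F where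
  hom := F.starι k τ.1 τ.2.1
  isOver := inferInstance
  meets σ := τ.1 ≤ σ.1
  cone σ h := F.starPt τ.1 τ.2.1 σ h
  ring σ h := F.starRing k τ.1 τ.2.1 σ h
  preimage_le σ h _ hV := F.starι_preimage_le k τ.1 τ.2.1 σ h hV
  preimage_eq_bot σ h _ hV := F.starι_preimage_eq_bot k τ.1 τ.2.1 σ h hV
  preimage_chartBasic σ h f := F.starι_preimage_chartBasic k τ.1 τ.2.1 σ h f
  pullHom_chartHom σ h _ hV a := F.pullHom_chartHom k τ.1 τ.2.1 σ h hV a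

variable (hF : F.IsSimplicial) (hm : (F.totalMult : k) ≠ 0) {v : F.relCones π r → Fin r → LinearMap.ker π}
  (hv : ∀ τ, F.IsRayOrdering τ.1 (v τ))
  {g : ∀ τ : F.relCones π r, RelM k π →ₗ[k] RelM k (F.starMap π τ)} (hg : ∀ τ, F.IsRelProj τ (g τ))
  {p q : ℕ} (hp : r + q = p)

include hF hm hv hg hp in
lemma Fan.residue_mem (τ : F.relCones π r) (U : (F.variety k).Opens)
    (s : Γ(F.variety k, U) ⊗[k] Wedge k π) (hs : s ∈ (F.weight k π p r).sec U) :
    pullMap (F.starι k τ.1 τ.2.1) (F.resOp (v τ) (g τ)) U s ∈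
      ((F.star τ.1 τ.2.1).omegaTilde k (F.starMap π τ) q).sec (F.starι k τ.1 τ.2.1 ⁻¹ᵁ U) :=
  (F.orbitMap k τ).pullMap_mem_omegaTilde (fun σ h _ ht =>
    F.starRes_mem_tildePart (hv τ) hF hm (hg τ).1 (hg τ).2 σ h ht) hp hs

include hF hm hv hg hp in
lemma Fan.mem_weight_pred_of_residue_eq_zero {U : (F.variety k).Opens}
    {s : Γ(F.variety k, U) ⊗[k] Wedge k π} (hs : s ∈ (F.weight k π p r).sec U)
    (h0 : ∀ τ : F.relCones π r,
      pullMap (F.starι k τ.1 τ.2.1) (F.resOp (v τ) (g τ)) U s = 0) :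
    s ∈ (F.weight k π p ((r : ℤ) - 1)).sec U :=
  mem_weight_pred_of_pullMap_eq_zero (fun τ => F.orbitMap k τ)
    (fun σ _ ht h => F.mem_weightBelowPart_of_starRes hF hm hv hg σ ht h) hp hs h0

omit [Module.Free ℤ N] [Module.Finite ℤ N] in
lemma Fan.resOp_eq_zero {τ : F.relCones π r} {v : Fin r → LinearMap.ker π}
    {g : RelM k π →ₗ[k] RelM k (F.starMap π τ)} {x : Wedge k π}
    (h : iterContract (rayForm k π ∘ v) x = 0) : F.resOp v g x = 0 :=
  (congrArg (map g).toLinearMap h).trans (LinearMap.map_zero _)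

lemma eq_zero_of_gradedComp {G B : Type*} [AddCommMonoid G] [AddCommGroup B] [Module k B]
    {t : AddMonoidAlgebra k G ⊗[k] B} (h : ∀ u, gradedComp u t = 0) : t = 0 :=
  ext_gradedComp fun u => (h u).trans (map_zero _).symm

omit [Module.Free ℤ N] [Module.Finite ℤ N] in
include hv in
lemma Fan.starRes_eq_zero (σ : F.cones) (τ : F.relCones π r) (h : τ.1 ≤ σ.1)
    {t : CoordRing k σ.1 ⊗[k] Wedge k π} (ht : t ∈ F.weightBelowPart k π σ.1 r q) :
    F.starRes (v τ) (g τ) σ h t = 0 := by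
  refine eq_zero_of_gradedComp fun u' => ?_
  have h1 := mem_gradedPart.1 ht ⟨u'.1 ∘ₗ (lat τ.1).mkQ, comp_mkQ_mem_dualMonoid u'.2⟩
  exact (F.gradedComp_starRes σ h u' t).trans (F.resOp_eq_zero
    (iterContract_eq_zero_of_mem_weightBelow (f := v τ)
      (fun i => F.mem_relRays_of_mem_rayGens h ((hv τ).mem i) u'.1) h1))

include hv hp in
lemma Fan.residue_eq_zero (τ : F.relCones π r) {U : (F.variety k).Opens}
    {s : Γ(F.variety k, U) ⊗[k] Wedge k π} (hs : s ∈ (F.weight k π p ((r : ℤ) - 1)).sec U) :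
    pullMap (F.starι k τ.1 τ.2.1) (F.resOp (v τ) (g τ)) U s = 0 :=
  (F.orbitMap k τ).pullMap_eq_zero (fun σ h _ ht => F.starRes_eq_zero hv σ τ h ht) hp hs

include hF hm hv hg hp in
lemma Fan.exists_residue_eq {U : (F.variety k).Opens}
    {w : ∀ τ : F.relCones π r, Γ((F.star τ.1 τ.2.1).variety k, F.starι k τ.1 τ.2.1 ⁻¹ᵁ U) ⊗[k]
      Wedge k (F.starMap π τ)}
    (hw : ∀ τ : F.relCones π r, w τ ∈ ((F.star τ.1 τ.2.1).omegaTilde k (F.starMap π τ) q).sec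
      (F.starι k τ.1 τ.2.1 ⁻¹ᵁ U)) {x : F.variety k} (hx : x ∈ U) :
    ∃ (V : (F.variety k).Opens) (hV : V ≤ U) (_ : x ∈ V), ∃ s ∈ (F.weight k π p r).sec V,
      ∀ τ : F.relCones π r, pullMap (F.starι k τ.1 τ.2.1) (F.resOp (v τ) (g τ)) V s =
        tensorRes (Wedge k (F.starMap π τ))
          (preimage_opens_mono (F.starι k τ.1 τ.2.1) hV) (w τ) :=
  exists_pullMap_eq (fun τ => F.orbitMap k τ)
    (fun σ t' ht' => F.exists_starRes_eq hF hm hv hg σ t' ht') hp hw hx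

include hF hm hv hg in
-- The comparison takes place in `⋀ M_{π,k}`, where the pullback of `w` has its coefficients; this
-- is why `relIncl` is applied to the residue.
lemma Fan.residue_mul (τ : F.relCones π r) (η : ⋀[k]^r (RelM k π)) {U : (F.variety k).Opens}
    {w : Γ(F.variety k, U) ⊗[k] Wedge k π} (hw : w ∈ (F.omegaTilde k π q).sec U) :
    pullMap (F.starι k τ.1 τ.2.1) ((map (F.relIncl k π τ)).toLinearMap ∘ₗ F.resOp (v τ) (g τ)) U
        ((1 ⊗ₜ (η : Wedge k π)) * w) =
      residueForm k π (v τ) η • pullMap (F.starι k τ.1 τ.2.1) LinearMap.id U w :=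
  (F.orbitMap k τ).pullMap_mul _ _ (fun σ h t ht => by
    refine Eq.trans ?_ (F.starRes_mul hF hm hv hg σ τ h η ht)
    exact tensorMap_comp _ _ _ _) hw

/-- The Poincaré residue along the orbit closure of `τ`. -/
noncomputable def Fan.residueAt (τ : F.relCones π r) :
    (F.weight k π p r).toModules ⟶ F.starForms k π q τ :=
  SubSheaf.pullMor (F.starι k τ.1 τ.2.1) (F.resOp (v τ) (g τ)) (F.residue_mem hF hm hv hg hp τ)

/-- The Poincaré residue. -/
noncomputable def Fan.residue : (F.weight k π p r).toModules ⟶ ⨁ F.starForms k π (r := r) q :=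
  biproduct.lift (F.residueAt hF hm hv hg hp)

lemma Fan.residue_π (τ : F.relCones π r) :
    F.residue hF hm hv hg hp ≫ biproduct.π (F.starForms k π (r := r) q) τ =
      F.residueAt hF hm hv hg hp τ :=
  biproduct.lift_π _ τ

lemma Fan.val_residue (τ : F.relCones π r) {U : (F.variety k).Opens}
    (s : Γ((F.weight k π p r).toModules, U)) :
    SubSheaf.val (U := F.starι k τ.1 τ.2.1 ⁻¹ᵁ U)
      ((F.star τ.1 τ.2.1).omegaTilde k (F.starMap π τ) q)
      ((biproduct.π (F.starForms k π (r := r) q) τ).app U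
        ((F.residue hF hm hv hg hp).app U s)) =
      pullMap (F.starι k τ.1 τ.2.1) (F.resOp (v τ) (g τ)) U (SubSheaf.val _ s) := by
  exact congrArg (fun φ => SubSheaf.val (U := F.starι k τ.1 τ.2.1 ⁻¹ᵁ U)
    ((F.star τ.1 τ.2.1).omegaTilde k (F.starMap π τ) q) (Scheme.Modules.Hom.app φ U s))
    (F.residue_π hF hm hv hg hp τ)

lemma Fan.isResidue_residue : F.IsResidue k π v (F.residue hF hm hv hg hp) := by
  intro τ U η w hw s hs
  refine (congrArg (Algebra.TensorProduct.map (AlgHom.id k _) (map (F.relIncl k π τ)))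
    ((F.val_residue hF hm hv hg hp τ s).trans (congrArg _ hs))).trans ?_
  exact (tensorMap_comp _ _ _ _).symm.trans (F.residue_mul hF hm hv hg τ η hw)

lemma Fan.incl_residue (hW : ∀ U, (F.weight k π p ((r : ℤ) - 1)).sec U ≤ (F.weight k π p r).sec U) :
    SubSheaf.incl hW ≫ F.residue hF hm hv hg hp = 0 := by
  refine biproduct.hom_ext _ _ fun τ => ?_
  rw [Category.assoc, F.residue_π, zero_comp]
  exact SubSheaf.incl_pullMor_eq_zero _ _ hW (F.residue_mem hF hm hv hg hp τ) fun U s hs =>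
    F.residue_eq_zero hv hp τ hs

/-- Exactness in the middle holds on sections over every open set, whereas surjectivity holds only
locally: sections on the orbit closures are lifted on principal open subsets of charts. -/
lemma Fan.shortExact_residue
    (hW : ∀ U, (F.weight k π p ((r : ℤ) - 1)).sec U ≤ (F.weight k π p r).sec U) :
    (ShortComplex.mk (SubSheaf.incl hW) (F.residue hF hm hv hg hp)
      (F.incl_residue hF hm hv hg hp hW)).ShortExact where
  exact := SubSheaf.exact_incl hW _ _ fun U s hs =>
    F.mem_weight_pred_of_residue_eq_zero hF hm hv hg hp s.2 fun τ => by
      refine (F.val_residue hF hm hv hg hp τ s).symm.trans ?_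
      rw [hs, map_zero]
      rfl
  mono_f := inferInstanceAs (Mono (SubSheaf.incl hW))
  epi_g := by
    refine Scheme.Modules.epi_of_locally_surjective _ fun U t x hx => ?_
    obtain ⟨V, hV, hxV, s, hs, hst⟩ := F.exists_residue_eq hF hm hv hg hp
      (w := fun τ => SubSheaf.val (U := F.starι k τ.1 τ.2.1 ⁻¹ᵁ U)
        ((F.star τ.1 τ.2.1).omegaTilde k (F.starMap π τ) q)
        ((biproduct.π (F.starForms k π (r := r) q) τ).app U t))
      (fun τ => Subtype.property _) hx
    refine ⟨V, homOfLE hV, hxV, (⟨s, hs⟩ : (F.weight k π p r).sec V),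
      Scheme.Modules.biproduct_section_ext fun τ => SubSheaf.val_injective _ ?_⟩
    refine (F.val_residue hF hm hv hg hp τ _).trans ((hst τ).trans ?_)
    exact congrArg (SubSheaf.val (U := F.starι k τ.1 τ.2.1 ⁻¹ᵁ V)
      ((F.star τ.1 τ.2.1).omegaTilde k (F.starMap π τ) q)) (CategoryTheory.congr_fun
      ((biproduct.π (F.starForms k π (r := r) q) τ).mapPresheaf.naturality (homOfLE hV).op) t).symm

end Main

end Toric
/-- The exact sequence of the Poincaré residue on a simplicial toric variety `P = P_Σ`, relative to
an equivariant morphism `P ⟶ A` to the affine toric variety of a cone `σ'`. -/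
theorem mainTheorem5 {k : Type u} [Field k] [IsAlgClosed k]
    {N N' : Type u} [AddCommGroup N] [Module.Free ℤ N] [Module.Finite ℤ N]
    [AddCommGroup N'] [Module.Free ℤ N'] [Module.Finite ℤ N']
    (F : Toric.Fan N) (hF : F.IsSimplicial) (hm : (F.totalMult : k) ≠ 0)
    (σ' : Toric.Cone N') (hσ' : Toric.IsRationalPolyhedral σ') (hσ'' : Toric.IsStronglyConvex σ')
    (π : N →ₗ[ℤ] N') (hπ : ∀ σ ∈ F.cones, ∀ x ∈ σ, π.baseChange ℝ x ∈ σ')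
    (p r : ℕ) (hr : r ≤ p)
    (v : F.relCones π r → Fin r → LinearMap.ker π) (hv : ∀ τ, F.IsRayOrdering τ.1 (v τ)) :
    ∃ (hW : ∀ U, (F.weight k π p ((r : ℤ) - 1)).sec U ≤ (F.weight k π p r).sec U)
      (Res : (F.weight k π p r).toModules ⟶ ⨁ F.starForms k π (r := r) (p - r)),
      F.IsResidue k π v Res ∧
      ∃ h0 : Toric.SubSheaf.incl hW ≫ Res = 0,
        (ShortComplex.mk (Toric.SubSheaf.incl hW) Res h0).ShortExact := by
  -- The retractions are auxiliary: by `Fan.map_relIncl_resOp` and the injectivity of `relIncl`, the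
  -- residue on `W_r` does not depend on them.
  choose g hg using fun τ : F.relCones π r => F.exists_relProj (k := k) (π := π) τ hF hm
  have hp := Nat.add_sub_of_le hr
  exact ⟨fun U => F.weight_pred_le hF hm π hr U, F.residue hF hm hv hg hp,
    F.isResidue_residue hF hm hv hg hp, F.incl_residue hF hm hv hg hp _,
    F.shortExact_residue hF hm hv hg hp _⟩
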